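/- **Setting.** Let $L,r>0$, $1<p<2$, let $S=\{x'=(x_2,x_3):|x'|<r\}$, $\Omega=(-L,L)\times S$, with points $x=(x_1,x')$, and let $b\in\mathbb R^3$ with $|b|=1$. Let $\Gamma$ be a simple, relatively closed Lipschitz curve of finite length in $S$, that is, either a closed loop contained in $S$, or an arc inside $S$ with both end points on $\partial S$; let $\dot\Gamma$ be its unit tangent for a fixed orientation. We identify $\Gamma$ with $\{0\}\times\Gamma\subset\{x_1=0\}$. For an open set $U\subset\mathbb R\times S$, a vector $\beta\in\mathbb R^3$ and $F:U\to\mathbb R^{3\times3}$, the equation $\operatorname{curl}F=-\beta\otimes\dot\Gamma\,d\mathcal H^1\llcorner\Gamma$ is understood row by row in the sense of distributions in $U$, i.e. $\int_U\sum_jF_{ij}(\operatorname{curl}\varphi)_j\,dx=-\beta_i\int_\Gamma\varphi\cdot\dot\Gamma\,d\mathcal H^1$ for all $\varphi\in C_c^\infty(U;\mathbb R^3)$ and $i=1,2,3$. Let $H\in\mathbb R^{3\times3}$ with $\det H>0$, and let $W(x,A)=W_1(A)$ if $x_1<0$ and $W(x,A)=W_2(A)$ if $x_1>0$, where, for $i=1,2$,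 with $K_1=SO(3)$ and $K_2=SO(3)H$: (i) $W_i:\mathbb R^{3\times3}\to[0,\infty)$ is continuous; (ii) $W_i(RA)=W_i(A)$ for all $A\in\mathbb R^{3\times3}$ and $R\in SO(3)$; (iii) there are $C_1,C_2>0$ such that for all $A\in\mathbb R^{3\times3}$ $$C_1\min\{\operatorname{dist}^2(A,K_i),|A|^p+1\}\le W_i(A)\le C_2\min\{\operatorname{dist}^2(A,K_i),|A|^p+1\}.$$ Here $|\cdot|$ is the Euclidean norm on matrices. For $h>0$ define the admissible class $$\mathcal F^{(h)}=\{F\in L^p(\Omega;\mathbb R^{3\times3}):\operatorname{curl}F=-h\,b\otimes\dot\Gamma\,d\mathcal H^1\llcorner\Gamma\ \text{ in }\Omega\},$$ and for a matrix field $F$ with columns $F^1,F^2,F^3$ put $F_h=(F^1\,|\,\tfrac1hF^2\,|\,\tfrac1hF^3)$. Let $$\gamma_H=\inf\Big\{\int_{(-M,M)\times S}W(x,F(x))\,dx\Big\},$$ the infimum being over all $M>0$ and all $F\in L^p_{loc}(\mathbb R\times S;\mathbb R^{3\times3})$ with $\operatorname{curl}F=-b\otimes\dot\Gamma\,d\mathcal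 H^1\llcorner\Gamma$ in $\mathbb R\times S$, $F=I$ a.e. where $x_1<-M$, and $F=H$ a.e. where $x_1>M$. **Theorem.** Let $F\in L^p((-L,L);\mathbb R^{3\times3})$ satisfy $F\in\operatorname{co}(SO(3))$ a.e. in $(-L,0)$ and $F\in\operatorname{co}(SO(3)H)$ a.e. in $(0,L)$, where $\operatorname{co}$ denotes the convex hull. Then there is a family $F^{(h)}\in\mathcal F^{(h)}$, $h>0$, such that, as $h\to0^+$, $$F^{(h)}_h\rightharpoonup F\quad\text{weakly in }L^p(\Omega;\mathbb R^{3\times3}),$$ where $F$ is regarded as a function of $x_1$ on $\Omega$, and $$\limsup_{h\to0^+}\frac1h\int_\Omega W(x,F^{(h)}_h(x))\,dx\le\gamma_H.$$ -/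

import Mathlib

open Set Filter Topology MeasureTheory
open scoped ContDiff

/-- Real `3 × 3` matrices. -/
abbrev Mat3 : Type := Matrix (Fin 3) (Fin 3) ℝ

/- `|A|`, distances between matrices and `L^p` norms of matrix fields refer to the Euclidean
(Frobenius) norm on `3 × 3` matrices. -/
attribute [local instance] Matrix.frobeniusNormedAddCommGroup Matrix.frobeniusNormedSpace

/-- The plane of the cross-section, with coordinates `x' = (x₂, x₃)`. -/
abbrev Plane : Type := EuclideanSpace ℝ (Fin 2)

/-- Three-dimensional space, whose points are written `x = (x₁, x')`. Only its Lebesgue measure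
and its smooth functions are used. -/
abbrev Space3 : Type := ℝ × Plane

/-- The open disk `S` of radius `r` centred at the origin. -/
def disk (r : ℝ) : Set Plane := Metric.ball 0 r

/-- The cylinder `I × S` over a set `I` of values of `x₁`. -/
def cyl (I : Set ℝ) (r : ℝ) : Set Space3 := I ×ˢ disk r

/-- The coordinate vectors `e₁, e₂, e₃`. -/
noncomputable def coordVec : Fin 3 → Space3 :=
  ![(1, 0), (0, EuclideanSpace.single 0 1), (0, EuclideanSpace.single 1 1)]

/-- The partial derivative `∂ⱼ φₖ` at `x`. -/
noncomputable def partialD (φ : Space3 → Fin 3 → ℝ) (j k : Fin 3) (x : Space3) : ℝ :=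
  fderiv ℝ φ x (coordVec j) k

/-- The classical curl of a smooth vector field. -/
noncomputable def curl (φ : Space3 → Fin 3 → ℝ) (x : Space3) : Fin 3 → ℝ :=
  ![partialD φ 1 2 x - partialD φ 2 1 x,
    partialD φ 2 0 x - partialD φ 0 2 x,
    partialD φ 0 1 x - partialD φ 1 0 x]

/-- `c : [0, ℓ] → ℝ²` is the arc-length parametrization of a simple, relatively closed Lipschitz
curve `Γ` of length `ℓ` in the disk `S`: either a closed loop contained in `S`, or an arc inside
`S` whose two end points lie on the boundary circle of `S`. -/
structure IsDislocationCurve (r ℓ : ℝ) (c : ℝ → Plane) : Prop where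
  length_pos : 0 < ℓ
  lipschitz : LipschitzOnWith 1 c (Icc 0 ℓ)
  unit_speed : ∀ᵐ s ∂(volume.restrict (Ioo 0 ℓ)), ‖deriv c s‖ = 1
  mem_disk : ∀ s ∈ Ioo 0 ℓ, c s ∈ disk r
  simple : InjOn c (Ioo 0 ℓ)
  ends : (c 0 = c ℓ ∧ c 0 ∈ disk r ∧ c 0 ∉ c '' Ioo 0 ℓ) ∨
    (c 0 ∈ Metric.sphere (0 : Plane) r ∧ c ℓ ∈ Metric.sphere (0 : Plane) r)

/-- The action `∫_Γ φ · Γ̇ dH¹` of the vector measure `Γ̇ dH¹⌞Γ` on a vector field `φ`; the curve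
`Γ`, with arc-length parametrization `c`, lies in the cross-section `{x₁ = 0}`, so that its
tangent vector is `Γ̇ = (0, c')`. -/
noncomputable def lineAction (ℓ : ℝ) (c : ℝ → Plane) (φ : Space3 → Fin 3 → ℝ) : ℝ :=
  ∫ s in (0 : ℝ)..ℓ, (φ (0, c s) 1 * deriv c s 0 + φ (0, c s) 2 * deriv c s 1)

/-- `curl F = - β ⊗ Γ̇ dH¹⌞Γ` in the sense of distributions on the open set `U`, where the curl of
a matrix field is taken row by row. -/
def HasDislocationCurl (U : Set Space3) (ℓ : ℝ) (c : ℝ → Plane)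
    (β : EuclideanSpace ℝ (Fin 3)) (F : Space3 → Mat3) : Prop :=
  ∀ φ : Space3 → Fin 3 → ℝ, ContDiff ℝ ∞ φ → HasCompactSupport φ → tsupport φ ⊆ U →
    ∀ i : Fin 3, ∫ x in U, ∑ j, F x i j * curl φ x j = -(β i * lineAction ℓ c φ)

/-- The class `𝓕^(h)` of admissible fields on `Ω = (-L, L) × S`. -/
def AdmissibleField (L r p : ℝ) (b : EuclideanSpace ℝ (Fin 3)) (ℓ : ℝ) (c : ℝ → Plane) (h : ℝ) :
    Set (Space3 → Mat3) :=
  {F | MemLp F (ENNReal.ofReal p) (volume.restrict (cyl (Ioo (-L) L) r)) ∧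
    HasDislocationCurl (cyl (Ioo (-L) L) r) ℓ c (h • b) F}

/-- The rescaled matrix `A_h = (A¹ | A²/h | A³/h)`, where `Aⁱ` is the `i`-th column of `A`. -/
noncomputable def rescale (h : ℝ) (A : Mat3) : Mat3 :=
  Matrix.of fun i j => if j = 0 then A i j else (1 / h) * A i j

/-- The rotation group `SO(3)` as a set of matrices. -/
def SO3 : Set Mat3 := {R | R ∈ Matrix.specialOrthogonalGroup (Fin 3) ℝ}

/-- The energy well `SO(3) H`. -/
def SO3mul (H : Mat3) : Set Mat3 := (fun R => R * H) '' SO3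

/-- The conditions on the energy density `W` of one of the two materials, with energy well `K`:
continuity, frame indifference, and two-sided growth
`C₁ (dist²(A, K) ∧ (|A|^p + 1)) ≤ W A ≤ C₂ (dist²(A, K) ∧ (|A|^p + 1))`. -/
structure IsEnergyDensity (p C₁ C₂ : ℝ) (K : Set Mat3) (W : Mat3 → ℝ) : Prop where
  continuous : Continuous W
  frame_indifferent : ∀ A : Mat3, ∀ R ∈ SO3, W (R * A) = W A
  lower : ∀ A : Mat3, C₁ * min (Metric.infDist A K ^ 2) (‖A‖ ^ p + 1) ≤ W A
  upper : ∀ A : Mat3, W A ≤ C₂ * min (Metric.infDist A K ^ 2) (‖A‖ ^ p + 1)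

/-- The density `W(x, A)` of the two-phase material: `W₁(A)` for `x₁ < 0`, `W₂(A)` for `x₁ > 0`. -/
noncomputable def density (W₁ W₂ : Mat3 → ℝ) (x : Space3) (A : Mat3) : ℝ :=
  if x.1 < 0 then W₁ A else W₂ A

/-- The elastic energy `∫_{I × S} W(x, F(x)) dx`, with values in `[0, ∞]`. -/
noncomputable def energy (W₁ W₂ : Mat3 → ℝ) (I : Set ℝ) (r : ℝ) (F : Space3 → Mat3) : ENNReal :=
  ∫⁻ x in cyl I r, ENNReal.ofReal (density W₁ W₂ x (F x))

/-- The class `𝓒` of fields in `L^p_loc(ℝ × S)` with `curl F = - b ⊗ Γ̇ dH¹⌞Γ`. -/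
def dislocatedFields (r p : ℝ) (b : EuclideanSpace ℝ (Fin 3)) (ℓ : ℝ) (c : ℝ → Plane) :
    Set (Space3 → Mat3) :=
  {F | (∀ K : Set Space3, IsCompact K → K ⊆ cyl univ r →
      MemLp F (ENNReal.ofReal p) (volume.restrict K)) ∧
    HasDislocationCurl (cyl univ r) ℓ c b F}

/-- The class `𝓒_M(P, Q)` of fields in `𝓒` that equal `P` for `x₁ < -M` and `Q` for `x₁ > M`. -/
def transitionFields (r p : ℝ) (b : EuclideanSpace ℝ (Fin 3)) (ℓ : ℝ) (c : ℝ → Plane)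
    (M : ℝ) (P Q : Mat3) : Set (Space3 → Mat3) :=
  {F | F ∈ dislocatedFields r p b ℓ c ∧
    (∀ᵐ x ∂(volume.restrict (cyl (Iio (-M)) r)), F x = P) ∧
    (∀ᵐ x ∂(volume.restrict (cyl (Ioi M) r)), F x = Q)}

/-- The transition cost `γ_H(R, Γ)`. -/
noncomputable def transitionCost (r p : ℝ) (W₁ W₂ : Mat3 → ℝ) (b : EuclideanSpace ℝ (Fin 3))
    (ℓ : ℝ) (c : ℝ → Plane) (R H : Mat3) : ENNReal :=
  ⨅ (M : ℝ) (_ : 0 < M) (F : Space3 → Mat3) (_ : F ∈ transitionFields r p b ℓ c M R H),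
    energy W₁ W₂ (Ioo (-M) M) r F

/-- Weak convergence in `L^p(U; ℝ^{3×3})`, for `1 < p < ∞`, of a family of `L^p` fields `F h` to
an `L^p` field `G` as `h → 0⁺`: convergence of the integrals against every field in `L^{p'}`,
where `p' = p / (p - 1)`. -/
def WeakLpConverges (U : Set Space3) (p : ℝ) (F : ℝ → Space3 → Mat3) (G : Space3 → Mat3) :
    Prop :=
  (∀ h : ℝ, 0 < h → MemLp (F h) (ENNReal.ofReal p) (volume.restrict U)) ∧
  MemLp G (ENNReal.ofReal p) (volume.restrict U) ∧
  ∀ Φ : Space3 → Mat3, MemLp Φ (ENNReal.ofReal (p / (p - 1))) (volume.restrict U) →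
    Tendsto (fun h => ∫ x in U, ∑ i, ∑ j, F h x i j * Φ x i j) (𝓝[>] 0)
      (𝓝 (∫ x in U, ∑ i, ∑ j, G x i j * Φ x i j))

/-!
The recovery fields superpose two independent constructions: an almost optimal transition profile,
squeezed to width `h` around the interface `x₁ = 0`, which carries the dislocation and all of the
energy, and fast axial oscillations between elements of the energy wells away from the interface,
which carry the weak limit and cost almost nothing.

*Transition profiles have finite energy.* Close up the dislocation curve, along the boundary circle
if it is an arc, to a simple closed Lipschitz curve in the plane. Its winding number `w` is bounded
(`exists_abs_windingNumber_le`): two nonzero values `m ≠ n`, about `p` and `q`, would let `(z - p)ⁿ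
(z - q)⁻ᵐ` extend, from the curve and its exterior, to a continuous nonvanishing function on the
plane with nonzero degree along large circles. By the Cauchy–Pompeiu formula and Fubini's theorem,
`w` is the density of a planar current whose boundary is the curve
(`integral_curve_eq_integral_dbar`, `IsDislocationCurve.exists_filling`). For `x₁ > 0` let `u` be
the average of `w` over the disk of radius `x₁`. Its gradient is at most a constant over `x₁`,
because `w` is bounded, and its integral over slices is bounded, because the curve has finite
length; so it is in `L^p` near `x₁ = 0` for `p < 2` (`IsCurveFilling.memLp_kernelAvg_partial`). As
`u` jumps by `w` across the interface, the gradient without its singular part has the prescribed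
curl (`IsDislocationCurve.exists_slip`). Adding a smooth deformation from the identity to `H` gives
an admissible transition field (`IsDislocationCurve.exists_transitionField`), so the infimum that
defines the transition cost is finite (`transitionCost_lt_top`). Conversely the growth condition
shows that a transition field of finite energy is in `L^p` up to the lateral boundary
(`memLp_sub_restState`).

*Oscillations.* Euler angles write `SO(3)` as the range of a smooth map on `ℝ³`. The averages of
that map along smooth compactly supported curves of angles form, up to closure, a convex set. So any
measurable field with values in the convex hull of `SO(3)` has a primitive uniformly close to that
of a smooth field of rotations that is the identity near the end points of the interval
(`exists_isTestCurve_primitive_close`, `exists_oscillation`). Integration by parts against smooth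
test functions turns closeness of primitives into weak convergence
(`tendsto_integral_cyl_of_primitive`).

*Superposition.* Let `T` be a transition field and `B` the deviation of an oscillating field from
the rest state, which vanishes near the interface. The recovery field is `T (x₁ / h, x') + B x₁ + h
D`, where `D` has only a first column, linear in `x'` and containing `B'`. It makes the oscillating
part a gradient in the original variables (`hasDislocationCurl_oscillation`), so that only `T`
contributes to the curl. For small `h` the field equals `T (x₁ / h, x')` where `T` is not in its
rest state. Elsewhere it is at distance `O(h)` from the wells, which costs `O(h²)`
(`exists_energy_recoveryField_le`). It is close to the oscillating field in `L^p`
(`tendsto_eLpNorm_recoveryField_sub`). A diagonal choice over better and better profiles and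
oscillations concludes (`exists_diagonal`).
-/

/-! ### Logarithms along a curve -/

/-- The logarithmic integral `∫₀ˢ γ' / (γ - z)`. -/
noncomputable def logIntegral (γ : ℝ → ℂ) (z : ℂ) (s : ℝ) : ℂ :=
  ∫ τ in (0 : ℝ)..s, deriv γ τ / (γ τ - z)

section Winding

variable {C : NNReal} {γ : ℝ → ℂ} {T : ℝ}

theorem exists_pos_le_norm_sub (hγ : LipschitzWith C γ) {z : ℂ} (hz : z ∉ γ '' Icc 0 T) :
    ∃ d > 0, ∀ s ∈ Icc 0 T, d ≤ ‖γ s - z‖ := by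
  have hK : IsClosed (γ '' Icc 0 T) := (isCompact_Icc.image hγ.continuous).isClosed
  obtain ⟨d, hd, hball⟩ := Metric.isOpen_iff.1 hK.isOpen_compl z hz
  refine ⟨d, hd, fun s hs => ?_⟩
  by_contra hlt
  push Not at hlt
  exact hball (by rwa [Metric.mem_ball, dist_eq_norm]) (mem_image_of_mem γ hs)

theorem measurable_deriv_div (hγ : LipschitzWith C γ) (z : ℂ) :
    Measurable fun s => deriv γ s / (γ s - z) :=
  (measurable_deriv γ).div (hγ.continuous.measurable.sub_const z)

theorem norm_deriv_div_le (hγ : LipschitzWith C γ) {z : ℂ} {d s : ℝ} (hd : 0 < d)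
    (hs : d ≤ ‖γ s - z‖) : ‖deriv γ s / (γ s - z)‖ ≤ C / d := by
  rw [norm_div]
  exact div_le_div₀ C.coe_nonneg (norm_deriv_le_of_lipschitz hγ) hd hs

theorem intervalIntegrable_deriv_div (hγ : LipschitzWith C γ) (hT : 0 ≤ T) {z : ℂ}
    (hz : z ∉ γ '' Icc 0 T) :
    IntervalIntegrable (fun s => deriv γ s / (γ s - z)) volume 0 T := by
  obtain ⟨d, hd, h⟩ := exists_pos_le_norm_sub hγ hz
  rw [intervalIntegrable_iff_integrableOn_Icc_of_le hT]
  refine Measure.integrableOn_of_bounded (M := C / d) (by simp)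
    (measurable_deriv_div hγ z).aestronglyMeasurable ?_
  filter_upwards [ae_restrict_mem measurableSet_Icc] with s hs
  exact norm_deriv_div_le hγ hd (h s hs)

theorem LipschitzWith.ae_hasDerivAt (hγ : LipschitzWith C γ) :
    ∀ᵐ s : ℝ, HasDerivAt γ (deriv γ s) s := by
  filter_upwards [hγ.ae_differentiableAt (μ := volume)] with s hs using hs.hasDerivAt

theorem lipschitzOnWith_logIntegral (hγ : LipschitzWith C γ) (hT : 0 ≤ T) {z : ℂ} {d : ℝ}
    (hd : 0 < d) (h : ∀ s ∈ Icc 0 T, d ≤ ‖γ s - z‖) (hz : z ∉ γ '' Icc 0 T) :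
    LipschitzOnWith (C / d.toNNReal) (logIntegral γ z) (Icc 0 T) := by
  have hint := intervalIntegrable_deriv_div hγ hT hz
  refine LipschitzOnWith.of_dist_le_mul fun s hs t ht => ?_
  have h0s : IntervalIntegrable (fun s => deriv γ s / (γ s - z)) volume 0 s :=
    hint.mono_set (by rw [uIcc_of_le hT, uIcc_of_le hs.1]; exact Icc_subset_Icc_right hs.2)
  have h0t : IntervalIntegrable (fun s => deriv γ s / (γ s - z)) volume 0 t :=
    hint.mono_set (by rw [uIcc_of_le hT, uIcc_of_le ht.1]; exact Icc_subset_Icc_right ht.2)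
  rw [dist_eq_norm, logIntegral, logIntegral, intervalIntegral.integral_interval_sub_left h0s h0t]
  rw [Real.dist_eq, NNReal.coe_div, Real.coe_toNNReal _ hd.le]
  refine intervalIntegral.norm_integral_le_of_norm_le_const fun x hx => ?_
  refine norm_deriv_div_le hγ hd (h x ?_)
  have := uIoc_subset_uIcc hx
  exact (uIcc_subset_Icc ht hs) this

/-- `exp ∫₀ˢ γ'/(γ - z)` follows `γ - z`: the quotient of the two is absolutely continuous and has
derivative zero almost everywhere. -/
theorem exp_logIntegral (hγ : LipschitzWith C γ) (hT : 0 ≤ T) {z : ℂ}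
    (hz : z ∉ γ '' Icc 0 T) {s : ℝ} (hs : s ∈ Icc 0 T) :
    Complex.exp (logIntegral γ z s) * (γ 0 - z) = γ s - z := by
  obtain ⟨d, hd, h⟩ := exists_pos_le_norm_sub hγ hz
  have hint := intervalIntegrable_deriv_div hγ hT hz
  have hL := lipschitzOnWith_logIntegral hγ hT hd h hz
  have hLc : ContinuousOn (logIntegral γ z) (Icc 0 T) := hL.continuousOn
  have hg : AbsolutelyContinuousOnInterval (fun s => Complex.exp (-logIntegral γ z s)) 0 T := by
    have hcomp : IsCompact ((fun s => -logIntegral γ z s) '' Icc 0 T) :=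
      isCompact_Icc.image_of_continuousOn hLc.neg
    obtain ⟨R, hR⟩ := hcomp.isBounded.subset_closedBall 0
    obtain ⟨K, hK⟩ := ((Complex.contDiff_exp (𝕜 := ℝ)).contDiffOn
      (s := Metric.closedBall 0 R)).exists_lipschitzOnWith (n := 1) (by decide)
      (convex_closedBall _ _) (isCompact_closedBall _ _)
    refine LipschitzOnWith.absolutelyContinuousOnInterval (K := K * (C / d.toNNReal)) ?_
    rw [uIcc_of_le hT]
    exact hK.comp (hL.neg) (fun s hs => hR (mem_image_of_mem _ hs))
  have hf : AbsolutelyContinuousOnInterval (fun s => γ s - z) 0 T := by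
    refine LipschitzOnWith.absolutelyContinuousOnInterval (K := C) ?_
    refine LipschitzOnWith.of_dist_le_mul fun s _ t _ => ?_
    simpa using hγ.dist_le_mul s t
  have hfg := hf.smul hg
  have hde : ∀ᵐ x, x ∈ uIcc 0 T →
      HasDerivAt ((fun s => γ s - z) • fun s => Complex.exp (-logIntegral γ z s)) 0 x := by
    filter_upwards [LipschitzWith.ae_hasDerivAt hγ, hint.ae_hasDerivAt_integral] with x h1 h2 hx
    have h3 := h2 hx 0 (by simp)
    have h4 := (h1.sub_const z).smul (h3.neg.cexp)
    refine h4.congr_deriv ?_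
    have hne : γ x - z ≠ 0 := by
      rw [uIcc_of_le hT] at hx
      intro h0
      have := h x hx
      rw [h0, norm_zero] at this
      linarith
    have key : ∀ a b e : ℂ, a ≠ 0 → a * (e * -(b / a)) + b * e = 0 := by
      intro a b e ha
      field_simp
      ring
    exact key _ _ _ hne
  obtain ⟨c, hc⟩ := hfg.const_of_ae_hasDerivAt_zero hde
  rw [uIcc_of_le hT] at hc
  have hL0 : logIntegral γ z 0 = 0 := by simp [logIntegral]
  have e0 : (γ 0 - z) * Complex.exp (-logIntegral γ z 0) = c := hc 0 ⟨le_rfl, hT⟩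
  have e1 : (γ s - z) * Complex.exp (-logIntegral γ z s) = c := hc s hs
  rw [hL0, neg_zero, Complex.exp_zero, mul_one] at e0
  rw [e0, ← e1, mul_left_comm, ← Complex.exp_add, add_neg_cancel, Complex.exp_zero, mul_one]

end Winding

/-! ### Winding numbers of simple closed Lipschitz curves -/

/-- A continuous nonvanishing function on the plane has degree zero along large circles: if
`(z - p)ᵐ (z - q)⁻ⁿ` on a set `K` has a continuous logarithm, and `p`, `q` lie in a bounded
open set `V` whose boundary is in `K`, then gluing the exponential of the logarithm inside `V` to
`(z - p)ᵐ (z - q)⁻ⁿ` outside gives such a function, of degree `m - n`. -/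
theorem eq_of_logarithm_on_frontier {K V : Set ℂ} (hVo : IsOpen V)
    (hVK : IsClosed (K ∪ V)) (hVb : Bornology.IsBounded V) {p q : ℂ}
    (hp : p ∈ V) (hq : q ∈ V) {m n : ℤ} {N : ℂ → ℂ} (hN : Continuous N)
    (hNK : ∀ z ∈ K, Complex.exp (N z) = (z - p) ^ m * (z - q) ^ (-n)) : m = n := by
  classical
  let Rf : ℂ → ℂ := fun z => (z - p) ^ m * (z - q) ^ (-n)
  let Φ : ℂ → ℂ := fun z => if z ∈ K ∪ V then Complex.exp (N z) else Rf z
  have hΦV : ∀ z ∈ K ∪ V, Φ z = Complex.exp (N z) := fun z hz => if_pos hz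
  have hΦR : ∀ z ∈ Vᶜ, Φ z = Rf z := by
    intro z hz
    by_cases hzK : z ∈ K
    · rw [hΦV z (Or.inl hzK), hNK z hzK]
    · exact if_neg (fun h => h.elim hzK hz)
  have hnep : ∀ z ∈ Vᶜ, z - p ≠ 0 := fun z hz h => hz (sub_eq_zero.1 h ▸ hp)
  have hneq : ∀ z ∈ Vᶜ, z - q ≠ 0 := fun z hz h => hz (sub_eq_zero.1 h ▸ hq)
  have hRc : ContinuousOn Rf Vᶜ := by
    refine ContinuousOn.mul ?_ ?_
    · exact (continuous_id.sub continuous_const).continuousOn.zpow₀ _ fun z hz => Or.inl (hnep z hz)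
    · exact (continuous_id.sub continuous_const).continuousOn.zpow₀ _ fun z hz => Or.inl (hneq z hz)
  have hΦc : Continuous Φ := by
    rw [← continuousOn_univ, ← union_compl_self V]
    have h1 : ContinuousOn Φ (K ∪ V) := (hN.cexp.continuousOn).congr hΦV
    have h2 : ContinuousOn Φ Vᶜ := hRc.congr hΦR
    refine (h1.union_of_isClosed h2 hVK hVo.isClosed_compl).mono ?_
    exact union_subset_union_left _ subset_union_right
  have hΦ0 : ∀ z, Φ z ≠ 0 := by
    intro z
    by_cases hz : z ∈ V
    · rw [hΦV z (Or.inr hz)]; exact Complex.exp_ne_zero _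
    · rw [hΦR z hz]
      exact mul_ne_zero (zpow_ne_zero _ (hnep z hz)) (zpow_ne_zero _ (hneq z hz))
  have hsc : IsSimplyConnected (univ : Set ℂ) := by
    have : ContractibleSpace (univ : Set ℂ) := convex_univ.contractibleSpace univ_nonempty
    exact SimplyConnectedSpace.ofContractible _
  obtain ⟨G, hGc, hG⟩ := Complex.exists_continuousOn_eqOn_exp_comp (X := ℂ) (U := univ) (g := Φ)
    hsc isOpen_univ hΦc.continuousOn (by
      rintro ⟨z, -, hz⟩; exact hΦ0 z hz)
  rw [continuousOn_univ] at hGc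
  obtain ⟨ρ, hρ0, hρ⟩ := hVb.subset_ball_lt 0 0
  have hcirc : ∀ θ : ℝ, (ρ : ℂ) * Complex.exp (θ * Complex.I) ∈ Vᶜ := by
    intro θ h
    have := hρ h
    rw [mem_ball_zero_iff, norm_mul, Complex.norm_exp_ofReal_mul_I, Complex.norm_real,
      Real.norm_of_nonneg hρ0.le, mul_one] at this
    exact lt_irrefl _ this
  let e : ℝ → ℂ := fun θ => (ρ : ℂ) * Complex.exp (θ * Complex.I)
  have hec : Continuous e := by fun_prop
  have he0 : ∀ θ, e θ ≠ 0 := fun θ =>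
    mul_ne_zero (by exact_mod_cast hρ0.ne') (Complex.exp_ne_zero _)
  have hen : ∀ θ, ‖e θ‖ = ρ := by
    intro θ
    simp only [e]
    rw [norm_mul, Complex.norm_exp_ofReal_mul_I, Complex.norm_real,
      Real.norm_of_nonneg hρ0.le, mul_one]
  have hslit : ∀ {a : ℂ}, a ∈ V → ∀ θ, 1 - a / e θ ∈ Complex.slitPlane := by
    intro a ha θ
    rw [sub_eq_add_neg]
    refine Complex.mem_slitPlane_of_norm_lt_one ?_
    rw [norm_neg, norm_div, hen, div_lt_one hρ0]
    simpa using hρ ha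
  let lg : ℂ → ℝ → ℂ := fun a θ => (Real.log ρ : ℂ) + θ * Complex.I + Complex.log (1 - a / e θ)
  have hlgc : ∀ {a : ℂ}, a ∈ V → Continuous (lg a) := by
    intro a ha
    refine Continuous.add (by fun_prop) ?_
    refine Continuous.clog ?_ (hslit ha)
    exact continuous_const.sub (continuous_const.div hec he0)
  have hlg : ∀ {a : ℂ}, a ∈ V → ∀ θ, Complex.exp (lg a θ) = e θ - a := by
    intro a ha θ
    have h0 : (1 - a / e θ) ≠ 0 := Complex.slitPlane_ne_zero (hslit ha θ)
    simp only [lg]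
    rw [Complex.exp_add, Complex.exp_add, Complex.exp_log h0, ← Complex.ofReal_exp,
      Real.exp_log hρ0]
    change e θ * (1 - a / e θ) = _
    rw [mul_sub, mul_one, mul_div_cancel₀ _ (he0 θ)]
  let D : ℝ → ℂ := fun θ => G (e θ) - (m * lg p θ - n * lg q θ)
  have hDc : Continuous D := by
    refine (hGc.comp hec).sub ?_
    exact (continuous_const.mul (hlgc hp)).sub (continuous_const.mul (hlgc hq))
  have hD1 : ∀ θ, Complex.exp (D θ) = 1 := by
    intro θ
    have h1 : Complex.exp (G (e θ)) = Rf (e θ) := by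
      rw [← hΦR _ (hcirc θ)]; exact hG (mem_univ (e θ))
    simp only [D]
    rw [Complex.exp_sub, h1, Complex.exp_sub, Complex.exp_int_mul, Complex.exp_int_mul, hlg hp,
      hlg hq]
    simp only [Rf]
    rw [zpow_neg, div_eq_mul_inv ((e θ - p) ^ m)]
    exact div_self (mul_ne_zero (zpow_ne_zero _ (hnep _ (hcirc θ)))
      (inv_ne_zero (zpow_ne_zero _ (hneq _ (hcirc θ)))))
  have hD : D 0 = D (2 * Real.pi) := by
    have hdisc : ∀ θ, ∃ k : ℤ, D θ = k * (2 * Real.pi * Complex.I) := fun θ =>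
      Complex.exp_eq_one_iff.1 (hD1 θ)
    choose k hk using hdisc
    have hkc : Continuous k := by
      have h1 : Continuous fun θ => ((k θ : ℤ) : ℝ) := by
        have : (fun θ => ((k θ : ℤ) : ℝ)) = fun θ => (D θ / (2 * Real.pi * Complex.I)).re := by
          funext θ
          rw [hk θ, mul_div_cancel_right₀ _ Complex.two_pi_I_ne_zero]
          simp
        rw [this]
        exact Complex.continuous_re.comp (hDc.div_const _)
      exact Int.isClosedEmbedding_coe_real.continuous_iff.2 h1
    have : k 0 = k (2 * Real.pi) := PreconnectedSpace.constant inferInstance hkc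
    rw [hk, hk, this]
  have he2 : e (2 * Real.pi) = e 0 := by
    simp only [e]
    push_cast
    rw [Complex.exp_two_pi_mul_I]; simp
  simp only [D, lg, he2] at hD
  have h2 : ((m : ℂ) - n) * (2 * Real.pi * Complex.I) = 0 := by
    push_cast at hD
    linear_combination hD
  rcases mul_eq_zero.1 h2 with h | h
  · exact_mod_cast sub_eq_zero.1 h
  · exact absurd h Complex.two_pi_I_ne_zero

/-- A continuous function along a simple closed curve that takes the same value at both ends
extends from the curve to the plane. -/
theorem exists_continuous_extension {γ : ℝ → ℂ} {T : ℝ} (hT : 0 < T) (hγ : Continuous γ)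
    (hclosed : γ 0 = γ T) (hinj : InjOn γ (Ico 0 T)) {M : ℝ → ℂ} (hM : ContinuousOn M (Icc 0 T))
    (hM0 : M 0 = M T) : ∃ N : ℂ → ℂ, Continuous N ∧ ∀ s ∈ Icc 0 T, N (γ s) = M s := by
  let K : Set ℂ := γ '' Icc 0 T
  have hKc : IsCompact K := isCompact_Icc.image hγ
  let f : Icc (0 : ℝ) T → K := fun s => ⟨γ s, mem_image_of_mem γ s.2⟩
  have hf : Continuous f := (hγ.comp continuous_subtype_val).subtype_mk _
  have hfs : Function.Surjective f := by
    rintro ⟨_, s, hs, rfl⟩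
    exact ⟨⟨s, hs⟩, rfl⟩
  have hq : IsQuotientMap f := hf.isClosedMap.isQuotientMap hf hfs
  let M' : C(Icc (0 : ℝ) T, ℂ) := ⟨fun s => M s, hM.domRestrict⟩
  have key : ∀ s ∈ Icc 0 T, ∀ t ∈ Icc 0 T, γ s = γ t → M s = M t := by
    have red : ∀ s ∈ Icc 0 T, ∃ s' ∈ Ico 0 T, γ s = γ s' ∧ M s = M s' := by
      intro s hs
      rcases hs.2.lt_or_eq with h | h
      · exact ⟨s, ⟨hs.1, h⟩, rfl, rfl⟩
      · exact ⟨0, ⟨le_rfl, hT⟩, by rw [h, hclosed], by rw [h, hM0]⟩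
    intro s hs t ht hst
    obtain ⟨s', hs', h1, h2⟩ := red s hs
    obtain ⟨t', ht', h3, h4⟩ := red t ht
    rw [h2, h4, hinj hs' ht' (by rw [← h1, hst, h3])]
  have hfac : ∀ s t, f s = f t → M' s = M' t := fun s t h =>
    key s s.2 t t.2 (congrArg Subtype.val h)
  let F : C(Icc (0 : ℝ) T, K) := ⟨f, hf⟩
  let N₀ : C(K, ℂ) := IsQuotientMap.lift (f := F) hq M' hfac
  obtain ⟨N, hN⟩ := ContinuousMap.exists_restrict_eq hKc.isClosed N₀
  refine ⟨N, N.continuous, fun s hs => ?_⟩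
  have h1 : N₀ (f ⟨s, hs⟩) = M s :=
    congrArg (fun g : C(Icc (0 : ℝ) T, ℂ) => g ⟨s, hs⟩)
      (IsQuotientMap.lift_comp (f := F) hq M' hfac)
  rw [← h1, ← hN]
  rfl

/-- The winding number of the closed curve `γ : [0, T] → ℂ` about `z`; it is an integer off the
curve. -/
noncomputable def windingNumber (γ : ℝ → ℂ) (T : ℝ) (z : ℂ) : ℝ :=
  (logIntegral γ z T).im / (2 * Real.pi)

section WindingNumber

variable {C : NNReal} {γ : ℝ → ℂ} {T : ℝ}

theorem exists_int_logIntegral_eq (hγ : LipschitzWith C γ) (hT : 0 ≤ T) (hclosed : γ 0 = γ T)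
    {z : ℂ} (hz : z ∉ γ '' Icc 0 T) :
    ∃ n : ℤ, logIntegral γ z T = n * (2 * Real.pi * Complex.I) ∧ windingNumber γ T z = n := by
  have h := exp_logIntegral hγ hT hz ⟨hT, le_rfl⟩
  have hne : γ 0 - z ≠ 0 := fun h0 => hz ⟨0, ⟨le_rfl, hT⟩, sub_eq_zero.1 h0⟩
  rw [← hclosed] at h
  obtain ⟨n, hn⟩ := Complex.exp_eq_one_iff.1 (mul_right_cancel₀ hne (h.trans (one_mul _).symm))
  refine ⟨n, hn, ?_⟩
  rw [windingNumber, hn]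
  have : ((n : ℂ) * (2 * Real.pi * Complex.I)).im = n * (2 * Real.pi) := by simp
  rw [this, mul_div_cancel_right₀ _ Real.two_pi_pos.ne']

theorem continuousAt_windingNumber (hγ : LipschitzWith C γ) (hT : 0 ≤ T) {z : ℂ}
    (hz : z ∉ γ '' Icc 0 T) : ContinuousAt (windingNumber γ T) z := by
  obtain ⟨d, hd, h⟩ := exists_pos_le_norm_sub hγ hz
  have h1 : ContinuousAt (fun w => logIntegral γ w T) z := by
    refine intervalIntegral.continuousAt_of_dominated_interval (bound := fun _ => C / (d / 2))
      ?_ ?_ (by simp) ?_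
    · exact Eventually.of_forall fun w => (measurable_deriv_div hγ w).aestronglyMeasurable
    · filter_upwards [Metric.ball_mem_nhds z (half_pos hd)] with w hw
      refine Eventually.of_forall fun s hs => norm_deriv_div_le hγ (half_pos hd) ?_
      have hs' : s ∈ Icc 0 T := by
        rw [uIoc_of_le hT] at hs; exact ⟨hs.1.le, hs.2⟩
      have h2 := h s hs'
      rw [Metric.mem_ball, dist_eq_norm] at hw
      have h3 : ‖γ s - z‖ ≤ ‖γ s - w‖ + ‖w - z‖ := norm_sub_le_norm_sub_add_norm_sub _ _ _
      linarith
    · refine Eventually.of_forall fun s hs => ?_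
      have hs' : s ∈ Icc 0 T := by
        rw [uIoc_of_le hT] at hs; exact ⟨hs.1.le, hs.2⟩
      have hne : γ s - z ≠ 0 := by
        intro h0
        have := h s hs'
        rw [h0, norm_zero] at this
        linarith
      exact continuousAt_const.div (continuousAt_const.sub continuousAt_id) hne
  exact (Complex.continuous_im.continuousAt.comp h1).div_const _

theorem windingNumber_eventually_eq (hγ : LipschitzWith C γ) (hT : 0 ≤ T) (hclosed : γ 0 = γ T)
    {z : ℂ} (hz : z ∉ γ '' Icc 0 T) : ∀ᶠ w in 𝓝 z, windingNumber γ T w = windingNumber γ T z := by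
  have hK : IsClosed (γ '' Icc 0 T) := (isCompact_Icc.image hγ.continuous).isClosed
  have h1 := Metric.continuousAt_iff.1 (continuousAt_windingNumber hγ hT hz) 1 one_pos
  obtain ⟨δ, hδ, h2⟩ := h1
  filter_upwards [Metric.ball_mem_nhds z hδ, hK.isOpen_compl.mem_nhds hz] with w hw hwK
  obtain ⟨n, -, hn⟩ := exists_int_logIntegral_eq hγ hT hclosed hz
  obtain ⟨m, -, hm⟩ := exists_int_logIntegral_eq hγ hT hclosed hwK
  have h3 := h2 hw
  rw [hn, hm, Real.dist_eq] at h3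
  rw [hn, hm]
  have : |m - n| < 1 := by exact_mod_cast h3
  rw [Int.abs_lt_one_iff, sub_eq_zero] at this
  rw [this]

theorem exists_windingNumber_eq_zero (hγ : LipschitzWith C γ) (hT : 0 ≤ T)
    (hclosed : γ 0 = γ T) : ∃ R : ℝ, 0 < R ∧ (∀ s ∈ Icc 0 T, ‖γ s‖ < R) ∧
      ∀ z, R ≤ ‖z‖ → windingNumber γ T z = 0 := by
  obtain ⟨ρ, hρ0, hρ⟩ :=
    (isCompact_Icc.image hγ.continuous (f := γ) (s := Icc 0 T)).isBounded.subset_ball_lt 0 0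
  have hb : ∀ s ∈ Icc 0 T, ‖γ s‖ < ρ := fun s hs =>
    mem_ball_zero_iff.1 (hρ (mem_image_of_mem γ hs))
  have hCT : 0 ≤ C * T := mul_nonneg C.coe_nonneg hT
  refine ⟨ρ + (C * T + 1), by positivity, fun s hs => (hb s hs).trans (by linarith),
    fun z hz => ?_⟩
  have hd : ∀ s ∈ Icc 0 T, C * T + 1 ≤ ‖γ s - z‖ := by
    intro s hs
    have h1 := norm_sub_norm_le z (γ s)
    rw [norm_sub_rev] at h1
    have := hb s hs
    linarith
  have hzK : z ∉ γ '' Icc 0 T := by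
    rintro ⟨s, hs, rfl⟩
    have := hb s hs
    linarith
  obtain ⟨n, hn, hn'⟩ := exists_int_logIntegral_eq hγ hT hclosed hzK
  have h1 : ‖logIntegral γ z T‖ ≤ C / (C * T + 1) * |T - 0| := by
    refine intervalIntegral.norm_integral_le_of_norm_le_const fun s hs => ?_
    rw [uIoc_of_le hT] at hs
    exact norm_deriv_div_le hγ (by linarith) (hd s ⟨hs.1.le, hs.2⟩)
  have h2 : (C : ℝ) / (C * T + 1) * |T - 0| < 1 := by
    rw [sub_zero, abs_of_nonneg hT, div_mul_eq_mul_div, div_lt_one (by linarith)]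
    linarith
  have h3 : ‖logIntegral γ z T‖ = |(n : ℝ)| * (2 * Real.pi) := by
    rw [hn]
    simp [abs_of_pos Real.pi_pos]
  have h4 : |(n : ℝ)| < 1 := by
    have := Real.pi_gt_three
    have := abs_nonneg (n : ℝ)
    nlinarith
  rw [hn']
  have : |n| < 1 := by exact_mod_cast h4
  rw [Int.abs_lt_one_iff] at this
  simp [this]

/-- Two nonzero winding numbers of a simple closed curve agree. With winding numbers `m` about `p`
and `n` about `q`, the function `(z - p)ⁿ (z - q)⁻ᵐ` has degree zero along the curve, hence a
continuous logarithm on it. -/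
theorem windingNumber_eq_of_ne_zero (hγ : LipschitzWith C γ) (hT : 0 < T) (hclosed : γ 0 = γ T)
    (hinj : InjOn γ (Ico 0 T)) {p q : ℂ} (hp : p ∉ γ '' Icc 0 T) (hq : q ∉ γ '' Icc 0 T)
    (hp0 : windingNumber γ T p ≠ 0) (hq0 : windingNumber γ T q ≠ 0) :
    windingNumber γ T p = windingNumber γ T q := by
  obtain ⟨m, hm, hm'⟩ := exists_int_logIntegral_eq hγ hT.le hclosed hp
  obtain ⟨n, hn, hn'⟩ := exists_int_logIntegral_eq hγ hT.le hclosed hq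
  let K : Set ℂ := γ '' Icc 0 T
  have hK : IsCompact K := isCompact_Icc.image hγ.continuous
  let V : Set ℂ := {z | z ∉ K ∧ windingNumber γ T z ≠ 0}
  have hloc : ∀ z ∉ K, ∀ᶠ w in 𝓝 z, w ∉ K ∧ windingNumber γ T w = windingNumber γ T z :=
    fun z hz => (show ∀ᶠ w in 𝓝 z, w ∈ Kᶜ from hK.isClosed.isOpen_compl.mem_nhds hz).and
      (windingNumber_eventually_eq hγ hT.le hclosed hz)
  have hVo : IsOpen V := by
    rw [isOpen_iff_mem_nhds]
    rintro z ⟨hz, hz0⟩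
    filter_upwards [hloc z hz] with w hw
    exact ⟨hw.1, by rw [hw.2]; exact hz0⟩
  have hVK : IsClosed (K ∪ V) := by
    rw [← isOpen_compl_iff, isOpen_iff_mem_nhds]
    intro z hz
    have hzK : z ∉ K := fun h => hz (Or.inl h)
    have hz0 : windingNumber γ T z = 0 := by
      by_contra h
      exact hz (Or.inr ⟨hzK, h⟩)
    filter_upwards [hloc z hzK] with w hw
    rintro (h | h)
    · exact hw.1 h
    · exact h.2 (hw.2.trans hz0)
  have hVb : Bornology.IsBounded V := by
    obtain ⟨R, -, -, hR⟩ := exists_windingNumber_eq_zero hγ hT.le hclosed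
    refine (Metric.isBounded_ball (x := (0 : ℂ)) (r := R)).subset fun z hz => ?_
    rw [mem_ball_zero_iff]
    by_contra h
    exact hz.2 (hR z (not_lt.1 h))
  have hne : ∀ {a : ℂ}, a ∉ K → γ 0 - a ≠ 0 := fun ha h0 =>
    ha ⟨0, ⟨le_rfl, hT.le⟩, sub_eq_zero.1 h0⟩
  let M : ℝ → ℂ := fun s => n * (Complex.log (γ 0 - p) + logIntegral γ p s) -
    m * (Complex.log (γ 0 - q) + logIntegral γ q s)
  have hlc : ∀ {a : ℂ}, a ∉ K → ContinuousOn (logIntegral γ a) (Icc 0 T) := by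
    intro a ha
    obtain ⟨d, hd, h⟩ := exists_pos_le_norm_sub hγ ha
    exact (lipschitzOnWith_logIntegral hγ hT.le hd h ha).continuousOn
  have hMc : ContinuousOn M (Icc 0 T) :=
    (continuousOn_const.mul (continuousOn_const.add (hlc hp))).sub
      (continuousOn_const.mul (continuousOn_const.add (hlc hq)))
  have hM0 : M 0 = M T := by
    have h0 : ∀ a, logIntegral γ a 0 = 0 := fun a => by simp [logIntegral]
    simp only [M, h0, hm, hn]
    ring
  obtain ⟨N, hN, hNM⟩ := exists_continuous_extension hT hγ.continuous hclosed hinj hMc hM0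
  have hexp : ∀ {a : ℂ}, a ∉ K → ∀ s ∈ Icc 0 T,
      Complex.exp (Complex.log (γ 0 - a) + logIntegral γ a s) = γ s - a := by
    intro a ha s hs
    rw [Complex.exp_add, Complex.exp_log (hne ha), mul_comm]
    exact exp_logIntegral hγ hT.le ha hs
  have := eq_of_logarithm_on_frontier hVo hVK hVb (p := p) (q := q) (m := n) (n := m)
    ⟨hp, hp0⟩ ⟨hq, hq0⟩ hN (by
      rintro _ ⟨s, hs, rfl⟩
      rw [hNM s hs]
      simp only [M]
      rw [Complex.exp_sub, Complex.exp_int_mul, Complex.exp_int_mul, hexp hp s hs, hexp hq s hs,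
        zpow_neg, div_eq_mul_inv])
  rw [hm', hn', this]

/-- The winding number of a simple closed curve is bounded off the curve. -/
theorem exists_abs_windingNumber_le (hγ : LipschitzWith C γ) (hT : 0 < T) (hclosed : γ 0 = γ T)
    (hinj : InjOn γ (Ico 0 T)) :
    ∃ B : ℝ, 0 ≤ B ∧ ∀ z ∉ γ '' Icc 0 T, |windingNumber γ T z| ≤ B := by
  by_cases h : ∃ p ∉ γ '' Icc 0 T, windingNumber γ T p ≠ 0
  · obtain ⟨p, hp, hp0⟩ := h
    refine ⟨|windingNumber γ T p|, abs_nonneg _, fun z hz => ?_⟩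
    by_cases hz0 : windingNumber γ T z = 0
    · rw [hz0, abs_zero]; exact abs_nonneg _
    · rw [windingNumber_eq_of_ne_zero hγ hT hclosed hinj hz hp hz0 hp0]
  · push Not at h
    exact ⟨0, le_rfl, fun z hz => by rw [h z hz, abs_zero]⟩

theorem measurable_windingNumber (hγ : LipschitzWith C γ) (hT : 0 ≤ T) :
    Measurable (windingNumber γ T) := by
  have h1 : Measurable fun q : ℂ × ℝ => deriv γ q.2 / (γ q.2 - q.1) :=
    ((measurable_deriv γ).comp measurable_snd).div
      ((hγ.continuous.measurable.comp measurable_snd).sub measurable_fst)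
  have h2 : StronglyMeasurable fun z => ∫ s in Ioc 0 T, deriv γ s / (γ s - z) :=
    h1.stronglyMeasurable.integral_prod_right (ν := volume.restrict (Ioc 0 T))
  have h3 : (fun z => logIntegral γ z T) = fun z => ∫ s in Ioc 0 T, deriv γ s / (γ s - z) := by
    funext z
    rw [logIntegral, intervalIntegral.integral_of_le hT]
  have h4 : Measurable fun z => logIntegral γ z T := by rw [h3]; exact h2.measurable
  exact (Complex.measurable_im.comp h4).div_const _

end WindingNumber

/-- A Lipschitz curve has measure zero in the plane. -/
theorem volume_image_curve {C : NNReal} {γ : ℝ → ℂ} (hγ : LipschitzWith C γ) (T : ℝ) :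
    volume (γ '' Icc 0 T) = 0 := by
  have h1 : volume ≪ (Measure.hausdorffMeasure ((2 : NNReal) : ℝ) : Measure ℂ) := by
    have h : ((2 : NNReal) : ℝ) = (Module.finrank ℝ ℂ : ℕ) := by
      rw [Complex.finrank_real_complex]; norm_num
    rw [h]
    exact Measure.absolutelyContinuous_isAddHaarMeasure _ _
  refine measure_zero_of_dimH_lt h1 ?_
  calc dimH (γ '' Icc 0 T) ≤ dimH (Icc 0 T) := hγ.dimH_image_le _
    _ ≤ dimH (univ : Set ℝ) := dimH_mono (subset_univ _)
    _ = 1 := Real.dimH_univ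
    _ < _ := by norm_num

/-! ### Green's formula for the winding number -/

/-- Twice the Wirtinger derivative `∂f/∂z̄`, that is `∂₁f + i ∂₂f`. -/
noncomputable def dbar (f : ℂ → ℝ) (z : ℂ) : ℂ :=
  (fderiv ℝ f z 1 : ℂ) + Complex.I * (fderiv ℝ f z Complex.I : ℂ)

section Pompeiu

variable {f : ℂ → ℝ}

theorem continuous_dbar (hf : ContDiff ℝ 1 f) : Continuous (dbar f) := by
  have h := hf.continuous_fderiv one_ne_zero
  unfold dbar
  fun_prop

theorem hasCompactSupport_dbar (hfc : HasCompactSupport f) : HasCompactSupport (dbar f) := by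
  refine HasCompactSupport.intro hfc fun z hz => ?_
  have : fderiv ℝ f z = 0 := by
    by_contra h
    exact hz (support_fderiv_subset ℝ h)
  simp [dbar, this]

theorem lintegral_inv_norm_le {R : ℝ} (hR : 0 ≤ R) :
    ∫⁻ z in Metric.ball (0 : ℂ) R, ENNReal.ofReal (1 / ‖z‖) ≤ ENNReal.ofReal (R * (2 * Real.pi)) := by
  rw [← lintegral_indicator Metric.isOpen_ball.measurableSet, ← Complex.lintegral_comp_polarCoord_symm]
  calc _ ≤ ∫⁻ p in polarCoord.target,
        (Ioo 0 R ×ˢ Ioo (-Real.pi) Real.pi).indicator (fun _ => (1 : ENNReal)) p := by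
        refine setLIntegral_mono_ae' polarCoord.open_target.measurableSet
          (Eventually.of_forall fun p hp => ?_)
        rw [polarCoord_target] at hp
        have hp0 : 0 < p.1 := hp.1
        have hn : ‖Complex.polarCoord.symm p‖ = p.1 := by
          rw [Complex.norm_polarCoord_symm, abs_of_pos hp0]
        by_cases hpR : p.1 < R
        · rw [indicator_of_mem (by rwa [mem_ball_zero_iff, hn]),
            indicator_of_mem (show p ∈ Ioo 0 R ×ˢ Ioo (-Real.pi) Real.pi from ⟨⟨hp0, hpR⟩, hp.2⟩), hn, smul_eq_mul,
            ← ENNReal.ofReal_mul hp0.le, mul_one_div_cancel hp0.ne', ENNReal.ofReal_one]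
        · rw [indicator_of_notMem (by rw [mem_ball_zero_iff, hn]; exact hpR), smul_zero]
          exact bot_le
    _ ≤ ∫⁻ p, (Ioo 0 R ×ˢ Ioo (-Real.pi) Real.pi).indicator (fun _ => (1 : ENNReal)) p :=
        setLIntegral_le_lintegral _ _
    _ = _ := by
        rw [lintegral_indicator (measurableSet_Ioo.prod measurableSet_Ioo), setLIntegral_one,
          Measure.volume_eq_prod, Measure.prod_prod, Real.volume_Ioo, Real.volume_Ioo,
          ← ENNReal.ofReal_mul (by linarith)]
        congr 1
        ring

theorem exists_bound_dbar (hf : ContDiff ℝ 1 f) (hfc : HasCompactSupport f) :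
    ∃ B : ℝ, 0 ≤ B ∧ ∀ z, ‖dbar f z‖ ≤ B := by
  obtain ⟨B, hB⟩ := (hasCompactSupport_dbar hfc).exists_bound_of_continuous (continuous_dbar hf)
  exact ⟨B, (norm_nonneg _).trans (hB 0), hB⟩

/-- The Cauchy kernel integrates against compactly supported functions, uniformly in the position
of the pole. -/
theorem exists_lintegral_dbar_div_le (hf : ContDiff ℝ 1 f) (hfc : HasCompactSupport f) {ρ : ℝ} :
    ∃ B : NNReal, ∀ ζ, ‖ζ‖ ≤ ρ → ∫⁻ z, ‖dbar f z / (z - ζ)‖ₑ ≤ B := by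
  obtain ⟨B, hB0, hB⟩ := exists_bound_dbar hf hfc
  obtain ⟨R, hR0, hR⟩ := (hasCompactSupport_dbar hfc).isCompact.isBounded.subset_ball_lt 0 0
  refine ⟨(ENNReal.ofReal B * ENNReal.ofReal ((R + |ρ|) * (2 * Real.pi))).toNNReal, fun ζ hζ => ?_⟩
  rw [ENNReal.coe_toNNReal (by finiteness)]
  have hR' : 0 ≤ R + |ρ| := by positivity
  refine le_trans ?_ (mul_le_mul_right (lintegral_inv_norm_le hR') _)
  rw [← lintegral_const_mul' _ _ (by finiteness), ← lintegral_indicator Metric.isOpen_ball.measurableSet,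
    ← lintegral_sub_right_eq_self (f := indicator _ _) ζ]
  refine lintegral_mono fun z => ?_
  by_cases hz : z ∈ tsupport (dbar f)
  · have h1 := mem_ball_zero_iff.1 (hR hz)
    rw [indicator_of_mem, ← ENNReal.ofReal_mul hB0, ← ofReal_norm, norm_div, mul_one_div]
    · gcongr
      exact hB z
    · rw [mem_ball_zero_iff]
      calc ‖z - ζ‖ ≤ ‖z‖ + ‖ζ‖ := norm_sub_le _ _
        _ < R + |ρ| := by linarith [le_abs_self ρ]
  · rw [image_eq_zero_of_notMem_tsupport hz]
    simp

/-- Cauchy–Pompeiu formula at the origin, in polar coordinates: the radial part of the integrand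
integrates to the value at the centre, the angular part to zero. -/
theorem integral_dbar_div_self (hf : ContDiff ℝ 1 f) (hfc : HasCompactSupport f) :
    ∫ z, dbar f z / z = -(2 * Real.pi * f 0 : ℝ) := by
  let e : ℝ × ℝ → ℂ := fun p => p.1 * (Real.cos p.2 + Real.sin p.2 * Complex.I)
  let er : ℝ → ℂ := fun θ => Real.cos θ + Real.sin θ * Complex.I
  let et : ℝ → ℂ := fun θ => -Real.sin θ + Real.cos θ * Complex.I
  let a : ℝ × ℝ → ℝ := fun p => fderiv ℝ f (e p) (er p.2)
  let b : ℝ × ℝ → ℝ := fun p => fderiv ℝ f (e p) (et p.2)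
  have hfd := hf.continuous_fderiv one_ne_zero
  have hec : Continuous e := by fun_prop
  have herc : Continuous er := by fun_prop
  have hetc : Continuous et := by fun_prop
  have hac : Continuous a := (hfd.comp hec).clm_apply (herc.comp continuous_snd)
  have hbc : Continuous b := (hfd.comp hec).clm_apply (hetc.comp continuous_snd)
  have hdf : Differentiable ℝ f := hf.differentiable one_ne_zero
  obtain ⟨R, hR0, hR⟩ := hfc.isCompact.isBounded.subset_ball_lt 0 0
  have hen : ∀ p, ‖e p‖ = |p.1| := fun p => by
    have := Complex.norm_polarCoord_symm p
    rwa [Complex.polarCoord_symm_apply] at this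
  have hzero : ∀ p : ℝ × ℝ, R ≤ p.1 → fderiv ℝ f (e p) = 0 := by
    intro p hp
    by_contra h
    have h1 := hR (support_fderiv_subset ℝ h)
    rw [mem_ball_zero_iff, hen, abs_of_nonneg (hR0.le.trans hp)] at h1
    linarith
  have hf0 : ∀ p : ℝ × ℝ, R ≤ p.1 → f (e p) = 0 := by
    intro p hp
    by_contra h
    have h1 := hR (subset_tsupport _ h)
    rw [mem_ball_zero_iff, hen, abs_of_nonneg (hR0.le.trans hp)] at h1
    linarith
  -- On the target of polar coordinates only radii below `R` contribute.
  have hI : ∀ g : ℝ × ℝ → ℝ, Continuous g → (∀ p : ℝ × ℝ, R ≤ p.1 → g p = 0) →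
      IntegrableOn g (Ioi 0 ×ˢ Ioo (-Real.pi) Real.pi) := by
    intro g hg hg0
    have h1 : IntegrableOn g (Icc 0 R ×ˢ Icc (-Real.pi) Real.pi) :=
      hg.continuousOn.integrableOn_compact (isCompact_Icc.prod isCompact_Icc)
    refine IntegrableOn.of_forall_sdiff_eq_zero h1 (measurableSet_Ioi.prod measurableSet_Ioo) ?_
    rintro ⟨r, θ⟩ ⟨⟨hr, hθ⟩, hn⟩
    refine hg0 _ ?_
    by_contra h
    exact hn ⟨⟨le_of_lt hr, (not_le.1 h).le⟩, Ioo_subset_Icc_self hθ⟩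
  have hIa := hI a hac fun p hp => by simp [a, hzero p hp]
  have hIb := hI b hbc fun p hp => by simp [b, hzero p hp]
  have hA : ∫ p in Ioi (0 : ℝ) ×ˢ Ioo (-Real.pi) Real.pi, a p = -(2 * Real.pi * f 0) := by
    rw [Measure.volume_eq_prod] at hIa ⊢
    rw [IntegrableOn, ← Measure.prod_restrict] at hIa
    rw [← Measure.prod_restrict, integral_prod_symm _ hIa]
    have h1 : ∀ θ : ℝ, ∫ r in Ioi (0 : ℝ), a (r, θ) = -f 0 := by
      intro θ
      have h2 : ∀ r ∈ Ici (0 : ℝ), HasDerivAt (fun r : ℝ => f (e (r, θ))) (a (r, θ)) r := by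
        intro r _
        have h3 : HasDerivAt (fun r : ℝ => e (r, θ)) (er θ) r := by
          simpa using (Complex.ofRealCLM.hasDerivAt (x := r)).mul_const (er θ)
        exact (hdf (e (r, θ))).hasFDerivAt.comp_hasDerivAt r h3
      have h4 : IntegrableOn (fun r => a (r, θ)) (Ioi 0) := by
        have h1 : IntegrableOn (fun r => a (r, θ)) (Icc 0 R) :=
          (hac.comp (by fun_prop : Continuous fun r : ℝ => (r, θ))).continuousOn.integrableOn_compact
            isCompact_Icc
        refine IntegrableOn.of_forall_sdiff_eq_zero h1 measurableSet_Ioi ?_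
        rintro r ⟨hr, hn⟩
        have : fderiv ℝ f (e (r, θ)) = 0 := hzero _ (by
          by_contra h
          exact hn ⟨le_of_lt hr, (not_le.1 h).le⟩)
        simp [a, this]
      have h5 : Tendsto (fun r : ℝ => f (e (r, θ))) atTop (𝓝 0) := by
        refine tendsto_const_nhds.congr' ?_
        filter_upwards [eventually_ge_atTop R] with r hr using (hf0 _ hr).symm
      have h6 := integral_Ioi_of_hasDerivAt_of_tendsto' h2 h4 h5
      rw [h6]
      simp [e]
    simp_rw [h1]
    rw [setIntegral_const]
    rw [smul_eq_mul, measureReal_def, Real.volume_Ioo, ENNReal.toReal_ofReal (by linarith [Real.pi_pos])]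
    ring
  have hB : ∫ p in Ioi (0 : ℝ) ×ˢ Ioo (-Real.pi) Real.pi, b p = 0 := by
    rw [Measure.volume_eq_prod] at hIb ⊢
    rw [IntegrableOn, ← Measure.prod_restrict] at hIb
    rw [← Measure.prod_restrict, integral_prod _ hIb]
    refine (setIntegral_congr_fun measurableSet_Ioi fun r hr => ?_).trans (integral_zero _ _)
    have hr0 : (0 : ℝ) < r := hr
    have h2 : ∀ θ ∈ uIcc (-Real.pi) Real.pi,
        HasDerivAt (fun θ : ℝ => f (e (r, θ)) / r) (b (r, θ)) θ := by
      intro θ _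
      have h3 : HasDerivAt (fun θ : ℝ => e (r, θ)) (r * et θ) θ := by
        have h4 : HasDerivAt (fun θ : ℝ => (Real.cos θ : ℂ)) (-Real.sin θ : ℝ) θ :=
          (Real.hasDerivAt_cos θ).ofReal_comp
        have h5 : HasDerivAt (fun θ : ℝ => (Real.sin θ : ℂ)) (Real.cos θ : ℝ) θ :=
          (Real.hasDerivAt_sin θ).ofReal_comp
        have := (h4.add (h5.mul_const Complex.I)).const_mul (r : ℂ)
        refine (HasDerivAt.congr_deriv this ?_)
        simp [et]
      have h6 := ((hdf (e (r, θ))).hasFDerivAt.comp_hasDerivAt θ h3).div_const r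
      refine h6.congr_deriv ?_
      have h7 : (r : ℂ) * et θ = r • et θ := by simp
      rw [h7, map_smul, smul_eq_mul, mul_div_cancel_left₀ _ hr0.ne']
    have h8 : IntervalIntegrable (fun θ => b (r, θ)) volume (-Real.pi) Real.pi :=
      (hbc.comp (by fun_prop : Continuous fun θ : ℝ => (r, θ))).intervalIntegrable _ _
    have h9 := intervalIntegral.integral_eq_sub_of_hasDerivAt h2 h8
    rw [intervalIntegral.integral_of_le (by linarith [Real.pi_pos]),
      integral_Ioc_eq_integral_Ioo] at h9
    simp only [h9]
    simp [e]
  rw [← Complex.integral_comp_polarCoord_symm, polarCoord_target]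
  have hpt : ∀ p ∈ Ioi (0 : ℝ) ×ˢ Ioo (-Real.pi) Real.pi,
      p.1 • (dbar f (Complex.polarCoord.symm p) / Complex.polarCoord.symm p) =
        (a p : ℂ) + (b p : ℂ) * Complex.I := by
    rintro p ⟨hp, -⟩
    have hp0 : (0 : ℝ) < p.1 := hp
    rw [Complex.polarCoord_symm_apply]
    change p.1 • (dbar f (e p) / (p.1 * er p.2)) = _
    have hun : er p.2 * (Real.cos p.2 - Real.sin p.2 * Complex.I) = 1 := by
      have := Real.sin_sq_add_cos_sq p.2
      have h1 : (Real.sin p.2 : ℂ) ^ 2 + (Real.cos p.2 : ℂ) ^ 2 = 1 := by exact_mod_cast this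
      simp only [er]
      linear_combination h1 - (Real.sin p.2 : ℂ) ^ 2 * Complex.I_sq
    have her : er p.2 ≠ 0 := left_ne_zero_of_mul_eq_one hun
    have hpc : (p.1 : ℂ) ≠ 0 := by exact_mod_cast hp0.ne'
    have ha : a p = Real.cos p.2 * fderiv ℝ f (e p) 1 + Real.sin p.2 * fderiv ℝ f (e p) Complex.I := by
      have : er p.2 = Real.cos p.2 • (1 : ℂ) + Real.sin p.2 • Complex.I := by simp [er]
      simp only [a]
      rw [this, map_add, map_smul, map_smul, smul_eq_mul, smul_eq_mul]
    have hb : b p = -Real.sin p.2 * fderiv ℝ f (e p) 1 + Real.cos p.2 * fderiv ℝ f (e p) Complex.I := by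
      have : et p.2 = (-Real.sin p.2) • (1 : ℂ) + Real.cos p.2 • Complex.I := by simp [et]
      simp only [b]
      rw [this, map_add, map_smul, map_smul, smul_eq_mul, smul_eq_mul]
    have hinv : dbar f (e p) / (p.1 * er p.2) =
        (p.1 : ℂ)⁻¹ * (dbar f (e p) * (Real.cos p.2 - Real.sin p.2 * Complex.I)) := by
      rw [div_eq_iff (mul_ne_zero hpc her)]
      have h2 : (p.1 : ℂ)⁻¹ * p.1 = 1 := inv_mul_cancel₀ hpc
      linear_combination (-dbar f (e p)) * h2 - dbar f (e p) * ((p.1 : ℂ)⁻¹ * p.1) * hun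
    rw [hinv, Complex.real_smul, mul_inv_cancel_left₀ hpc, ha, hb, dbar]
    push_cast
    linear_combination (-(fderiv ℝ f (e p) Complex.I : ℂ) * Complex.sin p.2) * Complex.I_sq
  rw [setIntegral_congr_fun (measurableSet_Ioi.prod measurableSet_Ioo) hpt, integral_add
    hIa.ofReal (hIb.ofReal.mul_const _), integral_mul_const, integral_complex_ofReal, integral_complex_ofReal,
    hA, hB]
  simp

/-- The Cauchy–Pompeiu formula for compactly supported functions. -/
theorem integral_dbar_div (hf : ContDiff ℝ 1 f) (hfc : HasCompactSupport f) (ζ : ℂ) :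
    ∫ z, dbar f z / (z - ζ) = -(2 * Real.pi * f ζ : ℝ) := by
  have h1 : ContDiff ℝ 1 fun z => f (z + ζ) := hf.comp (contDiff_id.add contDiff_const)
  have h2 : HasCompactSupport fun z => f (z + ζ) :=
    hfc.comp_homeomorph (Homeomorph.addRight ζ)
  have h3 := integral_dbar_div_self h1 h2
  rw [zero_add] at h3
  rw [← h3, ← integral_add_right_eq_self _ ζ]
  congr 1
  funext z
  rw [add_sub_cancel_right, dbar, dbar, fderiv_comp_add_right]

end Pompeiu

/-- **Green's formula** for a closed Lipschitz curve: the winding number is the density of the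
planar current bounded by the curve. -/
theorem integral_curve_eq_integral_dbar {C : NNReal} {γ : ℝ → ℂ} {T : ℝ} {f : ℂ → ℝ}
    (hγ : LipschitzWith C γ) (hT : 0 ≤ T) (hclosed : γ 0 = γ T)
    (hf : ContDiff ℝ 1 f) (hfc : HasCompactSupport f) :
    ∫ s in (0 : ℝ)..T, (f (γ s) : ℂ) * deriv γ s =
      Complex.I * ∫ z, dbar f z * windingNumber γ T z := by
  obtain ⟨ρ, -, hρ, -⟩ := exists_windingNumber_eq_zero hγ hT hclosed
  obtain ⟨B, hB⟩ := exists_lintegral_dbar_div_le hf hfc (ρ := ρ)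
  let k : ℝ × ℂ → ℂ := fun q => dbar f q.2 / (q.2 - γ q.1) * deriv γ q.1
  have hkm : Measurable k := by
    refine Measurable.mul (Measurable.div ?_ ?_) ((measurable_deriv γ).comp measurable_fst)
    · exact (continuous_dbar hf).measurable.comp measurable_snd
    · exact measurable_snd.sub (hγ.continuous.measurable.comp measurable_fst)
  have hki : Integrable k ((volume.restrict (Ioc 0 T)).prod volume) := by
    refine ⟨hkm.aestronglyMeasurable, ?_⟩
    rw [HasFiniteIntegral, lintegral_prod _ hkm.enorm.aemeasurable]
    calc ∫⁻ s in Ioc 0 T, ∫⁻ z, ‖k (s, z)‖ₑ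
        ≤ ∫⁻ _s in Ioc 0 T, (B * C : ENNReal) := by
          refine setLIntegral_mono_ae' measurableSet_Ioc (Eventually.of_forall fun s hs => ?_)
          simp only [k, enorm_mul]
          rw [lintegral_mul_const' _ _ (by finiteness)]
          refine mul_le_mul' (hB _ (hρ s ⟨hs.1.le, hs.2⟩).le) ?_
          rw [← ofReal_norm, ← ENNReal.ofReal_coe_nnreal]
          exact ENNReal.ofReal_le_ofReal (norm_deriv_le_of_lipschitz hγ)
      _ < ⊤ := by
          rw [setLIntegral_const]
          exact ENNReal.mul_lt_top (by finiteness) (by simp)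
  have h1 : ∫ s in Ioc 0 T, ∫ z, k (s, z) = ∫ z, ∫ s in Ioc 0 T, k (s, z) :=
    integral_integral_swap hki
  have h2 : ∀ s, ∫ z, k (s, z) = -(2 * Real.pi) * ((f (γ s) : ℂ) * deriv γ s) := by
    intro s
    simp only [k]
    rw [integral_mul_const, integral_dbar_div hf hfc]
    push_cast
    ring
  have h3 : ∫ z, ∫ s in Ioc 0 T, k (s, z) =
      ∫ z, -(2 * Real.pi * Complex.I) * (dbar f z * windingNumber γ T z) := by
    refine integral_congr_ae ?_
    have hnull : ∀ᵐ z : ℂ, z ∉ γ '' Icc 0 T :=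
      measure_eq_zero_iff_ae_notMem.1 (volume_image_curve hγ T)
    filter_upwards [hnull] with z hz
    obtain ⟨n, hn, hn'⟩ := exists_int_logIntegral_eq hγ hT hclosed hz
    have h4 : ∀ s, k (s, z) = -dbar f z * (deriv γ s / (γ s - z)) := by
      intro s
      simp only [k]
      rw [← neg_sub (γ s) z, div_neg]
      ring
    simp_rw [h4]
    rw [integral_const_mul, ← intervalIntegral.integral_of_le hT]
    change -dbar f z * logIntegral γ z T = _
    rw [hn, hn']
    push_cast
    ring
  rw [intervalIntegral.integral_of_le hT]
  simp_rw [h2] at h1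
  rw [h3, integral_const_mul, integral_const_mul] at h1
  have hpi : (2 * Real.pi : ℂ) ≠ 0 := by
    have := Real.two_pi_pos.ne'
    exact_mod_cast this
  refine mul_left_cancel₀ hpi ?_
  linear_combination -h1

/-! ### Filling the dislocation curve -/

/-- The isometric identification of `ℂ` with the plane of the cross-section. -/
noncomputable def planeEquiv : ℂ ≃ₗᵢ[ℝ] Plane := Complex.orthonormalBasisOneI.repr

theorem planeEquiv_apply_zero (z : ℂ) : planeEquiv z 0 = z.re := by
  simp [planeEquiv, Complex.orthonormalBasisOneI_repr_apply]

theorem planeEquiv_apply_one (z : ℂ) : planeEquiv z 1 = z.im := by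
  simp [planeEquiv, Complex.orthonormalBasisOneI_repr_apply]

theorem planeEquiv_one : planeEquiv 1 = EuclideanSpace.single 0 1 := by
  ext i; fin_cases i
  · simpa using planeEquiv_apply_zero 1
  · simpa using planeEquiv_apply_one 1

theorem planeEquiv_I : planeEquiv Complex.I = EuclideanSpace.single 1 1 := by
  ext i; fin_cases i
  · simpa using planeEquiv_apply_zero Complex.I
  · simpa using planeEquiv_apply_one Complex.I

/-- A dislocation curve is part of a simple closed Lipschitz curve whose remaining part runs along
the boundary circle of the disk. -/
theorem IsDislocationCurve.exists_closed_extension {r ℓ : ℝ} {c : ℝ → Plane} (hr : 0 < r)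
    (hΓ : IsDislocationCurve r ℓ c) :
    ∃ (γ : ℝ → ℂ) (C : NNReal) (T : ℝ), ℓ ≤ T ∧ LipschitzWith C γ ∧ γ 0 = γ T ∧
      InjOn γ (Ico 0 T) ∧ (∀ s ∈ Icc 0 ℓ, planeEquiv (γ s) = c s) ∧
      ∀ s, ℓ < s → s ≤ T → planeEquiv (γ s) ∉ disk r := by
  have hℓ := hΓ.length_pos
  let cE : ℝ → ℂ := fun s => planeEquiv.symm (c (projIcc 0 ℓ hℓ.le s))
  have hcE : LipschitzWith 1 cE := by
    refine LipschitzWith.of_dist_le_mul fun s t => ?_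
    simp only [cE]
    rw [LinearIsometryEquiv.dist_map]
    have h1 := hΓ.lipschitz.dist_le_mul _ (projIcc 0 ℓ hℓ.le s).2 _ (projIcc 0 ℓ hℓ.le t).2
    have h2 := (LipschitzWith.projIcc hℓ.le).dist_le_mul s t
    rw [Subtype.dist_eq] at h2
    rw [NNReal.coe_one, one_mul] at *
    exact h1.trans h2
  have hcE' : ∀ s ∈ Icc 0 ℓ, cE s = planeEquiv.symm (c s) := by
    intro s hs
    simp only [cE]
    rw [projIcc_of_mem hℓ.le hs]
  have hcEe : ∀ s, ℓ ≤ s → cE s = planeEquiv.symm (c ℓ) := by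
    intro s hs
    simp only [cE]
    rw [projIcc_of_right_le hℓ.le hs]
  have hinjE : c 0 ∉ c '' Ioo 0 ℓ → InjOn cE (Ico 0 ℓ) := by
    intro h0 s hs t ht hst
    rw [hcE' s ⟨hs.1, hs.2.le⟩, hcE' t ⟨ht.1, ht.2.le⟩] at hst
    have hst' : c s = c t := planeEquiv.symm.injective hst
    rcases hs.1.eq_or_lt with rfl | hs0
    · rcases ht.1.eq_or_lt with rfl | ht0
      · rfl
      · exact absurd ⟨t, ⟨ht0, ht.2⟩, hst'.symm⟩ h0
    · rcases ht.1.eq_or_lt with rfl | ht0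
      · exact absurd ⟨s, ⟨hs0, hs.2⟩, hst'⟩ h0
      · exact hΓ.simple ⟨hs0, hs.2⟩ ⟨ht0, ht.2⟩ hst'
  have hnot : c 0 ∈ Metric.sphere (0 : Plane) r → c 0 ∉ c '' Ioo 0 ℓ := by
    rintro h0 ⟨s, hs, hs'⟩
    have h1 := mem_ball_zero_iff.1 (hΓ.mem_disk s hs)
    rw [hs'] at h1
    rw [mem_sphere_zero_iff_norm] at h0
    linarith
  have hclosedcase : c 0 = c ℓ → c 0 ∉ c '' Ioo 0 ℓ → ∃ (γ : ℝ → ℂ) (C : NNReal) (T : ℝ), ℓ ≤ T ∧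
      LipschitzWith C γ ∧ γ 0 = γ T ∧
      InjOn γ (Ico 0 T) ∧ (∀ s ∈ Icc 0 ℓ, planeEquiv (γ s) = c s) ∧
      ∀ s, ℓ < s → s ≤ T → planeEquiv (γ s) ∉ disk r := by
    intro h0 h1
    refine ⟨cE, 1, ℓ, le_rfl, hcE, ?_, hinjE h1, fun s hs => ?_, fun s h1 h2 => absurd h2 h1.not_ge⟩
    · rw [hcE' 0 ⟨le_rfl, hℓ.le⟩, hcE' ℓ ⟨hℓ.le, le_rfl⟩, h0]
    · rw [hcE' s hs, LinearIsometryEquiv.apply_symm_apply]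
  rcases hΓ.ends with ⟨h0, -, h1⟩ | ⟨h0, h1⟩
  · exact hclosedcase h0 h1
  by_cases h01 : c 0 = c ℓ
  · exact hclosedcase h01 (hnot h0)
  -- Close up an arc along the boundary circle, counterclockwise from its end to its start.
  let a := planeEquiv.symm (c ℓ)
  let b := planeEquiv.symm (c 0)
  have hna : ‖a‖ = r := by
    simp only [a]; rw [LinearIsometryEquiv.norm_map]; exact mem_sphere_zero_iff_norm.1 h1
  have hnb : ‖b‖ = r := by
    simp only [b]; rw [LinearIsometryEquiv.norm_map]; exact mem_sphere_zero_iff_norm.1 h0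
  have hab : a ≠ b := fun h => h01 (planeEquiv.symm.injective h.symm)
  have hpa : (r : ℂ) * Complex.exp (a.arg * Complex.I) = a := by
    rw [← hna]; exact Complex.norm_mul_exp_arg_mul_I a
  have hpb : (r : ℂ) * Complex.exp (b.arg * Complex.I) = b := by
    rw [← hnb]; exact Complex.norm_mul_exp_arg_mul_I b
  obtain ⟨δ, hδ0, hδ2, hδ⟩ : ∃ δ : ℝ, 0 < δ ∧ δ < 2 * Real.pi ∧
      (r : ℂ) * Complex.exp ((a.arg + δ : ℝ) * Complex.I) = b := by
    have h3 := Complex.arg_le_pi a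
    have h4 := Complex.neg_pi_lt_arg a
    have h5 := Complex.arg_le_pi b
    have h6 := Complex.neg_pi_lt_arg b
    have h7 : a.arg ≠ b.arg := fun h => hab (by rw [← hpa, ← hpb, h])
    rcases lt_or_gt_of_ne h7 with h | h
    · refine ⟨b.arg - a.arg, by linarith, by linarith, ?_⟩
      rw [add_sub_cancel, hpb]
    · refine ⟨b.arg - a.arg + 2 * Real.pi, by linarith, by linarith, ?_⟩
      rw [← add_assoc, add_sub_cancel]
      push_cast
      rw [add_mul, Complex.exp_add, Complex.exp_two_pi_mul_I, mul_one, hpb]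
  let arc : ℝ → ℂ := fun s => (r : ℂ) * Complex.exp ((a.arg + (max s ℓ - ℓ) : ℝ) * Complex.I)
  have harc : LipschitzWith r.toNNReal arc := by
    refine LipschitzWith.of_dist_le_mul fun s t => ?_
    rw [dist_eq_norm, ← mul_sub, norm_mul, Complex.norm_real, Real.norm_of_nonneg hr.le,
      Real.coe_toNNReal _ hr.le]
    refine mul_le_mul_of_nonneg_left ?_ hr.le
    have h2 : ∀ x y : ℝ, ‖Complex.exp (x * Complex.I) - Complex.exp (y * Complex.I)‖ ≤ |x - y| := by
      intro x y
      have h3 : Complex.exp (x * Complex.I) - Complex.exp (y * Complex.I) =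
          Complex.exp (y * Complex.I) * (Complex.exp (Complex.I * (x - y : ℝ)) - 1) := by
        rw [mul_sub, ← Complex.exp_add, mul_one]
        congr 2
        push_cast
        ring
      rw [h3, norm_mul, Complex.norm_exp_ofReal_mul_I, one_mul]
      exact Real.norm_exp_I_mul_ofReal_sub_one_le
    refine (h2 _ _).trans ?_
    rw [Real.dist_eq]
    calc |a.arg + (max s ℓ - ℓ) - (a.arg + (max t ℓ - ℓ))| = |max s ℓ - max t ℓ| := by
          congr 1; ring
      _ ≤ |s - t| := abs_max_sub_max_le_abs _ _ _
  have harcℓ : ∀ s ≤ ℓ, arc s = a := by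
    intro s hs
    simp only [arc]
    rw [max_eq_right hs, sub_self, add_zero, hpa]
  let γ : ℝ → ℂ := fun s => cE s + (arc s - a)
  have hγ1 : ∀ s ∈ Icc 0 ℓ, γ s = planeEquiv.symm (c s) := by
    intro s hs
    simp only [γ]
    rw [harcℓ s hs.2, sub_self, add_zero, hcE' s hs]
  have hγ2 : ∀ s, ℓ ≤ s → γ s = (r : ℂ) * Complex.exp ((a.arg + (s - ℓ) : ℝ) * Complex.I) := by
    intro s hs
    simp only [γ]
    rw [hcEe s hs]
    simp only [arc]
    rw [max_eq_left hs]
    simp [a]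
  have hγn : ∀ s, ℓ ≤ s → ‖γ s‖ = r := by
    intro s hs
    rw [hγ2 s hs, norm_mul, Complex.norm_exp_ofReal_mul_I, Complex.norm_real,
      Real.norm_of_nonneg hr.le, mul_one]
  have hexpinj : ∀ x y : ℝ, |x - y| < 2 * Real.pi →
      (r : ℂ) * Complex.exp (x * Complex.I) = (r : ℂ) * Complex.exp (y * Complex.I) → x = y := by
    intro x y hxy h
    have hrc : (r : ℂ) ≠ 0 := by exact_mod_cast hr.ne'
    obtain ⟨n, hn⟩ := Complex.exp_eq_exp_iff_exists_int.1 (mul_left_cancel₀ hrc h)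
    have h2 : x = y + n * (2 * Real.pi) := by
      have h3 : (x : ℂ) * Complex.I = (y + n * (2 * Real.pi)) * Complex.I := by rw [hn]; ring
      exact_mod_cast mul_right_cancel₀ Complex.I_ne_zero h3
    have h4 : n = 0 := by
      rw [h2, add_sub_cancel_left, abs_mul, abs_of_pos Real.two_pi_pos] at hxy
      have : |(n : ℝ)| < 1 := by
        by_contra h5
        push Not at h5
        nlinarith [Real.two_pi_pos]
      exact Int.abs_lt_one_iff.1 (by exact_mod_cast this)
    rw [h2, h4]; simp
  have hγ0 : γ 0 = b := hγ1 0 ⟨le_rfl, hℓ.le⟩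
  have hγT : γ (ℓ + δ) = b := by
    rw [hγ2 _ (by linarith), add_sub_cancel_left, hδ]
  have hmix : ∀ s ∈ Ico 0 ℓ, ∀ t, ℓ ≤ t → t < ℓ + δ → γ s ≠ γ t := by
    intro s hs t ht1 ht2 hst
    rcases hs.1.eq_or_lt with rfl | hs0
    · rw [hγ0, ← hδ, hγ2 t ht1] at hst
      have := hexpinj _ _ (by rw [abs_lt]; constructor <;> linarith) hst
      linarith
    · have h3 := mem_ball_zero_iff.1 (hΓ.mem_disk s ⟨hs0, hs.2⟩)
      have h4 := hγn t ht1
      rw [← hst, hγ1 s ⟨hs.1, hs.2.le⟩, LinearIsometryEquiv.norm_map] at h4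
      linarith
  refine ⟨γ, 1 + (r.toNNReal + 0), ℓ + δ, by linarith,
    hcE.add (harc.sub (LipschitzWith.const a)), by rw [hγ0, hγT], ?_, fun s hs => ?_,
    fun s hs1 _ hs3 => ?_⟩
  · intro s hs t ht hst
    rcases lt_or_ge s ℓ with h2 | h2
    · rcases lt_or_ge t ℓ with h3 | h3
      · refine hinjE (hnot h0) ⟨hs.1, h2⟩ ⟨ht.1, h3⟩ ?_
        rw [hcE' s ⟨hs.1, h2.le⟩, hcE' t ⟨ht.1, h3.le⟩, ← hγ1 s ⟨hs.1, h2.le⟩,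
          ← hγ1 t ⟨ht.1, h3.le⟩, hst]
      · exact absurd hst (hmix s ⟨hs.1, h2⟩ t h3 ht.2)
    · rcases lt_or_ge t ℓ with h3 | h3
      · exact absurd hst.symm (hmix t ⟨ht.1, h3⟩ s h2 hs.2)
      · rw [hγ2 s h2, hγ2 t h3] at hst
        have hs2 := hs.2
        have ht2 := ht.2
        have := hexpinj _ _ (by rw [abs_lt]; constructor <;> linarith) hst
        linarith
  · rw [hγ1 s hs, LinearIsometryEquiv.apply_symm_apply]
  · have h3 := mem_ball_zero_iff.1 hs3
    rw [LinearIsometryEquiv.norm_map, hγn s hs1.le] at h3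
    exact lt_irrefl _ h3

/-- A bounded function `w` of compact support whose distributional gradient is the rotated tangent
measure of the closed curve `γ : [0, T] → ℝ²`, and which is locally constant off a null set. -/
structure IsCurveFilling (C : NNReal) (γ : ℝ → Plane) (T : ℝ) (B R : ℝ) (w : Plane → ℝ) :
    Prop where
  length_nonneg : 0 ≤ T
  bound_nonneg : 0 ≤ B
  lipschitz : LipschitzWith C γ
  measurable : Measurable w
  abs_le : ∀ y, |w y| ≤ B
  eq_zero : ∀ y, R ≤ ‖y‖ → w y = 0
  locally_const : ∀ᵐ y, ∀ᶠ z in 𝓝 y, w z = w y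
  green_zero : ∀ f : Plane → ℝ, ContDiff ℝ 1 f → HasCompactSupport f →
    ∫ s in (0 : ℝ)..T, f (γ s) * deriv γ s 0 =
      -∫ y, fderiv ℝ f y (EuclideanSpace.single 1 1) * w y
  green_one : ∀ f : Plane → ℝ, ContDiff ℝ 1 f → HasCompactSupport f →
    ∫ s in (0 : ℝ)..T, f (γ s) * deriv γ s 1 =
      ∫ y, fderiv ℝ f y (EuclideanSpace.single 0 1) * w y

/-- The winding number of a simple closed curve, set to zero on the curve, fills the curve. -/
theorem exists_isCurveFilling {C : NNReal} {γ : ℝ → ℂ} {T : ℝ} (hγ : LipschitzWith C γ)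
    (hT : 0 < T) (hclosed : γ 0 = γ T) (hinj : InjOn γ (Ico 0 T)) :
    ∃ B R w, IsCurveFilling C (fun s => planeEquiv (γ s)) T B R w := by
  classical
  let K : Set ℂ := γ '' Icc 0 T
  have hK : IsClosed K := (isCompact_Icc.image hγ.continuous).isClosed
  obtain ⟨B, hB0, hB⟩ := exists_abs_windingNumber_le hγ hT hclosed hinj
  obtain ⟨R, -, -, hR⟩ := exists_windingNumber_eq_zero hγ hT.le hclosed
  let v : ℂ → ℝ := Kᶜ.indicator (windingNumber γ T)
  have hvm : Measurable v := (measurable_windingNumber hγ hT.le).indicator hK.measurableSet.compl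
  have hvB : ∀ z, |v z| ≤ B := by
    intro z
    by_cases hz : z ∈ K
    · simp only [v]
      rw [indicator_of_notMem (by simpa using hz), abs_zero]
      exact hB0
    · simp only [v]
      rw [indicator_of_mem (by simpa using hz)]
      exact hB z hz
  have hvR : ∀ z, R ≤ ‖z‖ → v z = 0 := by
    intro z hz
    simp only [v, indicator, hR z hz, ite_self]
  have hvl : ∀ z ∉ K, ∀ᶠ w in 𝓝 z, v w = v z := by
    intro z hz
    filter_upwards [windingNumber_eventually_eq hγ hT.le hclosed hz,
      hK.isOpen_compl.mem_nhds hz] with w hw hwK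
    simp only [v]
    rw [indicator_of_mem hwK, indicator_of_mem hz, hw]
  have hnull : ∀ᵐ z : ℂ, z ∉ K := measure_eq_zero_iff_ae_notMem.1 (volume_image_curve hγ T)
  have hmp : MeasurePreserving planeEquiv := planeEquiv.measurePreserving
  have hmp' : MeasurePreserving planeEquiv.symm := planeEquiv.symm.measurePreserving
  have hae : ∀ᵐ y : Plane, planeEquiv.symm y ∉ K := hmp'.quasiMeasurePreserving.ae hnull
  have hγ' : LipschitzWith C fun s => planeEquiv (γ s) := by
    refine LipschitzWith.of_dist_le_mul fun s t => ?_
    rw [LinearIsometryEquiv.dist_map]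
    exact hγ.dist_le_mul s t
  have hderiv : ∀ᵐ s : ℝ, deriv (fun s => planeEquiv (γ s)) s = planeEquiv (deriv γ s) := by
    filter_upwards [LipschitzWith.ae_hasDerivAt hγ] with s hs
    exact (planeEquiv.toContinuousLinearEquiv.hasFDerivAt.comp_hasDerivAt s hs).deriv
  -- Real and imaginary part of Green's formula for the function `f ∘ planeEquiv`.
  have green : ∀ f : Plane → ℝ, ContDiff ℝ 1 f → HasCompactSupport f →
      (∫ s in (0 : ℝ)..T, f (planeEquiv (γ s)) * (deriv γ s).re =
        -∫ y, fderiv ℝ f y (EuclideanSpace.single 1 1) * v (planeEquiv.symm y)) ∧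
      ∫ s in (0 : ℝ)..T, f (planeEquiv (γ s)) * (deriv γ s).im =
        ∫ y, fderiv ℝ f y (EuclideanSpace.single 0 1) * v (planeEquiv.symm y) := by
    intro f hf hfc
    let g : ℂ → ℝ := fun z => f (planeEquiv z)
    have hg : ContDiff ℝ 1 g := hf.comp planeEquiv.contDiff
    have hgc : HasCompactSupport g := hfc.comp_homeomorph planeEquiv.toHomeomorph
    have hgd : ∀ z u, fderiv ℝ g z u = fderiv ℝ f (planeEquiv z) (planeEquiv u) := by
      intro z u
      have h1 : HasFDerivAt g ((fderiv ℝ f (planeEquiv z)).comp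
          (planeEquiv.toContinuousLinearEquiv : ℂ →L[ℝ] Plane)) z :=
        (hf.differentiable one_ne_zero _).hasFDerivAt.comp z
          planeEquiv.toContinuousLinearEquiv.hasFDerivAt
      rw [h1.fderiv]
      rfl
    have hint : ∀ u : ℂ, Integrable fun z => fderiv ℝ g z u * v z := by
      intro u
      have h1 : Continuous fun z => fderiv ℝ g z u :=
        (hg.continuous_fderiv one_ne_zero).clm_apply continuous_const
      have h2 : HasCompactSupport fun z => fderiv ℝ g z u := hgc.fderiv_apply ℝ u
      exact (h1.integrable_of_hasCompactSupport h2).mul_bdd (c := B) hvm.aestronglyMeasurable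
        (Eventually.of_forall hvB)
    have hchange : ∀ u : ℂ, ∫ y, fderiv ℝ f y (planeEquiv u) * v (planeEquiv.symm y) =
        ∫ z, fderiv ℝ g z u * v z := by
      intro u
      rw [← hmp.integral_comp planeEquiv.toHomeomorph.measurableEmbedding]
      simp only [hgd, LinearIsometryEquiv.symm_apply_apply]
    have h1 := integral_curve_eq_integral_dbar hγ hT.le hclosed hg hgc
    have h2 : ∫ z, dbar g z * windingNumber γ T z =
        (∫ z, fderiv ℝ g z 1 * v z : ℝ) + Complex.I * (∫ z, fderiv ℝ g z Complex.I * v z : ℝ) := by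
      rw [← integral_complex_ofReal, ← integral_complex_ofReal, ← integral_const_mul,
        ← integral_add (hint 1).ofReal ((hint Complex.I).ofReal.const_mul _)]
      refine integral_congr_ae ?_
      filter_upwards [hnull] with z hz
      simp only [v]
      rw [indicator_of_mem (show z ∈ Kᶜ from hz), dbar]
      push_cast
      ring
    have hfi : IntervalIntegrable (fun s => (g (γ s) : ℂ) * deriv γ s) volume 0 T := by
      rw [intervalIntegrable_iff_integrableOn_Icc_of_le hT.le]
      have hc : Continuous fun s => (g (γ s) : ℂ) :=
        Complex.continuous_ofReal.comp (hg.continuous.comp hγ.continuous)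
      refine Integrable.mul_bdd (c := C) (hc.continuousOn.integrableOn_compact isCompact_Icc)
        (measurable_deriv γ).aestronglyMeasurable
        (Eventually.of_forall fun s => norm_deriv_le_of_lipschitz hγ)
    have h3 := Complex.reCLM.intervalIntegral_comp_comm hfi
    have h4 := Complex.imCLM.intervalIntegral_comp_comm hfi
    rw [h1, h2] at h3 h4
    rw [← planeEquiv_I, ← planeEquiv_one, hchange, hchange]
    constructor
    · refine Eq.trans ?_ (h3.trans ?_)
      · refine intervalIntegral.integral_congr fun s _ => ?_
        simp [g]
      · simp
    · refine Eq.trans ?_ (h4.trans ?_)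
      · refine intervalIntegral.integral_congr fun s _ => ?_
        simp [g]
      · simp
  refine ⟨B, R, fun y => v (planeEquiv.symm y), hT.le, hB0, hγ',
    hvm.comp planeEquiv.symm.continuous.measurable, fun y => hvB _, fun y hy => hvR _ ?_, ?_, ?_, ?_⟩
  · rwa [LinearIsometryEquiv.norm_map]
  · filter_upwards [hae] with y hy
    exact planeEquiv.symm.continuous.continuousAt.eventually (hvl _ hy)
  · intro f hf hfc
    rw [← (green f hf hfc).1]
    refine intervalIntegral.integral_congr_ae ?_
    filter_upwards [hderiv] with s hs _
    rw [hs, planeEquiv_apply_zero]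
  · intro f hf hfc
    rw [← (green f hf hfc).2]
    refine intervalIntegral.integral_congr_ae ?_
    filter_upwards [hderiv] with s hs _
    rw [hs, planeEquiv_apply_one]

/-- The tangent measure of a dislocation curve is, inside the disk, that of a closed curve with a
bounded filling. -/
theorem IsDislocationCurve.exists_filling {r ℓ : ℝ} {c : ℝ → Plane} (hr : 0 < r)
    (hΓ : IsDislocationCurve r ℓ c) :
    ∃ C γ T B R w, IsCurveFilling C γ T B R w ∧
      ∀ f g : Plane → ℝ, Function.support f ⊆ disk r → Function.support g ⊆ disk r →
        ∫ s in (0 : ℝ)..T, (f (γ s) * deriv γ s 0 + g (γ s) * deriv γ s 1) =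
          ∫ s in (0 : ℝ)..ℓ, (f (c s) * deriv c s 0 + g (c s) * deriv c s 1) := by
  obtain ⟨γ, C, T, hℓT, hγ, hclosed, hinj, hin, hout⟩ := hΓ.exists_closed_extension hr
  have hℓ := hΓ.length_pos
  obtain ⟨B, R, w, hw⟩ := exists_isCurveFilling hγ (hℓ.trans_le hℓT) hclosed hinj
  refine ⟨C, _, T, B, R, w, hw, fun f g hf hg => ?_⟩
  rw [intervalIntegral.integral_of_le hℓ.le, intervalIntegral.integral_of_le (hℓ.le.trans hℓT)]
  rw [setIntegral_eq_of_subset_of_forall_sdiff_eq_zero (s := Ioc 0 ℓ) measurableSet_Ioc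
      (Ioc_subset_Ioc_right hℓT)]
  swap
  · have hzero : ∀ {k : Plane → ℝ} {s : ℝ}, Function.support k ⊆ disk r → ℓ < s → s ≤ T →
        k (planeEquiv (γ s)) = 0 := by
      intro k s hk h1 h2
      by_contra h
      exact hout s h1 h2 (hk h)
    rintro s ⟨hs, hs'⟩
    have hs2 : ℓ < s := by
      by_contra h
      exact hs' ⟨hs.1, not_lt.1 h⟩
    rw [hzero hf hs2 hs.2, hzero hg hs2 hs.2, zero_mul, zero_mul, add_zero]
  rw [integral_Ioc_eq_integral_Ioo, integral_Ioc_eq_integral_Ioo]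
  refine setIntegral_congr_fun measurableSet_Ioo fun s hs => ?_
  have h2 : (fun s => planeEquiv (γ s)) =ᶠ[𝓝 s] c := by
    filter_upwards [Ioo_mem_nhds hs.1 hs.2] with t ht
    exact hin t ⟨ht.1.le, ht.2.le⟩
  simp only
  rw [h2.deriv_eq, hin s ⟨hs.1.le, hs.2.le⟩]

/-! ### Distributional curls of matrix fields -/

instance : (volume : Measure Space3).IsAddHaarMeasure :=
  Measure.prod.instIsAddHaarMeasure (volume : Measure ℝ) (volume : Measure Plane)

section CurlCalculus

variable {φ : Space3 → Fin 3 → ℝ}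

theorem partialD_eq (hφ : ContDiff ℝ ∞ φ) (j k : Fin 3) (x : Space3) :
    partialD φ j k x = fderiv ℝ (fun x => φ x k) x (coordVec j) := by
  have h := hφ.differentiable (by simp) x
  rw [partialD, fderiv_apply h k]
  rfl

theorem contDiff_partialD (hφ : ContDiff ℝ ∞ φ) (j k : Fin 3) : ContDiff ℝ ∞ (partialD φ j k) := by
  have h : ContDiff ℝ ∞ fun x => fderiv ℝ φ x (coordVec j) :=
    (hφ.fderiv_right (m := ∞) (by simp)).clm_apply contDiff_const
  exact contDiff_pi.1 h k

theorem contDiff_curl (hφ : ContDiff ℝ ∞ φ) (j : Fin 3) : ContDiff ℝ ∞ fun x => curl φ x j := by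
  have h := contDiff_partialD hφ
  fin_cases j
  · exact (h 1 2).sub (h 2 1)
  · exact (h 2 0).sub (h 0 2)
  · exact (h 0 1).sub (h 1 0)

theorem partialD_eq_zero {x : Space3} (hx : x ∉ tsupport φ) (j k : Fin 3) :
    partialD φ j k x = 0 := by
  have : fderiv ℝ φ x = 0 := by
    by_contra h
    exact hx (support_fderiv_subset ℝ h)
  simp [partialD, this]

theorem curl_eq_zero {x : Space3} (hx : x ∉ tsupport φ) (j : Fin 3) : curl φ x j = 0 := by
  fin_cases j <;> simp [curl, partialD_eq_zero hx]

theorem hasCompactSupport_curl (hc : HasCompactSupport φ) (j : Fin 3) :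
    HasCompactSupport fun x => curl φ x j :=
  HasCompactSupport.intro hc fun _ hx => curl_eq_zero hx j

theorem fderiv_partialD_comm (hφ : ContDiff ℝ ∞ φ) (i j k : Fin 3) (x : Space3) :
    fderiv ℝ (partialD φ i k) x (coordVec j) = fderiv ℝ (partialD φ j k) x (coordVec i) := by
  have hk : ContDiff ℝ ∞ fun x => φ x k := contDiff_pi.1 hφ k
  have h1 : ∀ i, partialD φ i k = fun x => fderiv ℝ (fun x => φ x k) x (coordVec i) := fun i =>
    funext fun x => partialD_eq hφ i k x
  have h2 : DifferentiableAt ℝ (fderiv ℝ fun x => φ x k) x :=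
    (hk.fderiv_right (m := ∞) (by simp)).differentiable (by simp) x
  have h3 : IsSymmSndFDerivAt ℝ (fun x => φ x k) x :=
    hk.contDiffAt.isSymmSndFDerivAt (by
      rw [minSmoothness_of_isRCLikeNormedField]
      exact WithTop.coe_le_coe.2 le_top)
  have h4 : ∀ i j, fderiv ℝ (partialD φ i k) x (coordVec j) =
      fderiv ℝ (fderiv ℝ fun x => φ x k) x (coordVec j) (coordVec i) := by
    intro i j
    rw [h1, fderiv_clm_apply h2 (differentiableAt_const _)]
    simp
  rw [h4, h4]
  exact h3 _ _

theorem divergence_curl (hφ : ContDiff ℝ ∞ φ) (x : Space3) :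
    ∑ j, fderiv ℝ (fun x => curl φ x j) x (coordVec j) = 0 := by
  have hd : ∀ i k, DifferentiableAt ℝ (partialD φ i k) x := fun i k =>
    (contDiff_partialD hφ i k).differentiable (by simp) x
  have h0 : (fun x => curl φ x 0) = fun x => partialD φ 1 2 x - partialD φ 2 1 x := rfl
  have h1 : (fun x => curl φ x 1) = fun x => partialD φ 2 0 x - partialD φ 0 2 x := rfl
  have h2 : (fun x => curl φ x 2) = fun x => partialD φ 0 1 x - partialD φ 1 0 x := rfl
  rw [Fin.sum_univ_three, h0, h1, h2, fderiv_fun_sub (hd _ _) (hd _ _),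
    fderiv_fun_sub (hd _ _) (hd _ _), fderiv_fun_sub (hd _ _) (hd _ _)]
  simp only [_root_.sub_apply]
  rw [fderiv_partialD_comm hφ 1 0 2, fderiv_partialD_comm hφ 2 0 1, fderiv_partialD_comm hφ 2 1 0]
  ring

/-- Gradients are curl free in the sense of distributions. -/
theorem integral_grad_mul_curl {V : Space3 → ℝ} (hV : ContDiff ℝ 1 V) (hφ : ContDiff ℝ ∞ φ)
    (hc : HasCompactSupport φ) :
    ∫ x, ∑ j, fderiv ℝ V x (coordVec j) * curl φ x j = 0 := by
  have hV' : ∀ j, Continuous fun x => fderiv ℝ V x (coordVec j) := fun j =>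
    (hV.continuous_fderiv one_ne_zero).clm_apply continuous_const
  have hψ : ∀ j, ContDiff ℝ 1 fun x => curl φ x j := fun j => (contDiff_curl hφ j).of_le (by simp)
  have hψ' : ∀ j, Continuous fun x => fderiv ℝ (fun x => curl φ x j) x (coordVec j) := fun j =>
    ((hψ j).continuous_fderiv one_ne_zero).clm_apply continuous_const
  have hcc := hasCompactSupport_curl hc
  have i1 : ∀ j, Integrable fun x => fderiv ℝ V x (coordVec j) * curl φ x j := fun j =>
    ((hV' j).mul (hψ j).continuous).integrable_of_hasCompactSupport ((hcc j).mul_left)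
  have i2 : ∀ j, Integrable fun x => V x * fderiv ℝ (fun x => curl φ x j) x (coordVec j) := fun j =>
    (hV.continuous.mul (hψ' j)).integrable_of_hasCompactSupport
      (((hcc j).fderiv_apply ℝ _).mul_left)
  have i3 : ∀ j, Integrable fun x => V x * curl φ x j := fun j =>
    (hV.continuous.mul (hψ j).continuous).integrable_of_hasCompactSupport ((hcc j).mul_left)
  have h1 : ∀ j, ∫ x, fderiv ℝ V x (coordVec j) * curl φ x j =
      -∫ x, V x * fderiv ℝ (fun x => curl φ x j) x (coordVec j) := by
    intro j
    rw [integral_mul_fderiv_eq_neg_fderiv_mul_of_integrable (i1 j) (i2 j) (i3 j)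
      (fun x _ => hV.differentiable one_ne_zero x) (fun x _ => (hψ j).differentiable one_ne_zero x),
      neg_neg]
  rw [integral_finsetSum _ fun j _ => i1 j]
  simp_rw [h1]
  rw [Finset.sum_neg_distrib, ← integral_finsetSum _ fun j _ => i2 j]
  simp_rw [← Finset.mul_sum, divergence_curl hφ]
  simp

end CurlCalculus

/-! ### Matrix fields -/

theorem abs_entry_le_norm (A : Mat3) (i j : Fin 3) : |A i j| ≤ ‖A‖ := by
  rw [Matrix.frobenius_norm_def, ← Real.sqrt_eq_rpow]
  refine Real.abs_le_sqrt ?_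
  have h1 : A i j ^ 2 = ‖A i j‖ ^ (2 : ℝ) := by
    rw [Real.rpow_two, Real.norm_eq_abs, sq_abs]
  rw [h1]
  refine le_trans ?_ (Finset.single_le_sum (f := fun i => ∑ j, ‖A i j‖ ^ (2 : ℝ))
    (fun i _ => by positivity) (Finset.mem_univ i))
  exact Finset.single_le_sum (f := fun j => ‖A i j‖ ^ (2 : ℝ)) (fun j _ => by positivity)
    (Finset.mem_univ j)

theorem norm_le_sum_abs_entry (A : Mat3) : ‖A‖ ≤ ∑ i, ∑ j, |A i j| := by
  have h1 : ‖A‖ ^ 2 = ∑ i, ∑ j, A i j ^ 2 := by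
    rw [Matrix.frobenius_norm_def, ← Real.sqrt_eq_rpow, Real.sq_sqrt (by positivity)]
    simp
  have h2 : ∀ i j, |A i j| ≤ ∑ i, ∑ j, |A i j| := fun i j =>
    (Finset.single_le_sum (f := fun j => |A i j|) (fun j _ => abs_nonneg _)
      (Finset.mem_univ j)).trans (Finset.single_le_sum (f := fun i => ∑ j, |A i j|)
        (fun i _ => by positivity) (Finset.mem_univ i))
  refine (abs_le_of_sq_le_sq' ?_ (by positivity)).2
  rw [h1]
  calc ∑ i, ∑ j, A i j ^ 2 ≤ ∑ i, ∑ j, |A i j| * ∑ i, ∑ j, |A i j| := by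
        refine Finset.sum_le_sum fun i _ => Finset.sum_le_sum fun j _ => ?_
        rw [← sq_abs, sq]
        exact mul_le_mul_of_nonneg_left (h2 i j) (abs_nonneg _)
    _ = (∑ i, ∑ j, |A i j|) ^ 2 := by simp_rw [← Finset.sum_mul, sq]

theorem continuous_entry (i j : Fin 3) : Continuous fun A : Mat3 => A i j :=
  (continuous_apply j).comp (continuous_apply i)

section Entries

variable {α : Type*} [MeasurableSpace α] {μ : Measure α} {F : α → Mat3}

theorem aestronglyMeasurable_iff_entries :
    AEStronglyMeasurable F μ ↔ ∀ i j, AEStronglyMeasurable (fun x => F x i j) μ := by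
  refine ⟨fun h i j => (continuous_entry i j).comp_aestronglyMeasurable h, fun hF => ?_⟩
  let F' : α → Fin 3 → Fin 3 → ℝ := F
  have h2 : AEMeasurable F' μ :=
    aemeasurable_pi_iff.2 fun i => aemeasurable_pi_iff.2 fun j => (hF i j).aemeasurable
  exact h2.aestronglyMeasurable

theorem memLp_iff_entries {p : ENNReal} :
    MemLp F p μ ↔ ∀ i j, MemLp (fun x => F x i j) p μ := by
  refine ⟨fun h i j => ⟨aestronglyMeasurable_iff_entries.1 h.1 i j, ?_⟩, fun h =>
    ⟨aestronglyMeasurable_iff_entries.2 fun i j => (h i j).1, ?_⟩⟩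
  · exact (eLpNorm_mono fun x => abs_entry_le_norm (F x) i j).trans_lt h.2
  · have h1 : MemLp (fun x => ∑ i, ∑ j, |F x i j|) p μ :=
      memLp_finsetSum _ fun i _ => memLp_finsetSum _ fun j _ => (h i j).abs
    refine (eLpNorm_mono fun x => ?_).trans_lt h1.2
    exact (norm_le_sum_abs_entry (F x)).trans (le_abs_self _)

end Entries

/-! ### Fields with prescribed curl -/

/-- Entrywise local integrability of a matrix field on a set. -/
def LocIntegrableField (U : Set Space3) (F : Space3 → Mat3) : Prop :=
  ∀ i j, ∀ K : Set Space3, IsCompact K → K ⊆ U → IntegrableOn (fun x => F x i j) K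

section DislocationCurl

variable {U : Set Space3} {ℓ : ℝ} {c : ℝ → Plane} {β : EuclideanSpace ℝ (Fin 3)}
  {F D : Space3 → Mat3}

theorem LocIntegrableField.integrable_mul_curl (hF : LocIntegrableField U F)
    {φ : Space3 → Fin 3 → ℝ} (hφ : ContDiff ℝ ∞ φ) (hc : HasCompactSupport φ)
    (hU : tsupport φ ⊆ U) (i j : Fin 3) : Integrable fun x => F x i j * curl φ x j := by
  have h1 : IntegrableOn (fun x => F x i j * curl φ x j) (tsupport φ) :=
    (hF i j _ hc.isCompact hU).mul_continuousOn (contDiff_curl hφ j).continuous.continuousOn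
      hc.isCompact
  have h2 : IntegrableOn (fun x => F x i j * curl φ x j) univ :=
    h1.of_forall_sdiff_eq_zero MeasurableSet.univ fun x hx => by
      rw [curl_eq_zero hx.2, mul_zero]
  rwa [integrableOn_univ] at h2

theorem setIntegral_mul_curl_eq {φ : Space3 → Fin 3 → ℝ} (hU : tsupport φ ⊆ U)
    (i : Fin 3) : ∫ x in U, ∑ j, F x i j * curl φ x j = ∫ x, ∑ j, F x i j * curl φ x j := by
  refine setIntegral_eq_integral_of_forall_compl_eq_zero fun x hx => ?_
  simp [curl_eq_zero (fun h => hx (hU h))]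

theorem HasDislocationCurl.add {β' : EuclideanSpace ℝ (Fin 3)}
    (hF : HasDislocationCurl U ℓ c β F) (hD : HasDislocationCurl U ℓ c β' D)
    (hFi : LocIntegrableField U F) (hDi : LocIntegrableField U D) :
    HasDislocationCurl U ℓ c (β + β') fun x => F x + D x := by
  intro φ hφ hc hU i
  have h1 := hF φ hφ hc hU i
  have h2 := hD φ hφ hc hU i
  rw [setIntegral_mul_curl_eq hU] at h1 h2 ⊢
  have h3 : ∀ x, ∑ j, (F x + D x) i j * curl φ x j =
      ∑ j, F x i j * curl φ x j + ∑ j, D x i j * curl φ x j := by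
    intro x
    rw [← Finset.sum_add_distrib]
    refine Finset.sum_congr rfl fun j _ => ?_
    rw [Matrix.add_apply, add_mul]
  simp_rw [h3]
  rw [integral_add (integrable_finsetSum _ fun j _ => hFi.integrable_mul_curl hφ hc hU i j)
    (integrable_finsetSum _ fun j _ => hDi.integrable_mul_curl hφ hc hU i j), h1, h2,
    PiLp.add_apply]
  ring

theorem HasDislocationCurl.mono {U' : Set Space3} (hF : HasDislocationCurl U ℓ c β F)
    (hU : U' ⊆ U) : HasDislocationCurl U' ℓ c β F := by
  intro φ hφ hc hU' i
  rw [setIntegral_mul_curl_eq hU', ← hF φ hφ hc (hU'.trans hU) i,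
    setIntegral_mul_curl_eq (hU'.trans hU)]

/-- The rows of a gradient field are curl free. -/
theorem hasDislocationCurl_gradient {v : Fin 3 → Space3 → ℝ} (hv : ∀ i, ContDiff ℝ 1 (v i))
    (hD : ∀ x i j, D x i j = fderiv ℝ (v i) x (coordVec j)) :
    HasDislocationCurl U ℓ c 0 D := by
  intro φ hφ hc hU i
  rw [setIntegral_mul_curl_eq hU]
  simp_rw [hD]
  rw [integral_grad_mul_curl (hv i) hφ hc]
  simp

theorem locIntegrableField_of_continuous (hD : ∀ i j, Continuous fun x => D x i j) :
    LocIntegrableField U D :=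
  fun i j _ hK _ => (hD i j).continuousOn.integrableOn_compact hK

theorem locIntegrableField_of_memLp {p : ℝ} (hp : 1 ≤ p)
    (hF : ∀ K : Set Space3, IsCompact K → K ⊆ U →
      MemLp F (ENNReal.ofReal p) (volume.restrict K)) : LocIntegrableField U F := by
  intro i j K hK hKU
  have h1 := memLp_iff_entries.1 (hF K hK hKU) i j
  have : IsFiniteMeasure (volume.restrict K) := ⟨by simpa using hK.measure_lt_top⟩
  exact h1.integrable (by rwa [ENNReal.one_le_ofReal])

end DislocationCurl

/-! ### Rescaling in the axial direction -/

/-- The dilation of the axial variable by the factor `a`. -/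
def axialScale (a : ℝ) (x : Space3) : Space3 := (a * x.1, x.2)

theorem measurableEmbedding_axialScale {a : ℝ} (ha : a ≠ 0) :
    MeasurableEmbedding (axialScale a) :=
  ((Homeomorph.mulLeft₀ a ha).prodCongr (Homeomorph.refl Plane)).measurableEmbedding

theorem map_axialScale {a : ℝ} (ha : a ≠ 0) :
    Measure.map (axialScale a) volume = ENNReal.ofReal |a⁻¹| • (volume : Measure Space3) := by
  have h1 : Measure.map (axialScale a) volume =
      (Measure.map (fun t => a * t) (volume : Measure ℝ)).prod
        (Measure.map id (volume : Measure Plane)) := by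
    rw [Measure.map_prod_map _ _ (measurable_const_mul a) measurable_id]
    rfl
  rw [h1, Real.map_volume_mul_left ha, Measure.map_id, Measure.prod_smul_left]
  rfl

theorem integral_comp_axialScale {a : ℝ} (ha : a ≠ 0) (f : Space3 → ℝ) :
    ∫ x, f (axialScale a x) = |a⁻¹| * ∫ x, f x := by
  rw [← (measurableEmbedding_axialScale ha).integral_map, map_axialScale ha,
    integral_smul_measure, ENNReal.toReal_ofReal (abs_nonneg _), smul_eq_mul]

theorem setLIntegral_comp_axialScale {a : ℝ} (ha : a ≠ 0) (s : Set Space3)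
    (f : Space3 → ENNReal) :
    ∫⁻ x in axialScale a ⁻¹' s, f (axialScale a x) = ENNReal.ofReal |a⁻¹| * ∫⁻ x in s, f x := by
  rw [← (measurableEmbedding_axialScale ha).lintegral_map, ← (measurableEmbedding_axialScale
    ha).restrict_map, map_axialScale ha, Measure.restrict_smul, lintegral_smul_measure, smul_eq_mul]

/-! ### Squeezing a field along the axis -/

/-- The inverse `(A¹ | h A² | h A³)` of the rescaling `A_h`. -/
noncomputable def unrescale (h : ℝ) (A : Mat3) : Mat3 :=
  Matrix.of fun i j => if j = 0 then A i j else h * A i j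

theorem rescale_unrescale {h : ℝ} (hh : h ≠ 0) (A : Mat3) : rescale h (unrescale h A) = A := by
  ext i j
  simp only [rescale, unrescale, Matrix.of_apply]
  split_ifs
  · rfl
  · rw [one_div, inv_mul_cancel_left₀ hh]

theorem unrescale_add (h : ℝ) (A B : Mat3) :
    unrescale h (A + B) = unrescale h A + unrescale h B := by
  ext i j
  simp only [unrescale, Matrix.of_apply, Matrix.add_apply]
  split_ifs
  · rfl
  · ring

/-- Squeezing a field in the axial direction and unrescaling its columns multiplies the Burgers
vector by `h`. -/
theorem HasDislocationCurl.squeeze {r ℓ h : ℝ} (hh : 0 < h) {c : ℝ → Plane}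
    {b : EuclideanSpace ℝ (Fin 3)} {T : Space3 → Mat3}
    (hT : HasDislocationCurl (cyl univ r) ℓ c b T) :
    HasDislocationCurl (cyl univ r) ℓ c (h • b)
      fun x => unrescale h (T (axialScale h⁻¹ x)) := by
  intro φ hφ hc hU i
  let A : Space3 →L[ℝ] Space3 :=
    (h • ContinuousLinearMap.fst ℝ ℝ Plane).prod (ContinuousLinearMap.snd ℝ ℝ Plane)
  have hA : ∀ y, axialScale h y = A y := fun y => rfl
  let wt : Fin 3 → ℝ := fun k => if k = 0 then h else 1
  let ψ : Space3 → Fin 3 → ℝ := fun y k => wt k * φ (A y) k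
  have hψ : ContDiff ℝ ∞ ψ :=
    contDiff_pi.2 fun k => contDiff_const.mul ((contDiff_pi.1 hφ k).comp A.contDiff)
  have hzero : ∀ y, A y ∉ tsupport φ → ψ y = 0 := by
    intro y hy
    funext k
    simp [ψ, image_eq_zero_of_notMem_tsupport hy]
  have hts : tsupport ψ ⊆ A ⁻¹' tsupport φ := by
    refine closure_minimal (fun y hy => ?_) ((isClosed_tsupport φ).preimage A.continuous)
    by_contra h'
    exact hy (hzero y h')
  have hψc : HasCompactSupport ψ := by
    have h1 : IsCompact (A ⁻¹' tsupport φ) :=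
      ((Homeomorph.mulLeft₀ h hh.ne').prodCongr (Homeomorph.refl Plane)).isClosedEmbedding
        |>.isCompact_preimage hc.isCompact
    exact HasCompactSupport.of_support_subset_isCompact h1 ((subset_tsupport _).trans hts)
  have hψU : tsupport ψ ⊆ cyl univ r := fun y hy => ⟨mem_univ _, (hU (hts hy)).2⟩
  have hAc : ∀ j, A (coordVec j) = wt j • coordVec j := by
    intro j
    fin_cases j
    · simp [A, coordVec, wt]
    · simp [A, coordVec, wt]
    · simp [A, coordVec, wt]
  have hpd : ∀ j k y, partialD ψ j k y = wt k * (wt j * partialD φ j k (A y)) := by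
    intro j k y
    rw [partialD_eq hψ, partialD_eq hφ]
    have h1 : HasFDerivAt (fun x => φ x k) (fderiv ℝ (fun x => φ x k) (A y)) (A y) :=
      ((contDiff_pi.1 hφ k).differentiable (by simp) _).hasFDerivAt
    have h2 : HasFDerivAt (fun y => ψ y k)
        (wt k • (fderiv ℝ (fun x => φ x k) (A y)).comp A) y :=
      (h1.comp y A.hasFDerivAt).const_mul (wt k)
    rw [h2.fderiv]
    simp [hAc]
  have hcurl : ∀ y, ∑ j, T y i j * curl ψ y j =
      ∑ j, unrescale h (T (axialScale h⁻¹ (axialScale h y))) i j * curl φ (axialScale h y) j := by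
    intro y
    have h1 : axialScale h⁻¹ (axialScale h y) = y := by
      simp [axialScale, inv_mul_cancel_left₀ hh.ne']
    rw [h1, Fin.sum_univ_three, Fin.sum_univ_three, hA]
    simp [curl, hpd, unrescale, wt]
    ring
  have h1 := hT ψ hψ hψc hψU i
  rw [setIntegral_mul_curl_eq hψU] at h1
  rw [setIntegral_mul_curl_eq hU]
  simp_rw [hcurl] at h1
  rw [integral_comp_axialScale hh.ne'
    (fun x => ∑ j, unrescale h (T (axialScale h⁻¹ x)) i j * curl φ x j),
    abs_of_pos (inv_pos.2 hh)] at h1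
  have h2 : lineAction ℓ c ψ = lineAction ℓ c φ := by
    have h3 : ∀ s, A (0, c s) = (0, c s) := fun s => by simp [A]
    simp [lineAction, ψ, wt, h3]
  rw [h2] at h1
  rw [PiLp.smul_apply, smul_eq_mul]
  have h4 := congrArg (fun t => h * t) h1
  simp only [mul_inv_cancel_left₀ hh.ne'] at h4
  rw [h4]
  ring

/-! ### Averages of the filling over disks -/

/-- The average of `w` over the ball of radius `x₁` about `x'`, with weight `ρ` rescaled to unit
mass on that ball. -/
noncomputable def mollify (w ρ : Plane → ℝ) (x : Space3) : ℝ :=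
  (x.1 ^ 2)⁻¹ * ∫ y, w y * ρ (x.1⁻¹ • (x.2 - y))

/-- The averages of the form taken by the partial derivatives of `mollify w ρ`. -/
noncomputable def kernelAvg (w G : Plane → ℝ) (x : Space3) : ℝ :=
  (x.1 ^ 3)⁻¹ * ∫ y, w y * G (x.1⁻¹ • (x.2 - y))

theorem integral_comp_dilate {t : ℝ} (ht : 0 < t) (x : Plane) (f : Plane → ℝ) :
    ∫ y, f (t⁻¹ • (x - y)) = t ^ 2 * ∫ z, f z := by
  rw [integral_sub_left_eq_self (fun y => f (t⁻¹ • y)) volume x,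
    Measure.integral_comp_smul, finrank_euclideanSpace_fin, inv_pow, inv_inv,
    abs_of_pos (by positivity), smul_eq_mul]

theorem lintegral_comp_dilate {t : ℝ} (ht : 0 < t) (x : Plane) {f : Plane → ENNReal}
    (hf : Measurable f) :
    ∫⁻ y, f (t⁻¹ • (y - x)) = ENNReal.ofReal (t ^ 2) * ∫⁻ z, f z := by
  rw [lintegral_sub_right_eq_self (fun y => f (t⁻¹ • y)) x,
    ← lintegral_map hf (measurable_const_smul t⁻¹),
    Measure.map_addHaar_smul _ (inv_ne_zero ht.ne'), finrank_euclideanSpace_fin, inv_pow, inv_inv,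
    abs_of_pos (by positivity), lintegral_smul_measure, smul_eq_mul]

section Filling

variable {C : NNReal} {γ : ℝ → Plane} {T B R : ℝ} {w : Plane → ℝ}

theorem IsCurveFilling.hasCompactSupport (hw : IsCurveFilling C γ T B R w) :
    HasCompactSupport w := by
  refine HasCompactSupport.intro (isCompact_closedBall 0 R) fun y hy => hw.eq_zero y ?_
  rw [mem_closedBall_zero_iff, not_le] at hy
  exact hy.le

theorem IsCurveFilling.integrable (hw : IsCurveFilling C γ T B R w) : Integrable w := by
  have h1 : IntegrableOn w (Metric.closedBall 0 R) :=
    Measure.integrableOn_of_bounded (M := B) (isCompact_closedBall _ _).measure_lt_top.ne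
      hw.measurable.aestronglyMeasurable (Eventually.of_forall hw.abs_le)
  have h2 : IntegrableOn w univ := h1.of_forall_sdiff_eq_zero MeasurableSet.univ fun y hy => by
    have := hy.2
    rw [mem_closedBall_zero_iff, not_le] at this
    exact hw.eq_zero y this.le
  rwa [integrableOn_univ] at h2

theorem IsCurveFilling.integrable_mul_dilate (hw : IsCurveFilling C γ T B R w) {G : Plane → ℝ}
    (hG : Continuous G) (hGc : HasCompactSupport G) (x : Space3) :
    Integrable fun y => w y * G (x.1⁻¹ • (x.2 - y)) := by
  obtain ⟨M, hM⟩ := hGc.exists_bound_of_continuous hG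
  exact hw.integrable.mul_bdd (c := M) (by fun_prop) (Eventually.of_forall fun y => hM _)

theorem IsCurveFilling.kernelAvg_add (hw : IsCurveFilling C γ T B R w) {G G' : Plane → ℝ}
    (hG : Continuous G) (hGc : HasCompactSupport G) (hG' : Continuous G')
    (hGc' : HasCompactSupport G') (x : Space3) :
    kernelAvg w (fun z => G z + G' z) x = kernelAvg w G x + kernelAvg w G' x := by
  simp only [kernelAvg, mul_add]
  rw [integral_add (hw.integrable_mul_dilate hG hGc x) (hw.integrable_mul_dilate hG' hGc' x),
    mul_add]

theorem IsCurveFilling.abs_average_le (hw : IsCurveFilling C γ T B R w) {G : Plane → ℝ}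
    (hG : Continuous G) (hGc : HasCompactSupport G) {x : Space3} (hx : 0 < x.1) :
    |∫ y, w y * G (x.1⁻¹ • (x.2 - y))| ≤ B * (x.1 ^ 2 * ∫ z, |G z|) := by
  rw [← integral_comp_dilate hx x.2 fun z => |G z|, ← integral_const_mul, ← Real.norm_eq_abs]
  have hi : Integrable fun y => |G (x.1⁻¹ • (x.2 - y))| := by
    have h1 : Integrable G := hG.integrable_of_hasCompactSupport hGc
    exact ((h1.comp_smul (inv_ne_zero hx.ne')).comp_sub_left x.2).abs
  refine norm_integral_le_of_norm_le (hi.const_mul B) (Eventually.of_forall fun y => ?_)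
  rw [norm_mul]
  exact mul_le_mul_of_nonneg_right (hw.abs_le y) (abs_nonneg _)

/-- The bound on derivatives that comes from the boundedness of the filling. -/
theorem IsCurveFilling.abs_kernelAvg_le (hw : IsCurveFilling C γ T B R w) {G : Plane → ℝ}
    (hG : Continuous G) (hGc : HasCompactSupport G) {x : Space3} (hx : 0 < x.1) :
    |kernelAvg w G x| ≤ (B * ∫ z, |G z|) / x.1 := by
  rw [kernelAvg, abs_mul, abs_of_pos (by positivity)]
  calc (x.1 ^ 3)⁻¹ * |∫ y, w y * G (x.1⁻¹ • (x.2 - y))|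
      ≤ (x.1 ^ 3)⁻¹ * (B * (x.1 ^ 2 * ∫ z, |G z|)) :=
        mul_le_mul_of_nonneg_left (hw.abs_average_le hG hGc hx) (by positivity)
    _ = (B * ∫ z, |G z|) / x.1 := by field_simp

theorem continuous_partial {g : Plane → ℝ} (hg : ContDiff ℝ 1 g) (e : Plane) :
    Continuous fun z => fderiv ℝ g z e :=
  (hg.continuous_fderiv one_ne_zero).clm_apply continuous_const

/-- The bound on derivatives that comes from the finite length of the curve: by Green's formula an
average of `w` against a partial derivative is a line integral. -/
theorem IsCurveFilling.abs_kernelAvg_partial_le (hw : IsCurveFilling C γ T B R w) {g : Plane → ℝ}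
    (hg : ContDiff ℝ 1 g) (hgc : HasCompactSupport g) (i : Fin 2) {x : Space3} (hx : 0 < x.1) :
    |kernelAvg w (fun z => fderiv ℝ g z (EuclideanSpace.single i 1)) x| ≤
      (x.1 ^ 2)⁻¹ * ∫ s in (0 : ℝ)..T, C * |g (x.1⁻¹ • (x.2 - γ s))| := by
  let f : Plane → ℝ := fun y => g (x.1⁻¹ • (x.2 - y))
  have haff : ∀ y : Plane, HasFDerivAt (fun y : Plane => x.1⁻¹ • (x.2 - y))
      (x.1⁻¹ • (-ContinuousLinearMap.id ℝ Plane)) y := fun y =>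
    ((hasFDerivAt_id y).const_sub x.2).const_smul x.1⁻¹
  have hf : ContDiff ℝ 1 f := hg.comp (by fun_prop : ContDiff ℝ 1 fun y => x.1⁻¹ • (x.2 - y))
  have hfc : HasCompactSupport f :=
    hgc.comp_homeomorph ((Homeomorph.subLeft x.2).trans
      (Homeomorph.smulOfNeZero x.1⁻¹ (inv_ne_zero hx.ne')))
  have hfd : ∀ y e, fderiv ℝ f y e = -x.1⁻¹ * fderiv ℝ g (x.1⁻¹ • (x.2 - y)) e := by
    intro y e
    have h1 : HasFDerivAt f _ y :=
      (hg.differentiable one_ne_zero (x.1⁻¹ • (x.2 - y))).hasFDerivAt.comp y (haff y)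
    rw [h1.fderiv]
    simp
  have hk : kernelAvg w (fun z => fderiv ℝ g z (EuclideanSpace.single i 1)) x =
      -(x.1 ^ 2)⁻¹ * ∫ y, fderiv ℝ f y (EuclideanSpace.single i 1) * w y := by
    rw [kernelAvg, ← integral_const_mul, ← integral_const_mul]
    refine integral_congr_ae (Eventually.of_forall fun y => ?_)
    simp only [hfd]
    have : (x.1 ^ 3)⁻¹ = (x.1 ^ 2)⁻¹ * x.1⁻¹ := by rw [← mul_inv]; ring
    rw [this]
    ring
  have hline : ∀ j, |∫ s in (0 : ℝ)..T, f (γ s) * deriv γ s j| ≤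
      ∫ s in (0 : ℝ)..T, C * |g (x.1⁻¹ • (x.2 - γ s))| := by
    intro j
    rw [← Real.norm_eq_abs]
    refine intervalIntegral.norm_integral_le_of_norm_le hw.length_nonneg
      (Eventually.of_forall fun s _ => ?_) ?_
    · rw [norm_mul, mul_comm]
      refine mul_le_mul_of_nonneg_right ?_ (abs_nonneg _)
      exact (PiLp.norm_apply_le _ _).trans (norm_deriv_le_of_lipschitz hw.lipschitz)
    · have hγ := hw.lipschitz.continuous
      have hg' := hg.continuous
      have h1 : Continuous fun s => C * |g (x.1⁻¹ • (x.2 - γ s))| := by fun_prop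
      exact h1.intervalIntegrable _ _
  rw [hk, abs_mul, abs_neg, abs_of_pos (by positivity)]
  refine mul_le_mul_of_nonneg_left ?_ (by positivity)
  fin_cases i
  · have := hline 1
    rwa [hw.green_one f hf hfc] at this
  · have := hline 0
    rwa [hw.green_zero f hf hfc, abs_neg] at this

theorem IsCurveFilling.measurable_kernelAvg (hw : IsCurveFilling C γ T B R w) {G : Plane → ℝ}
    (hG : Continuous G) : Measurable (kernelAvg w G) := by
  refine Measurable.mul (by fun_prop) ?_
  have h1 : Measurable fun q : Space3 × Plane => w q.2 * G (q.1.1⁻¹ • (q.1.2 - q.2)) :=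
    (hw.measurable.comp measurable_snd).mul (hG.measurable.comp (by fun_prop))
  exact (h1.stronglyMeasurable.integral_prod_right (ν := volume)).measurable

/-- The derivatives of the averaged filling are `p`-integrable for `p < 2`: interpolate between the
bound `1 / x₁` and the bound by a line integral, whose integral over a slice does not depend on
`x₁`. -/
theorem IsCurveFilling.memLp_kernelAvg_partial (hw : IsCurveFilling C γ T B R w) {g : Plane → ℝ}
    (hg : ContDiff ℝ 1 g) (hgc : HasCompactSupport g) (i : Fin 2) {p : ℝ} (hp₁ : 1 < p)
    (hp₂ : p < 2) :
    MemLp (kernelAvg w (fun z => fderiv ℝ g z (EuclideanSpace.single i 1))) (ENNReal.ofReal p)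
      (volume.restrict (Ioo 0 2 ×ˢ univ)) := by
  have hp0 : 0 < p := by linarith
  set G : Plane → ℝ := fun z => fderiv ℝ g z (EuclideanSpace.single i 1) with hGdef
  have hG : Continuous G := continuous_partial hg _
  have hGc : HasCompactSupport G := hgc.fderiv_apply ℝ _
  have hm := hw.measurable_kernelAvg hG
  refine ⟨hm.aestronglyMeasurable, ?_⟩
  rw [eLpNorm_lt_top_iff_lintegral_rpow_enorm_lt_top (by simpa using hp0) (by simp),
    ENNReal.toReal_ofReal hp0.le]
  set A : ℝ := B * ∫ z, |G z| with hA
  have hA0 : 0 ≤ A := mul_nonneg hw.bound_nonneg (integral_nonneg fun z => abs_nonneg _)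
  let N : ENNReal := ∫⁻ z, ‖g z‖ₑ
  have hN : N < ⊤ := (hg.continuous.integrable_of_hasCompactSupport hgc).2
  have hgm : Measurable fun z => ‖g z‖ₑ := hg.continuous.measurable.enorm
  have hkm : Measurable fun q : ℝ × Plane × ℝ => ‖g (q.1⁻¹ • (q.2.1 - γ q.2.2))‖ₑ :=
    hgm.comp (by
      have := hw.lipschitz.continuous.measurable
      fun_prop)
  have hpt : ∀ x : Space3, 0 < x.1 → ‖kernelAvg w G x‖ₑ ^ p ≤
      ENNReal.ofReal ((A / x.1) ^ (p - 1)) * (ENNReal.ofReal ((x.1 ^ 2)⁻¹) * (C *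
        ∫⁻ s in Ioc 0 T, ‖g (x.1⁻¹ • (x.2 - γ s))‖ₑ)) := by
    intro x hx
    have e1 : ‖kernelAvg w G x‖ₑ ^ p = ‖kernelAvg w G x‖ₑ ^ (p - 1) * ‖kernelAvg w G x‖ₑ := by
      have := ENNReal.rpow_add_of_nonneg (x := ‖kernelAvg w G x‖ₑ) (p - 1) 1 (by linarith) zero_le_one
      rwa [sub_add_cancel, ENNReal.rpow_one] at this
    rw [e1]
    refine mul_le_mul' ?_ ?_
    · rw [← ofReal_norm, ENNReal.ofReal_rpow_of_nonneg (norm_nonneg _) (by linarith)]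
      refine ENNReal.ofReal_le_ofReal (Real.rpow_le_rpow (norm_nonneg _) ?_ (by linarith))
      exact hw.abs_kernelAvg_le hG hGc hx
    · rw [← ofReal_norm, Real.norm_eq_abs]
      refine (ENNReal.ofReal_le_ofReal (hw.abs_kernelAvg_partial_le hg hgc i hx)).trans ?_
      rw [ENNReal.ofReal_mul (by positivity), intervalIntegral.integral_of_le hw.length_nonneg,
        integral_const_mul, ENNReal.ofReal_mul C.coe_nonneg, ENNReal.ofReal_coe_nnreal]
      refine mul_le_mul_right (mul_le_mul_right ?_ _) _
      refine (ENNReal.ofReal_le_ofReal (le_abs_self _)).trans ?_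
      rw [← Real.norm_eq_abs, ofReal_norm]
      refine (enorm_integral_le_lintegral_enorm _).trans (le_of_eq ?_)
      refine lintegral_congr fun s => ?_
      rw [← ofReal_norm, ← ofReal_norm, Real.norm_eq_abs, abs_abs, Real.norm_eq_abs]
  have hslice : ∀ t : ℝ, 0 < t → ∫⁻ y : Plane, (ENNReal.ofReal ((t ^ 2)⁻¹) * (C *
        ∫⁻ s in Ioc 0 T, ‖g (t⁻¹ • (y - γ s))‖ₑ)) = C * (ENNReal.ofReal T * N) := by
    intro t ht
    rw [lintegral_const_mul' _ _ (by finiteness), lintegral_const_mul' _ _ (by finiteness),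
      lintegral_lintegral_swap (f := fun y s => ‖g (t⁻¹ • (y - γ s))‖ₑ)
        (hkm.comp ((measurable_const (a := t)).prodMk measurable_id)).aemeasurable]
    simp_rw [lintegral_comp_dilate ht _ hgm]
    rw [setLIntegral_const, Real.volume_Ioc, sub_zero, ← mul_assoc, ← mul_assoc,
      mul_comm _ (C : ENNReal), mul_assoc, mul_assoc, mul_comm _ (ENNReal.ofReal T)]
    congr 1
    rw [mul_left_comm]
    congr 1
    rw [← mul_assoc, ← ENNReal.ofReal_mul (by positivity), inv_mul_cancel₀ (by positivity),
      ENNReal.ofReal_one, one_mul]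
  calc ∫⁻ x in Ioo 0 2 ×ˢ univ, ‖kernelAvg w G x‖ₑ ^ p
      ≤ ∫⁻ x in Ioo 0 2 ×ˢ univ, ENNReal.ofReal ((A / x.1) ^ (p - 1)) *
          (ENNReal.ofReal ((x.1 ^ 2)⁻¹) * (C * ∫⁻ s in Ioc 0 T, ‖g (x.1⁻¹ • (x.2 - γ s))‖ₑ)) :=
        setLIntegral_mono_ae' (measurableSet_Ioo.prod MeasurableSet.univ)
          (Eventually.of_forall fun x hx => hpt x hx.1.1)
    _ ≤ ∫⁻ t in Ioo (0 : ℝ) 2, ∫⁻ y : Plane, ENNReal.ofReal ((A / t) ^ (p - 1)) *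
          (ENNReal.ofReal ((t ^ 2)⁻¹) * (C * ∫⁻ s in Ioc 0 T, ‖g (t⁻¹ • (y - γ s))‖ₑ)) := by
        rw [Measure.volume_eq_prod, ← Measure.prod_restrict, Measure.restrict_univ]
        exact lintegral_prod_le _
    _ = ∫⁻ t in Ioo (0 : ℝ) 2, ENNReal.ofReal ((A / t) ^ (p - 1)) *
          (C * (ENNReal.ofReal T * N)) := by
        refine setLIntegral_congr_fun measurableSet_Ioo fun t ht => ?_
        rw [lintegral_const_mul' _ _ (by finiteness), hslice t ht.1]
    _ = (∫⁻ t in Ioo (0 : ℝ) 2, ENNReal.ofReal ((A / t) ^ (p - 1))) *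
          (C * (ENNReal.ofReal T * N)) := by
        rw [lintegral_mul_const' _ _ (by finiteness)]
    _ < ⊤ := by
        refine ENNReal.mul_lt_top ?_ (by finiteness)
        have h1 : IntegrableOn (fun t : ℝ => A ^ (p - 1) * t ^ (1 - p)) (Ioo 0 2) :=
          Integrable.const_mul
            ((intervalIntegral.integrableOn_Ioo_rpow_iff two_pos).2 (by linarith)) _
        have h2 : ∫⁻ t in Ioo (0 : ℝ) 2, ENNReal.ofReal ((A / t) ^ (p - 1)) =
            ∫⁻ t in Ioo (0 : ℝ) 2, ‖A ^ (p - 1) * t ^ (1 - p)‖ₑ := by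
          refine setLIntegral_congr_fun measurableSet_Ioo fun t ht => ?_
          have ht0 : 0 < t := ht.1
          rw [Real.enorm_of_nonneg (by positivity), Real.div_rpow hA0 ht0.le, div_eq_mul_inv,
            ← Real.rpow_neg ht0.le, neg_sub]
        rw [h2]
        exact h1.2

end Filling

/-! ### The averaged filling and its derivatives -/

/-- A twice continuously differentiable probability density supported in the unit disk. -/
structure IsUnitMollifier (ρ : Plane → ℝ) : Prop where
  contDiff : ContDiff ℝ 2 ρ
  nonneg : ∀ z, 0 ≤ ρ z
  integral_eq : ∫ z, ρ z = 1
  eq_zero : ∀ z, 1 ≤ ‖z‖ → ρ z = 0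

theorem exists_isUnitMollifier : ∃ ρ, IsUnitMollifier ρ := by
  let φ : ContDiffBump (0 : Plane) := ⟨1 / 2, 1, by norm_num, by norm_num⟩
  refine ⟨φ.normed volume, φ.contDiff_normed, φ.nonneg_normed, φ.integral_normed, fun z hz => ?_⟩
  have h : z ∉ Function.support (φ.normed volume) := by
    rw [φ.support_normed_eq, mem_ball_zero_iff]
    exact not_lt.2 hz
  simpa using h

theorem IsUnitMollifier.hasCompactSupport {ρ : Plane → ℝ} (hρ : IsUnitMollifier ρ) :
    HasCompactSupport ρ := by
  refine HasCompactSupport.intro (isCompact_closedBall 0 1) fun z hz => hρ.eq_zero z ?_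
  rw [mem_closedBall_zero_iff, not_le] at hz
  exact hz.le

section Mollify

variable {C : NNReal} {γ : ℝ → Plane} {T B R : ℝ} {w ρ : Plane → ℝ}

theorem IsCurveFilling.abs_mollify_le (hw : IsCurveFilling C γ T B R w) (hρ : IsUnitMollifier ρ)
    {x : Space3} (hx : 0 < x.1) : |mollify w ρ x| ≤ B := by
  rw [mollify, abs_mul, abs_of_pos (by positivity)]
  have h1 := hw.abs_average_le hρ.contDiff.continuous hρ.hasCompactSupport hx
  have h2 : ∫ z, |ρ z| = 1 := by
    rw [← hρ.integral_eq]
    exact integral_congr_ae (Eventually.of_forall fun z => abs_of_nonneg (hρ.nonneg z))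
  rw [h2, mul_one] at h1
  rw [inv_mul_le_iff₀ (by positivity)]
  linarith

/-- Near the plane `x₁ = 0`, the average of `w` is `w`, except on the curve. -/
theorem IsUnitMollifier.mollify_eventually_eq (hρ : IsUnitMollifier ρ) {y : Plane}
    (hy : ∀ᶠ z in 𝓝 y, w z = w y) : ∀ᶠ t in 𝓝[>] (0 : ℝ), mollify w ρ (t, y) = w y := by
  obtain ⟨δ, hδ, h⟩ := Metric.eventually_nhds_iff.1 hy
  filter_upwards [Ioo_mem_nhdsGT hδ] with t ht
  have ht0 : 0 < t := ht.1
  have h1 : ∀ z, w z * ρ (t⁻¹ • (y - z)) = w y * ρ (t⁻¹ • (y - z)) := by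
    intro z
    by_cases hz : dist z y < δ
    · rw [h hz]
    · rw [hρ.eq_zero, mul_zero, mul_zero]
      rw [norm_smul, norm_inv, Real.norm_of_nonneg ht0.le, ← dist_eq_norm, dist_comm,
        inv_mul_eq_div, one_le_div ht0]
      linarith [ht.2]
  rw [mollify]
  simp only [h1]
  rw [integral_const_mul, integral_comp_dilate ht0, hρ.integral_eq]
  field_simp

/-- The averaged function is continuously differentiable for `x₁ > 0`, with the expected
derivative. -/
theorem IsCurveFilling.mollify_deriv (hw : IsCurveFilling C γ T B R w) (hρ : IsUnitMollifier ρ)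
    {x : Space3} (hx : 0 < x.1) : ContDiffAt ℝ 1 (mollify w ρ) x ∧ ∀ v : Space3,
      fderiv ℝ (mollify w ρ) x v = kernelAvg w
        (fun z => -(v.1 * (2 * ρ z + fderiv ℝ ρ z z)) + fderiv ℝ ρ z v.2) x := by
  let k : ℝ → Plane → ℝ := fun t z => (t ^ 2)⁻¹ * ρ (t⁻¹ • z)
  let L : ℝ →L[ℝ] ℝ →L[ℝ] ℝ := ContinuousLinearMap.mul ℝ ℝ
  let s : Set ℝ := Ioo 0 (x.1 + 1)
  have hρd : Differentiable ℝ ρ := hρ.contDiff.differentiable two_ne_zero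
  have hms : mollify w ρ = fun q : ℝ × Plane => (convolution w (k q.1) L volume) q.2 := by
    funext q
    rw [convolution_def, mollify, ← integral_const_mul]
    refine integral_congr_ae (Eventually.of_forall fun y => ?_)
    simp only [L, k, ContinuousLinearMap.mul_apply']
    ring
  have hks : ∀ p, ∀ z, p ∈ s → z ∉ Metric.closedBall (0 : Plane) (x.1 + 1) → k p z = 0 := by
    intro p z hp hz
    rw [mem_closedBall_zero_iff, not_le] at hz
    simp only [k]
    rw [hρ.eq_zero, mul_zero]
    rw [norm_smul, norm_inv, Real.norm_of_nonneg hp.1.le, inv_mul_eq_div, one_le_div hp.1]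
    linarith [hp.2]
  have hkc : ContDiffOn ℝ 1 (fun q : ℝ × Plane => k q.1 q.2) (s ×ˢ univ) := by
    intro q hq
    have hq0 : q.1 ≠ 0 := hq.1.1.ne'
    have h1 : ContDiffAt ℝ 1 (fun q : ℝ × Plane => (q.1 ^ 2)⁻¹) q :=
      (contDiffAt_fst.pow 2).inv (pow_ne_zero 2 hq0)
    have h2 : ContDiffAt ℝ 1 (fun q : ℝ × Plane => q.1⁻¹ • q.2) q :=
      (contDiffAt_fst.inv hq0).smul contDiffAt_snd
    have h3 : ContDiffAt ℝ 1 ρ (q.1⁻¹ • q.2) := hρ.contDiff.contDiffAt.of_le one_le_two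
    exact (h1.mul (h3.comp q h2)).contDiffWithinAt
  have hwl : LocallyIntegrable w := hw.integrable.locallyIntegrable
  have hxs : x.1 ∈ s := ⟨hx, by linarith⟩
  have hso : IsOpen (s ×ˢ (univ : Set Plane)) := isOpen_Ioo.prod isOpen_univ
  constructor
  · rw [hms]
    have h := contDiffOn_convolution_right_with_param (n := 1) L isOpen_Ioo
      (isCompact_closedBall 0 (x.1 + 1)) hks hwl hkc (μ := volume)
    exact h.contDiffAt (hso.mem_nhds ⟨hxs, mem_univ _⟩)
  intro v
  have h := hasFDerivAt_convolution_right_with_param L isOpen_Ioo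
      (isCompact_closedBall 0 (x.1 + 1)) hks hwl hkc x hxs (μ := volume)
  have hkd : ∀ z v, fderiv ℝ (fun q : ℝ × Plane => k q.1 q.2) (x.1, z) v =
      (x.1 ^ 3)⁻¹ * (-(v.1 * (2 * ρ (x.1⁻¹ • z) + fderiv ℝ ρ (x.1⁻¹ • z) (x.1⁻¹ • z))) +
        fderiv ℝ ρ (x.1⁻¹ • z) v.2) := by
    intro z v
    have h1 : HasFDerivAt (fun q : ℝ × Plane => q.1⁻¹) (-(x.1 ^ 2)⁻¹ •
        ContinuousLinearMap.fst ℝ ℝ Plane) (x.1, z) :=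
      (hasDerivAt_inv hx.ne').comp_hasFDerivAt (x.1, z) hasFDerivAt_fst
    have h2 := h1.smul (hasFDerivAt_snd (p := (x.1, z)) (𝕜 := ℝ) (E := ℝ) (F := Plane))
    have h3 := (hρd (x.1⁻¹ • z)).hasFDerivAt.comp (x.1, z) h2
    have h4 := ((h1.pow 2).mul h3)
    have h5 : (fun q : ℝ × Plane => k q.1 q.2) = (fun q : ℝ × Plane => q.1⁻¹ ^ 2) *
        (ρ ∘ fun q : ℝ × Plane => q.1⁻¹ • q.2) := by
      funext q
      simp [k]
    rw [h5]
    refine (DFunLike.congr_fun h4.fderiv v).trans ?_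
    simp
    field_simp
    ring
  rw [← hms] at h
  rw [h.fderiv, convolution_def]
  have hcont : Continuous fun z => fderiv ℝ (fun q : ℝ × Plane => k q.1 q.2) (x.1, z) := by
    have h1 := hkc.continuousOn_fderiv_of_isOpen hso le_rfl
    exact h1.comp_continuous (by fun_prop) fun z => ⟨hxs, mem_univ _⟩
  have hsupp : HasCompactSupport fun z => fderiv ℝ (fun q : ℝ × Plane => k q.1 q.2) (x.1, z) := by
    refine HasCompactSupport.intro (isCompact_closedBall 0 (x.1 + 1)) fun z hz => ?_
    refine (hasFDerivAt_zero_of_eventually_const 0 ?_).fderiv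
    have h1 : s ×ˢ (Metric.closedBall (0 : Plane) (x.1 + 1))ᶜ ∈ 𝓝 (x.1, z) :=
      (isOpen_Ioo.prod Metric.isClosed_closedBall.isOpen_compl).mem_nhds ⟨hxs, hz⟩
    filter_upwards [h1] with q hq
    exact hks _ _ hq.1 hq.2
  have hex := hsupp.convolutionExists_right (L.precompR (ℝ × Plane)) hwl hcont (μ := volume) x.2
  refine (ContinuousLinearMap.integral_apply hex v).trans ?_
  rw [kernelAvg, ← integral_const_mul]
  refine integral_congr_ae (Eventually.of_forall fun y => ?_)
  have h6 : (L.precompR (ℝ × Plane) (w y)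
      (fderiv ℝ (fun q : ℝ × Plane => k q.1 q.2) (x.1, x.2 - y))) v =
      w y * fderiv ℝ (fun q : ℝ × Plane => k q.1 q.2) (x.1, x.2 - y) v := rfl
  refine h6.trans ?_
  rw [hkd]
  ring

/-- The partial derivatives of the averaged filling are `p`-integrable near `x₁ = 0`. -/
theorem IsCurveFilling.memLp_fderiv_mollify (hw : IsCurveFilling C γ T B R w)
    (hρ : IsUnitMollifier ρ) {p : ℝ} (hp₁ : 1 < p) (hp₂ : p < 2) (j : Fin 3) :
    MemLp (fun x => fderiv ℝ (mollify w ρ) x (coordVec j)) (ENNReal.ofReal p)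
      (volume.restrict (Ioo 0 2 ×ˢ univ)) := by
  have hms : MeasurableSet (Ioo (0 : ℝ) 2 ×ˢ (univ : Set Plane)) :=
    measurableSet_Ioo.prod MeasurableSet.univ
  have hρ1 : ContDiff ℝ 1 ρ := hρ.contDiff.of_le one_le_two
  have hpart : ∀ i : Fin 2, MemLp (fun x => fderiv ℝ (mollify w ρ) x
      ((0, EuclideanSpace.single i 1) : Space3)) (ENNReal.ofReal p)
      (volume.restrict (Ioo 0 2 ×ˢ univ)) := by
    intro i
    refine MemLp.ae_eq ?_ (hw.memLp_kernelAvg_partial hρ1 hρ.hasCompactSupport i hp₁ hp₂)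
    filter_upwards [ae_restrict_mem hms] with x hx
    rw [(hw.mollify_deriv hρ hx.1.1).2]
    simp
  have hd : ∀ z, HasFDerivAt ρ (fderiv ℝ ρ z) z := fun z =>
    (hρ1.differentiable one_ne_zero z).hasFDerivAt
  fin_cases j
  · -- The axial derivative of the kernel is a divergence in the plane.
    let g : Fin 2 → Plane → ℝ := fun i z => -(ρ z * z i)
    have hco : ∀ i : Fin 2, ContDiff ℝ 1 fun z : Plane => z i := fun i =>
      (EuclideanSpace.proj i : Plane →L[ℝ] ℝ).contDiff
    have hg : ∀ i, ContDiff ℝ 1 (g i) := fun i => (hρ1.mul (hco i)).neg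
    have hgc : ∀ i, HasCompactSupport (g i) := fun i => hρ.hasCompactSupport.mul_right.neg
    have hgd : ∀ z i, fderiv ℝ (g i) z (EuclideanSpace.single i 1) =
        -(ρ z + z i * fderiv ℝ ρ z (EuclideanSpace.single i 1)) := by
      intro z i
      have h2 : HasFDerivAt (fun z : Plane => z i) (EuclideanSpace.proj i : Plane →L[ℝ] ℝ) z :=
        (EuclideanSpace.proj i : Plane →L[ℝ] ℝ).hasFDerivAt
      have h1 : HasFDerivAt (g i) _ z := ((hd z).mul h2).neg
      rw [h1.fderiv]
      simp
    have hsum := (hw.memLp_kernelAvg_partial (hg 0) (hgc 0) 0 hp₁ hp₂).add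
      (hw.memLp_kernelAvg_partial (hg 1) (hgc 1) 1 hp₁ hp₂)
    refine MemLp.ae_eq ?_ hsum
    filter_upwards [ae_restrict_mem hms] with x hx
    rw [Pi.add_apply, ← hw.kernelAvg_add (continuous_partial (hg 0) _) ((hgc 0).fderiv_apply ℝ _)
      (continuous_partial (hg 1) _) ((hgc 1).fderiv_apply ℝ _), (hw.mollify_deriv hρ hx.1.1).2]
    congr 1
    funext z
    have hz : z = z 0 • EuclideanSpace.single 0 (1 : ℝ) + z 1 • EuclideanSpace.single 1 (1 : ℝ) := by
      ext i; fin_cases i <;> simp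
    have h3 : fderiv ℝ ρ z z = z 0 * fderiv ℝ ρ z (EuclideanSpace.single 0 1) +
        z 1 * fderiv ℝ ρ z (EuclideanSpace.single 1 1) := by
      conv_lhs => rw [hz]
      rw [map_add, map_smul, map_smul, smul_eq_mul, smul_eq_mul, ← hz]
    rw [hgd, hgd, h3]
    simp [coordVec]
    ring
  · exact hpart 0
  · exact hpart 1

end Mollify

/-! ### The slip field -/

/-- A smooth transition from the value `0` on `(-∞, 1]` to the value `1` on `[2, ∞)`. -/
noncomputable def cutoff (t : ℝ) : ℝ := Real.smoothTransition (t - 1)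

theorem contDiff_cutoff {n : ℕ∞} : ContDiff ℝ n cutoff :=
  Real.smoothTransition.contDiff.comp (contDiff_id.sub contDiff_const)

theorem cutoff_of_le {t : ℝ} (ht : t ≤ 1) : cutoff t = 0 :=
  Real.smoothTransition.zero_of_nonpos (by linarith)

theorem cutoff_of_ge {t : ℝ} (ht : 2 ≤ t) : cutoff t = 1 :=
  Real.smoothTransition.one_of_one_le (by linarith)

theorem cutoff_nonneg (t : ℝ) : 0 ≤ cutoff t := Real.smoothTransition.nonneg _

theorem cutoff_le_one (t : ℝ) : cutoff t ≤ 1 := Real.smoothTransition.le_one _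

theorem hasDerivAt_cutoff (t : ℝ) : HasDerivAt cutoff (deriv cutoff t) t :=
  ((contDiff_cutoff (n := 1)).differentiable one_ne_zero t).hasDerivAt

theorem continuous_deriv_cutoff : Continuous (deriv cutoff) :=
  (contDiff_cutoff (n := 1)).continuous_deriv le_rfl

theorem deriv_cutoff_of_le {t : ℝ} (ht : t ≤ 1) : deriv cutoff t = 0 := by
  refine IsLocalMin.deriv_eq_zero (Eventually.of_forall fun s => ?_)
  simpa only [cutoff_of_le ht] using cutoff_nonneg s

theorem deriv_cutoff_of_ge {t : ℝ} (ht : 2 ≤ t) : deriv cutoff t = 0 := by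
  refine IsLocalMax.deriv_eq_zero (Eventually.of_forall fun s => ?_)
  simpa only [cutoff_of_ge ht] using cutoff_le_one s

theorem hasCompactSupport_deriv_cutoff : HasCompactSupport (deriv cutoff) := by
  refine HasCompactSupport.intro (isCompact_Icc (a := 1) (b := 2)) fun t ht => ?_
  rcases not_and_or.1 ht with h | h
  · exact deriv_cutoff_of_le (not_le.1 h).le
  · exact deriv_cutoff_of_ge (not_le.1 h).le

theorem integral_deriv_cutoff : ∫ t, deriv cutoff t = 1 := by
  rw [integral_of_hasDerivAt_of_tendsto (m := 0) (n := 1) hasDerivAt_cutoff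
    (continuous_deriv_cutoff.integrable_of_hasCompactSupport hasCompactSupport_deriv_cutoff), sub_zero]
  · refine tendsto_const_nhds.congr' ?_
    filter_upwards [eventually_le_atBot 1] with t ht using (cutoff_of_le ht).symm
  · refine tendsto_const_nhds.congr' ?_
    filter_upwards [eventually_ge_atTop 2] with t ht using (cutoff_of_ge ht).symm

theorem exists_abs_deriv_cutoff_le : ∃ D, ∀ t, |deriv cutoff t| ≤ D :=
  hasCompactSupport_deriv_cutoff.exists_bound_of_continuous continuous_deriv_cutoff

theorem hasFDerivAt_cutoff_axial (a : ℝ) (x : Space3) :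
    HasFDerivAt (fun x : Space3 => cutoff (a * x.1))
      ((deriv cutoff (a * x.1) * a) • ContinuousLinearMap.fst ℝ ℝ Plane) x := by
  have h1 : HasFDerivAt (fun x : Space3 => a * x.1) (a • ContinuousLinearMap.fst ℝ ℝ Plane) x :=
    hasFDerivAt_fst.const_mul a
  have h2 := (hasDerivAt_cutoff (a * x.1)).comp_hasFDerivAt x h1
  rwa [smul_smul] at h2

/-- The averaged filling, cut off for large `x₁`. -/
noncomputable def slipPotential (w ρ : Plane → ℝ) (x : Space3) : ℝ :=
  (1 - cutoff x.1) * mollify w ρ x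

/-- The gradient of the slip potential for `x₁ > 0`, extended by zero. Since the potential jumps by
`w` across `x₁ = 0`, the curl of this field is carried by the curve. -/
noncomputable def slipField (w ρ : Plane → ℝ) (x : Space3) (j : Fin 3) : ℝ :=
  if 0 < x.1 then fderiv ℝ (slipPotential w ρ) x (coordVec j) else 0

section Slip

variable {C : NNReal} {γ : ℝ → Plane} {T B R : ℝ} {w ρ : Plane → ℝ}

theorem IsCurveFilling.measurable_mollify (hw : IsCurveFilling C γ T B R w)
    (hρ : IsUnitMollifier ρ) : Measurable (mollify w ρ) := by
  have h : mollify w ρ = fun x : Space3 => x.1 * kernelAvg w ρ x := by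
    funext x
    rw [mollify, kernelAvg, ← mul_assoc]
    congr 1
    rcases eq_or_ne x.1 0 with h | h
    · simp [h]
    · field_simp
  rw [h]
  exact measurable_fst.mul (hw.measurable_kernelAvg hρ.contDiff.continuous)

theorem IsCurveFilling.abs_slipPotential_le (hw : IsCurveFilling C γ T B R w)
    (hρ : IsUnitMollifier ρ) {x : Space3} (hx : 0 < x.1) : |slipPotential w ρ x| ≤ B := by
  rw [slipPotential, abs_mul, abs_of_nonneg (by linarith [cutoff_le_one x.1])]
  have h1 := hw.abs_mollify_le hρ hx
  nlinarith [cutoff_nonneg x.1, cutoff_le_one x.1, abs_nonneg (mollify w ρ x), hw.bound_nonneg]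

theorem IsCurveFilling.contDiffAt_slipPotential (hw : IsCurveFilling C γ T B R w)
    (hρ : IsUnitMollifier ρ) {x : Space3} (hx : 0 < x.1) :
    ContDiffAt ℝ 1 (slipPotential w ρ) x :=
  (contDiff_const.sub (contDiff_cutoff.comp contDiff_fst)).contDiffAt.mul (hw.mollify_deriv hρ hx).1

theorem IsCurveFilling.fderiv_slipPotential (hw : IsCurveFilling C γ T B R w)
    (hρ : IsUnitMollifier ρ) {x : Space3} (hx : 0 < x.1) (v : Space3) :
    fderiv ℝ (slipPotential w ρ) x v =
      (1 - cutoff x.1) * fderiv ℝ (mollify w ρ) x v - deriv cutoff x.1 * v.1 * mollify w ρ x := by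
  have h1 := (hasFDerivAt_cutoff_axial 1 x).const_sub 1
  simp only [one_mul, mul_one] at h1
  have h2 := ((hw.mollify_deriv hρ hx).1.differentiableAt one_ne_zero).hasFDerivAt
  refine (DFunLike.congr_fun (h1.mul h2).fderiv v).trans ?_
  simp
  ring

theorem IsCurveFilling.slipField_eq_zero (hw : IsCurveFilling C γ T B R w)
    (hρ : IsUnitMollifier ρ) {x : Space3} (hx : x.1 ∉ Ioo (0 : ℝ) 2) (j : Fin 3) :
    slipField w ρ x j = 0 := by
  rw [slipField]
  split_ifs with h
  · have h2 : 2 ≤ x.1 := by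
      by_contra h2
      exact hx ⟨h, not_le.1 h2⟩
    rw [hw.fderiv_slipPotential hρ h, cutoff_of_ge h2, deriv_cutoff_of_ge h2]
    ring
  · rfl

theorem IsCurveFilling.memLp_slipField (hw : IsCurveFilling C γ T B R w)
    (hρ : IsUnitMollifier ρ) {p : ℝ} (hp₁ : 1 < p) (hp₂ : p < 2) (r : ℝ) (j : Fin 3) :
    MemLp (fun x => slipField w ρ x j) (ENNReal.ofReal p) (volume.restrict (cyl univ r)) := by
  obtain ⟨D, hD⟩ := exists_abs_deriv_cutoff_le
  let s : Set Space3 := Ioo (0 : ℝ) 2 ×ˢ univ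
  have hs : MeasurableSet s := measurableSet_Ioo.prod MeasurableSet.univ
  have hind : (fun x => slipField w ρ x j) = s.indicator fun x =>
      (1 - cutoff x.1) * fderiv ℝ (mollify w ρ) x (coordVec j) -
        deriv cutoff x.1 * (coordVec j).1 * mollify w ρ x := by
    funext x
    by_cases hx : x ∈ s
    · rw [indicator_of_mem hx, slipField, if_pos hx.1.1, hw.fderiv_slipPotential hρ hx.1.1]
    · rw [indicator_of_notMem hx]
      exact hw.slipField_eq_zero hρ (fun h => hx ⟨h, mem_univ _⟩) j
  rw [hind, memLp_indicator_iff_restrict hs, Measure.restrict_restrict hs]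
  have hle : s ∩ cyl univ r ⊆ s := inter_subset_left
  have hfin : IsFiniteMeasure (volume.restrict (s ∩ cyl univ r)) := by
    refine ⟨?_⟩
    rw [Measure.restrict_apply_univ]
    refine (measure_mono (t := Icc (0 : ℝ) 2 ×ˢ Metric.closedBall (0 : Plane) r) ?_).trans_lt
      (isCompact_Icc.prod (isCompact_closedBall _ _)).measure_lt_top
    rintro x ⟨⟨h1, -⟩, -, h2⟩
    exact ⟨Ioo_subset_Icc_self h1, Metric.ball_subset_closedBall h2⟩
  have hc : Measurable fun x : Space3 => cutoff x.1 :=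
    (contDiff_cutoff (n := 1)).continuous.measurable.comp measurable_fst
  have hc' : Measurable fun x : Space3 => deriv cutoff x.1 :=
    continuous_deriv_cutoff.measurable.comp measurable_fst
  refine MemLp.sub ?_ ?_
  · have h1 := (hw.memLp_fderiv_mollify hρ hp₁ hp₂ j).mono_measure (Measure.restrict_mono hle le_rfl)
    refine h1.of_le ((hc.const_sub 1).aestronglyMeasurable.mul h1.1)
      (Eventually.of_forall fun x => ?_)
    rw [norm_mul, Real.norm_of_nonneg (by linarith [cutoff_le_one x.1])]
    exact mul_le_of_le_one_left (norm_nonneg _) (by linarith [cutoff_nonneg x.1])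
  · refine MemLp.of_bound ?_ (D * |(coordVec j).1| * B) ?_
    · exact ((hc'.mul_const _).mul (hw.measurable_mollify hρ)).aestronglyMeasurable
    · refine (ae_restrict_iff' (hs.inter (MeasurableSet.univ.prod measurableSet_ball))).2
        (Eventually.of_forall fun x hx => ?_)
      rw [Real.norm_eq_abs, abs_mul, abs_mul]
      have := hw.abs_mollify_le hρ hx.1.1.1
      have hDx := hD x.1
      have hD0 : 0 ≤ D := (abs_nonneg _).trans hDx
      gcongr

/-- The slip potential is continuously differentiable once it is switched off near `x₁ = 0`; the
cutoff adds a term to its gradient. -/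
theorem IsCurveFilling.contDiff_cutoff_mul (hw : IsCurveFilling C γ T B R w)
    (hρ : IsUnitMollifier ρ) {a : ℝ} (ha : 0 < a) :
    ContDiff ℝ 1 (fun x : Space3 => cutoff (a * x.1) * slipPotential w ρ x) ∧
    ∀ x v, fderiv ℝ (fun x : Space3 => cutoff (a * x.1) * slipPotential w ρ x) x v =
      if 0 < x.1 then cutoff (a * x.1) * fderiv ℝ (slipPotential w ρ) x v +
        a * deriv cutoff (a * x.1) * v.1 * slipPotential w ρ x else 0 := by
  have hneg : ∀ x : Space3, ¬ 0 < x.1 →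
      (fun x : Space3 => cutoff (a * x.1) * slipPotential w ρ x) =ᶠ[𝓝 x] fun _ => 0 := by
    intro x hx
    have h1 : ∀ᶠ y in 𝓝 x, a * y.1 < 1 := by
      refine (Continuous.tendsto (by fun_prop) x).eventually_lt_const ?_
      nlinarith [mul_nonneg ha.le (sub_nonneg.2 (not_lt.1 hx))]
    filter_upwards [h1] with y hy
    rw [cutoff_of_le hy.le, zero_mul]
  constructor
  · rw [contDiff_iff_contDiffAt]
    intro x
    by_cases hx : 0 < x.1
    · exact (contDiff_cutoff.comp (contDiff_const.mul contDiff_fst)).contDiffAt.mul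
        (hw.contDiffAt_slipPotential hρ hx)
    · exact contDiffAt_const.congr_of_eventuallyEq (hneg x hx)
  · intro x v
    split_ifs with hx
    · have h2 := ((hw.contDiffAt_slipPotential hρ hx).differentiableAt one_ne_zero).hasFDerivAt
      refine (DFunLike.congr_fun ((hasFDerivAt_cutoff_axial a x).mul h2).fderiv v).trans ?_
      simp
      ring
    · rw [(hneg x hx).fderiv_eq]
      simp

/-- Testing the slip field with a curl leaves the jump `w` of the slip potential across the plane
`x₁ = 0`. -/
theorem IsCurveFilling.integral_slipField_mul_curl (hw : IsCurveFilling C γ T B R w)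
    (hρ : IsUnitMollifier ρ) {φ : Space3 → Fin 3 → ℝ} (hφ : ContDiff ℝ ∞ φ)
    (hc : HasCompactSupport φ)
    (hE : ∀ j, Integrable fun x => slipField w ρ x j * curl φ x j) :
    ∫ x, ∑ j, slipField w ρ x j * curl φ x j = -∫ y, w y * curl φ (0, y) 0 := by
  let a : ℕ → ℝ := fun n => (n : ℝ) + 1
  have ha : ∀ n, 0 < a n := fun n => by positivity
  have hatop : Tendsto a atTop atTop := tendsto_atTop_add_const_right _ _ tendsto_natCast_atTop_atTop
  have hψ : Continuous fun x => curl φ x 0 := (contDiff_curl hφ 0).continuous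
  have hψc : HasCompactSupport fun x => curl φ x 0 := hasCompactSupport_curl hc 0
  obtain ⟨D, hD⟩ := exists_abs_deriv_cutoff_le
  obtain ⟨N, hN⟩ := hψc.exists_bound_of_continuous hψ
  have hN' : ∀ x, |curl φ x 0| ≤ N := hN
  have hVm : Measurable (slipPotential w ρ) :=
    (((contDiff_cutoff (n := 1)).continuous.measurable.comp measurable_fst).const_sub 1).mul
      (hw.measurable_mollify hρ)
  let g : ℕ → Space3 → ℝ := fun n x => cutoff (a n * x.1) * ∑ j, slipField w ρ x j * curl φ x j
  let k : ℕ → Space3 → ℝ := fun n x => deriv cutoff x.1 * slipPotential w ρ (axialScale (a n)⁻¹ x) *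
    curl φ (axialScale (a n)⁻¹ x) 0
  have hsum : Integrable fun x => ∑ j, slipField w ρ x j * curl φ x j :=
    integrable_finsetSum _ fun j _ => hE j
  have hcut : ∀ n, Continuous fun x : Space3 => cutoff (a n * x.1) := fun n =>
    (contDiff_cutoff (n := 1)).continuous.comp (by fun_prop)
  have hg1 : ∀ n, Integrable (g n) := fun n => hsum.bdd_mul (c := 1) (hcut n).aestronglyMeasurable
    (Eventually.of_forall fun x => by
      rw [Real.norm_of_nonneg (cutoff_nonneg _)]
      exact cutoff_le_one _)
  obtain ⟨R', hR'⟩ := hψc.isCompact.isBounded.subset_closedBall 0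
  let S : Set Space3 := Icc 1 2 ×ˢ Metric.closedBall (0 : Plane) R'
  have hS : MeasurableSet S := measurableSet_Icc.prod Metric.isClosed_closedBall.measurableSet
  have hkb : ∀ n x, ‖k n x‖ ≤ S.indicator (fun _ => D * B * N) x := by
    intro n x
    have hD0 : 0 ≤ D := (abs_nonneg _).trans (hD 0)
    have hN0 : 0 ≤ N := (abs_nonneg _).trans (hN' 0)
    have hB0 := hw.bound_nonneg
    by_cases hx : x ∈ S
    · have hx0 : 0 < (axialScale (a n)⁻¹ x).1 :=
        mul_pos (inv_pos.2 (ha n)) (lt_of_lt_of_le one_pos hx.1.1)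
      have h1 := hw.abs_slipPotential_le hρ hx0
      have h2 := hN' (axialScale (a n)⁻¹ x)
      have h3 := hD x.1
      rw [indicator_of_mem hx, Real.norm_eq_abs, abs_mul, abs_mul]
      gcongr
    · rw [indicator_of_notMem hx, norm_le_zero_iff]
      simp only [k]
      by_cases h1 : x.1 ∈ Icc (1 : ℝ) 2
      · have h2 : curl φ (axialScale (a n)⁻¹ x) 0 = 0 := by
          by_contra h
          have h3 := hR' (subset_tsupport _ h)
          rw [mem_closedBall_zero_iff] at h3
          refine hx ⟨h1, ?_⟩
          rw [mem_closedBall_zero_iff]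
          exact (norm_snd_le (axialScale (a n)⁻¹ x)).trans h3
        rw [h2, mul_zero]
      · have h2 : deriv cutoff x.1 = 0 := by
          rcases not_and_or.1 h1 with h | h
          · exact deriv_cutoff_of_le (not_le.1 h).le
          · exact deriv_cutoff_of_ge (not_le.1 h).le
        rw [h2, zero_mul, zero_mul]
  have hbi : Integrable (S.indicator fun _ => D * B * N) :=
    (integrable_indicator_iff hS).2 (integrableOn_const
      (isCompact_Icc.prod (isCompact_closedBall _ _)).measure_lt_top.ne)
  have hscale : ∀ n, Continuous (axialScale (a n)⁻¹) := fun n => by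
    unfold axialScale
    fun_prop
  have hkm : ∀ n, AEStronglyMeasurable (k n) volume := fun n =>
    (((continuous_deriv_cutoff.measurable.comp measurable_fst).mul
      (hVm.comp (hscale n).measurable)).mul (hψ.comp (hscale n)).measurable).aestronglyMeasurable
  have hki : ∀ n, Integrable (k n) := fun n => hbi.mono' (hkm n) (Eventually.of_forall (hkb n))
  have hzero : ∀ n, ∫ x, g n x = -∫ x, k n x := by
    intro n
    obtain ⟨hV, hd⟩ := hw.contDiff_cutoff_mul hρ (ha n)
    have h1 := integral_grad_mul_curl hV hφ hc
    have h2 : ∀ x, k n (axialScale (a n) x) = deriv cutoff (a n * x.1) * slipPotential w ρ x *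
        curl φ x 0 := by
      intro x
      have h3 : axialScale (a n)⁻¹ (axialScale (a n) x) = x := by
        simp only [axialScale, inv_mul_cancel_left₀ (ha n).ne']
      simp only [k, h3]
      rfl
    have h4 : ∀ x, ∑ j, fderiv ℝ (fun x : Space3 => cutoff (a n * x.1) * slipPotential w ρ x) x
        (coordVec j) * curl φ x j = g n x + a n * k n (axialScale (a n) x) := by
      intro x
      rw [h2]
      simp only [hd, g, slipField, Fin.sum_univ_three]
      split_ifs with hx
      · simp [coordVec]
        ring
      · rw [deriv_cutoff_of_le]
        · simp
        · nlinarith [mul_nonneg (ha n).le (sub_nonneg.2 (not_lt.1 hx))]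
    have h5 : Integrable fun x => k n (axialScale (a n) x) := by
      have h6 := (measurableEmbedding_axialScale (ha n).ne').integrable_map_iff
        (μ := volume) (g := k n)
      refine h6.1 ?_
      rw [map_axialScale (ha n).ne']
      exact (hki n).smul_measure ENNReal.ofReal_ne_top
    simp_rw [h4] at h1
    rw [integral_add (hg1 n) (h5.const_mul _), integral_const_mul,
      integral_comp_axialScale (ha n).ne' (k n), abs_of_pos (inv_pos.2 (ha n)),
      mul_inv_cancel_left₀ (ha n).ne'] at h1
    linarith
  have hlim1 : Tendsto (fun n => ∫ x, g n x) atTop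
      (𝓝 (∫ x, ∑ j, slipField w ρ x j * curl φ x j)) := by
    refine tendsto_integral_of_dominated_convergence _ (fun n => (hg1 n).1) hsum.norm
      (fun n => Eventually.of_forall fun x => ?_) (Eventually.of_forall fun x => ?_)
    · simp only [g]
      rw [norm_mul, Real.norm_of_nonneg (cutoff_nonneg _)]
      exact mul_le_of_le_one_left (norm_nonneg _) (cutoff_le_one _)
    · by_cases hx : 0 < x.1
      · refine tendsto_const_nhds.congr' ?_
        filter_upwards [(hatop.atTop_mul_const hx).eventually_ge_atTop 2] with n hn
        simp only [g]
        rw [cutoff_of_ge hn, one_mul]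
      · simp [g, slipField, hx]
  have hlim2 : Tendsto (fun n => ∫ x, k n x) atTop
      (𝓝 (∫ x : Space3, deriv cutoff x.1 * (w x.2 * curl φ (0, x.2) 0))) := by
    refine tendsto_integral_of_dominated_convergence _ hkm hbi
      (fun n => Eventually.of_forall (hkb n)) ?_
    have hae : ∀ᵐ x : Space3, ∀ᶠ z in 𝓝 x.2, w z = w x.2 :=
      Measure.quasiMeasurePreserving_snd.ae hw.locally_const
    filter_upwards [hae] with x hx
    by_cases hx0 : 0 < x.1
    · have h0 : Tendsto (fun n => (a n)⁻¹ * x.1) atTop (𝓝 0) := by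
        have := (tendsto_inv_atTop_zero.comp hatop).mul_const x.1
        rwa [zero_mul] at this
      have h1 : Tendsto (fun n => (a n)⁻¹ * x.1) atTop (𝓝[>] 0) :=
        tendsto_nhdsWithin_iff.2 ⟨h0, Eventually.of_forall fun n => mul_pos (inv_pos.2 (ha n)) hx0⟩
      have h2 : Tendsto (fun n => slipPotential w ρ (axialScale (a n)⁻¹ x)) atTop (𝓝 (w x.2)) := by
        refine tendsto_const_nhds.congr' ?_
        filter_upwards [h1.eventually (hρ.mollify_eventually_eq hx),
          h0.eventually_lt_const one_pos] with n hn hn'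
        simp only [slipPotential, axialScale]
        rw [hn, cutoff_of_le hn'.le]
        ring
      have h3 : Tendsto (fun n => curl φ (axialScale (a n)⁻¹ x) 0) atTop
          (𝓝 (curl φ (0, x.2) 0)) :=
        (hψ.tendsto (0, x.2)).comp (h0.prodMk_nhds tendsto_const_nhds)
      have h4 := (h2.const_mul (deriv cutoff x.1)).mul h3
      rwa [mul_assoc] at h4
    · have h1 : deriv cutoff x.1 = 0 := deriv_cutoff_of_le (by linarith)
      simp [k, h1]
  have hprod : ∫ x : Space3, deriv cutoff x.1 * (w x.2 * curl φ (0, x.2) 0) =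
      ∫ y, w y * curl φ (0, y) 0 := by
    have := integral_prod_mul (μ := (volume : Measure ℝ)) (ν := (volume : Measure Plane))
      (deriv cutoff) (fun y => w y * curl φ (0, y) 0)
    rw [integral_deriv_cutoff, one_mul] at this
    exact this
  rw [hprod] at hlim2
  refine tendsto_nhds_unique hlim1 ?_
  simp_rw [hzero]
  exact hlim2.neg

/-- By Green's formula the jump of the slip potential has the curve as its boundary. -/
theorem IsCurveFilling.integral_mul_curl_eq_lineAction (hw : IsCurveFilling C γ T B R w)
    {r ℓ : ℝ} {c : ℝ → Plane}
    (hΓ : ∀ f g : Plane → ℝ, Function.support f ⊆ disk r → Function.support g ⊆ disk r →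
        ∫ s in (0 : ℝ)..T, (f (γ s) * deriv γ s 0 + g (γ s) * deriv γ s 1) =
          ∫ s in (0 : ℝ)..ℓ, (f (c s) * deriv c s 0 + g (c s) * deriv c s 1))
    {φ : Space3 → Fin 3 → ℝ} (hφ : ContDiff ℝ ∞ φ) (hc : HasCompactSupport φ)
    (hU : tsupport φ ⊆ cyl univ r) :
    ∫ y, w y * curl φ (0, y) 0 = lineAction ℓ c φ := by
  let f : Fin 3 → Plane → ℝ := fun i y => φ (0, y) i
  have hφi : ∀ i, ContDiff ℝ ∞ fun x => φ x i := fun i => contDiff_pi.1 hφ i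
  have hf : ∀ i, ContDiff ℝ 1 (f i) := fun i =>
    ((hφi i).comp (contDiff_prodMk_right 0)).of_le (by simp)
  have hfs : ∀ i, Function.support (f i) ⊆ disk r := by
    intro i y hy
    have h1 : ((0 : ℝ), y) ∈ tsupport φ := subset_tsupport φ fun h => hy (by simp [f, h])
    exact (hU h1).2
  obtain ⟨R', hR'⟩ := hc.isCompact.isBounded.subset_closedBall 0
  have hfc : ∀ i, HasCompactSupport (f i) := by
    intro i
    refine HasCompactSupport.intro (isCompact_closedBall 0 R') fun y hy => ?_
    by_contra h
    have h1 : ((0 : ℝ), y) ∈ tsupport φ := subset_tsupport φ fun h' => h (by simp [f, h'])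
    have h2 := hR' h1
    rw [mem_closedBall_zero_iff] at h2 hy
    exact hy ((norm_snd_le ((0 : ℝ), y)).trans h2)
  have hfd : ∀ i y v, fderiv ℝ (f i) y v = fderiv ℝ φ (0, y) (0, v) i := by
    intro i y v
    have h1 : HasFDerivAt (fun y : Plane => ((0 : ℝ), y)) (ContinuousLinearMap.inr ℝ ℝ Plane) y :=
      hasFDerivAt_prodMk_right 0 y
    have h2 := (hφ.differentiable (by simp) (0, y)).hasFDerivAt
    have h3 := (hasFDerivAt_pi'.1 h2 i).comp y h1
    exact DFunLike.congr_fun h3.fderiv v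
  have hfint : ∀ i v, Integrable fun y => fderiv ℝ (f i) y v * w y := by
    intro i v
    have h1 : Integrable fun y => fderiv ℝ (f i) y v :=
      (continuous_partial (hf i) v).integrable_of_hasCompactSupport ((hfc i).fderiv_apply ℝ v)
    exact h1.mul_bdd (c := B) hw.measurable.aestronglyMeasurable (Eventually.of_forall hw.abs_le)
  have hint : ∀ i (k : Fin 2), IntervalIntegrable (fun s => f i (γ s) * deriv γ s k) volume 0 T := by
    intro i k
    have h1 : IntervalIntegrable (fun s => deriv γ s k) volume 0 T := by
      rw [intervalIntegrable_iff_integrableOn_Icc_of_le hw.length_nonneg]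
      refine Measure.integrableOn_of_bounded (M := C) (by simp) ?_ ?_
      · exact ((EuclideanSpace.proj k : Plane →L[ℝ] ℝ).measurable.comp
          (measurable_deriv γ)).aestronglyMeasurable
      · exact Eventually.of_forall fun s =>
          (PiLp.norm_apply_le (deriv γ s) k).trans (norm_deriv_le_of_lipschitz hw.lipschitz)
    exact h1.continuousOn_mul ((hf i).continuous.comp hw.lipschitz.continuous).continuousOn
  have h1 := hΓ (f 1) (f 2) (hfs 1) (hfs 2)
  rw [intervalIntegral.integral_add (hint 1 0) (hint 2 1), hw.green_zero _ (hf 1) (hfc 1),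
    hw.green_one _ (hf 2) (hfc 2), neg_add_eq_sub, ← integral_sub (hfint _ _) (hfint _ _)] at h1
  rw [lineAction, ← h1]
  refine integral_congr_ae (Eventually.of_forall fun y => ?_)
  simp only [hfd, curl, partialD, coordVec]
  simp
  ring

end Slip

/-- A field with the given dislocation curve: there is a `p`-integrable vector field, vanishing
outside `0 < x₁ < 2`, whose curl is carried by the curve. -/
theorem IsDislocationCurve.exists_slip {r ℓ p : ℝ} {c : ℝ → Plane} (hr : 0 < r)
    (hΓ : IsDislocationCurve r ℓ c) (hp₁ : 1 < p) (hp₂ : p < 2) :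
    ∃ E : Space3 → Fin 3 → ℝ,
      (∀ j, MemLp (fun x => E x j) (ENNReal.ofReal p) (volume.restrict (cyl univ r))) ∧
      (∀ x, x.1 ∉ Ioo (0 : ℝ) 2 → E x = 0) ∧
      ∀ b : EuclideanSpace ℝ (Fin 3),
        HasDislocationCurl (cyl univ r) ℓ c b fun x => Matrix.of fun i j => b i * E x j := by
  obtain ⟨C, γ, T, B, R, w, hw, hfill⟩ := hΓ.exists_filling hr
  obtain ⟨ρ, hρ⟩ := exists_isUnitMollifier
  have hE := hw.memLp_slipField hρ hp₁ hp₂ r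
  refine ⟨slipField w ρ, hE, fun x hx => funext fun j => hw.slipField_eq_zero hρ hx j, ?_⟩
  intro b φ hφ hc hU i
  have hloc : LocIntegrableField (cyl univ r) fun x => Matrix.of fun _ j => slipField w ρ x j := by
    refine locIntegrableField_of_memLp hp₁.le fun K _ hKU => memLp_iff_entries.2 fun i j => ?_
    exact (hE j).mono_measure (Measure.restrict_mono hKU le_rfl)
  have h1 := hw.integral_slipField_mul_curl hρ hφ hc fun j => hloc.integrable_mul_curl hφ hc hU 0 j
  rw [hw.integral_mul_curl_eq_lineAction hfill hφ hc hU] at h1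
  rw [setIntegral_mul_curl_eq hU]
  simp only [Matrix.of_apply, mul_assoc, ← Finset.mul_sum]
  rw [integral_const_mul, h1]
  ring

/-! ### Euler angles -/

theorem mem_SO3_iff {R : Mat3} : R ∈ SO3 ↔ R * R.transpose = 1 ∧ R.det = 1 := by
  rw [← Matrix.mem_orthogonalGroup_iff]
  exact Matrix.mem_specialOrthogonalGroup_iff

theorem one_mem_SO3 : (1 : Mat3) ∈ SO3 := one_mem (Matrix.specialOrthogonalGroup (Fin 3) ℝ)

theorem mul_mem_SO3 {R S : Mat3} (hR : R ∈ SO3) (hS : S ∈ SO3) : R * S ∈ SO3 :=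
  mul_mem (S := Submonoid Mat3) (s := Matrix.specialOrthogonalGroup (Fin 3) ℝ) hR hS

theorem transpose_mem_SO3 {R : Mat3} (hR : R ∈ SO3) : R.transpose ∈ SO3 := by
  rw [mem_SO3_iff] at hR ⊢
  rw [Matrix.transpose_transpose, Matrix.det_transpose]
  exact ⟨mul_eq_one_comm.1 hR.1, hR.2⟩

theorem sum_sq_row_of_mem_SO3 {R : Mat3} (hR : R ∈ SO3) (i : Fin 3) :
    R i 0 ^ 2 + R i 1 ^ 2 + R i 2 ^ 2 = 1 := by
  have h := congrFun (congrFun (mem_SO3_iff.1 hR).1 i) i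
  rw [Matrix.mul_apply, Fin.sum_univ_three, Matrix.one_apply_eq] at h
  simp only [Matrix.transpose_apply] at h
  linarith

theorem abs_entry_le_of_mem_SO3 {R : Mat3} (hR : R ∈ SO3) (i j : Fin 3) : |R i j| ≤ 1 := by
  have h := sum_sq_row_of_mem_SO3 hR i
  have h0 := sq_nonneg (R i 0)
  have h1 := sq_nonneg (R i 1)
  have h2 := sq_nonneg (R i 2)
  have h3 : ∀ j, R i j ^ 2 ≤ 1 := by
    intro j
    fin_cases j
    · change R i 0 ^ 2 ≤ 1
      linarith
    · change R i 1 ^ 2 ≤ 1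
      linarith
    · change R i 2 ^ 2 ≤ 1
      linarith
  exact (sq_le_one_iff_abs_le_one _).1 (h3 j)

/-- The rotation by the angle `t` about the third axis. -/
noncomputable def rotZ (t : ℝ) : Mat3 :=
  !![Real.cos t, -Real.sin t, 0; Real.sin t, Real.cos t, 0; 0, 0, 1]

/-- The rotation by the angle `t` about the first axis. -/
noncomputable def rotX (t : ℝ) : Mat3 :=
  !![1, 0, 0; 0, Real.cos t, -Real.sin t; 0, Real.sin t, Real.cos t]

/-- The rotation with given Euler angles. -/
noncomputable def eulerRotation (v : Fin 3 → ℝ) : Mat3 := rotZ (v 0) * rotX (v 1) * rotZ (v 2)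

theorem rotZ_mem_SO3 (t : ℝ) : rotZ t ∈ SO3 := by
  rw [mem_SO3_iff]
  have h := Real.cos_sq_add_sin_sq t
  constructor
  · ext i j
    fin_cases i <;> fin_cases j <;>
      simp [rotZ, Matrix.mul_apply, Fin.sum_univ_three] <;> linarith
  · simp [rotZ, Matrix.det_fin_three]
    linarith

theorem rotX_mem_SO3 (t : ℝ) : rotX t ∈ SO3 := by
  rw [mem_SO3_iff]
  have h := Real.cos_sq_add_sin_sq t
  constructor
  · ext i j
    fin_cases i <;> fin_cases j <;>
      simp [rotX, Matrix.mul_apply, Fin.sum_univ_three] <;> linarith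
  · simp [rotX, Matrix.det_fin_three]
    linarith

theorem eulerRotation_mem_SO3 (v : Fin 3 → ℝ) : eulerRotation v ∈ SO3 :=
  mul_mem_SO3 (mul_mem_SO3 (rotZ_mem_SO3 _) (rotX_mem_SO3 _)) (rotZ_mem_SO3 _)

theorem eulerRotation_zero : eulerRotation 0 = 1 := by
  have h1 : rotZ 0 = 1 := by
    ext i j
    fin_cases i <;> fin_cases j <;> simp [rotZ]
  have h2 : rotX 0 = 1 := by
    ext i j
    fin_cases i <;> fin_cases j <;> simp [rotX]
  simp [eulerRotation, h1, h2]

theorem contDiff_eulerRotation (i j : Fin 3) : ContDiff ℝ ∞ fun v => eulerRotation v i j := by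
  have hc : ∀ k : Fin 3, ContDiff ℝ ∞ fun v : Fin 3 → ℝ => v k := fun k => contDiff_apply ℝ ℝ k
  simp only [eulerRotation, Matrix.mul_apply, Fin.sum_univ_three]
  have hz : ∀ (k i j : Fin 3), ContDiff ℝ ∞ fun v : Fin 3 → ℝ => rotZ (v k) i j := by
    intro k i j
    fin_cases i <;> fin_cases j <;> simp [rotZ] <;>
      first
        | exact contDiff_const
        | exact (hc k).cos
        | exact (hc k).sin
        | exact (hc k).sin.neg
  have hx : ∀ (k i j : Fin 3), ContDiff ℝ ∞ fun v : Fin 3 → ℝ => rotX (v k) i j := by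
    intro k i j
    fin_cases i <;> fin_cases j <;> simp [rotX] <;>
      first
        | exact contDiff_const
        | exact (hc k).cos
        | exact (hc k).sin
        | exact (hc k).sin.neg
  fun_prop

theorem exists_cos_sin_eq {a b : ℝ} (h : a ^ 2 + b ^ 2 = 1) :
    ∃ t, Real.cos t = a ∧ Real.sin t = b := by
  have h1 : ‖(⟨a, b⟩ : ℂ)‖ = 1 := by
    rw [Complex.norm_def, Complex.normSq_mk, ← Real.sqrt_one]
    congr 1
    linarith
  have h0 : (⟨a, b⟩ : ℂ) ≠ 0 := by
    intro h
    simp [h] at h1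
  refine ⟨Complex.arg ⟨a, b⟩, ?_, ?_⟩
  · rw [Complex.cos_arg h0, h1, div_one]
  · rw [Complex.sin_arg, h1, div_one]

theorem exists_rotZ_eq {S : Mat3} (hSm : S ∈ SO3) (hScol : ∀ i, S i 2 = (1 : Mat3) i 2) :
    ∃ t, rotZ t = S := by
  have h02 : S 0 2 = 0 := by simpa using hScol 0
  have h12 : S 1 2 = 0 := by simpa using hScol 1
  have h22 : S 2 2 = 1 := by simpa using hScol 2
  have hrow := sum_sq_row_of_mem_SO3 hSm
  have hrow2 := hrow 2
  rw [h22] at hrow2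
  have h20 : S 2 0 = 0 := by nlinarith [sq_nonneg (S 2 0), sq_nonneg (S 2 1)]
  have h21 : S 2 1 = 0 := by nlinarith [sq_nonneg (S 2 0), sq_nonneg (S 2 1)]
  have hdet := (mem_SO3_iff.1 hSm).2
  rw [Matrix.det_fin_three, h02, h12, h22, h20, h21] at hdet
  have hrow0 := hrow 0
  have hrow1 := hrow 1
  rw [h02] at hrow0
  rw [h12] at hrow1
  have hsq : (S 0 0 - S 1 1) ^ 2 + (S 0 1 + S 1 0) ^ 2 = 0 := by nlinarith
  have h11 : S 1 1 = S 0 0 := by nlinarith [sq_nonneg (S 0 0 - S 1 1), sq_nonneg (S 0 1 + S 1 0)]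
  have h01 : S 0 1 = -S 1 0 := by nlinarith [sq_nonneg (S 0 0 - S 1 1), sq_nonneg (S 0 1 + S 1 0)]
  obtain ⟨θ, hc, hsn⟩ := exists_cos_sin_eq (a := S 0 0) (b := S 1 0) (by rw [h01] at hrow0; linarith)
  refine ⟨θ, ?_⟩
  ext i j
  fin_cases i <;> fin_cases j
  · exact hc
  · exact (congrArg Neg.neg hsn).trans h01.symm
  · exact h02.symm
  · exact hsn
  · exact hc.trans h11.symm
  · exact h12.symm
  · exact h20.symm
  · exact h21.symm
  · exact h22.symm

/-- Every rotation has Euler angles. -/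
theorem exists_eulerRotation_eq {R : Mat3} (hR : R ∈ SO3) : ∃ v, eulerRotation v = R := by
  have hcol := sum_sq_row_of_mem_SO3 (transpose_mem_SO3 hR) 2
  simp only [Matrix.transpose_apply] at hcol
  set s := Real.sqrt (R 0 2 ^ 2 + R 1 2 ^ 2) with hs
  have hs2 : s ^ 2 = R 0 2 ^ 2 + R 1 2 ^ 2 := Real.sq_sqrt (by positivity)
  obtain ⟨β, hβc, hβs⟩ := exists_cos_sin_eq (a := R 2 2) (b := s) (by linarith)
  obtain ⟨α, hα1, hα2⟩ : ∃ α, Real.sin α * s = R 0 2 ∧ -(Real.cos α * s) = R 1 2 := by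
    rcases eq_or_ne s 0 with h0 | h0
    · refine ⟨0, ?_, ?_⟩ <;> rw [h0] at hs2 ⊢ <;> simp <;>
        nlinarith [sq_nonneg (R 0 2), sq_nonneg (R 1 2)]
    · obtain ⟨α, h1, h2⟩ := exists_cos_sin_eq (a := -R 1 2 / s) (b := R 0 2 / s) (by
        field_simp
        linarith)
      refine ⟨α, ?_, ?_⟩
      · rw [h2, div_mul_cancel₀ _ h0]
      · rw [h1, div_mul_cancel₀ _ h0, neg_neg]
  set P := rotZ α * rotX β with hP
  have hPm : P ∈ SO3 := mul_mem_SO3 (rotZ_mem_SO3 α) (rotX_mem_SO3 β)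
  have hPcol : ∀ i, P i 2 = R i 2 := by
    intro i
    rw [hP, Matrix.mul_apply, Fin.sum_univ_three]
    fin_cases i <;> simp [rotZ, rotX, hβc, hβs]
    · exact hα1
    · exact hα2
  set S := P.transpose * R with hSdef
  have hSm : S ∈ SO3 := mul_mem_SO3 (transpose_mem_SO3 hPm) hR
  have hPS : P * S = R := by
    rw [hSdef, ← mul_assoc, (mem_SO3_iff.1 hPm).1, one_mul]
  have hScol : ∀ i, S i 2 = (1 : Mat3) i 2 := by
    intro i
    have h1 := (mem_SO3_iff.1 (transpose_mem_SO3 hPm)).1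
    rw [Matrix.transpose_transpose] at h1
    rw [← h1, hSdef, Matrix.mul_apply, Matrix.mul_apply]
    simp only [hPcol]
  obtain ⟨θ, hθ⟩ := exists_rotZ_eq hSm hScol
  refine ⟨![α, β, θ], ?_⟩
  rw [← hPS, ← hθ]
  rfl

theorem range_eulerRotation : range eulerRotation = SO3 :=
  Subset.antisymm (range_subset_iff.2 eulerRotation_mem_SO3) fun _ hR => exists_eulerRotation_eq hR

/-! ### Relaxation by oscillating rotations -/

section Relaxation

variable {V E : Type*} [NormedAddCommGroup V] [NormedSpace ℝ V] [NormedAddCommGroup E]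
  [NormedSpace ℝ E] {q : V → E} {a b m D : ℝ}

/-- Smooth curves of parameters with compact support in the interval `(a, b)`. -/
structure IsTestCurve (a b : ℝ) (Θ : ℝ → V) : Prop where
  contDiff : ContDiff ℝ ∞ Θ
  hasCompactSupport : HasCompactSupport Θ
  tsupport_subset : tsupport Θ ⊆ Ioo a b

theorem isTestCurve_zero : IsTestCurve a b (0 : ℝ → V) := by
  have h : tsupport (0 : ℝ → V) = ∅ := tsupport_eq_empty_iff.2 rfl
  exact ⟨contDiff_const, HasCompactSupport.zero, by rw [h]; exact empty_subset _⟩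

theorem IsTestCurve.eq_zero {Θ : ℝ → V} (hΘ : IsTestCurve a b Θ) {t : ℝ} (ht : t ∉ Ioo a b) :
    Θ t = 0 :=
  image_eq_zero_of_notMem_tsupport fun h => ht (hΘ.tsupport_subset h)

theorem IsTestCurve.glue {Θ₀ Θ₁ : ℝ → V} (h₀ : IsTestCurve a m Θ₀) (h₁ : IsTestCurve m b Θ₁)
    (ham : a ≤ m) (hmb : m ≤ b) : IsTestCurve a b (Θ₀ + Θ₁) ∧
      (∀ t ≤ m, (Θ₀ + Θ₁) t = Θ₀ t) ∧ (∀ t, m ≤ t → (Θ₀ + Θ₁) t = Θ₁ t) := by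
  refine ⟨⟨h₀.contDiff.add h₁.contDiff, h₀.hasCompactSupport.add h₁.hasCompactSupport,
    (tsupport_add _ _).trans (union_subset (h₀.tsupport_subset.trans (Ioo_subset_Ioo_right hmb))
      (h₁.tsupport_subset.trans (Ioo_subset_Ioo_left ham)))⟩, fun t ht => ?_, fun t ht => ?_⟩
  · rw [Pi.add_apply, h₁.eq_zero fun h => not_lt.2 ht h.1, add_zero]
  · rw [Pi.add_apply, h₀.eq_zero fun h => not_lt.2 ht h.2, zero_add]

theorem IsTestCurve.intervalIntegrable {E : Type*} [NormedAddCommGroup E] {q : V → E}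
    {Θ : ℝ → V} (hΘ : IsTestCurve a b Θ) (hq : Continuous q)
    (s t : ℝ) : IntervalIntegrable (fun u => q (Θ u)) volume s t :=
  (hq.comp hΘ.contDiff.continuous).intervalIntegrable s t

/-- The values that can be approximated, on every interval, by averages of `q` along test curves. -/
def attainableAverages (q : V → E) : Set E :=
  {z | ∀ a b : ℝ, a < b → ∀ ε > 0, ∃ Θ : ℝ → V, IsTestCurve a b Θ ∧
    ‖(∫ t in a..b, q (Θ t)) - (b - a) • z‖ ≤ ε}

theorem isClosed_attainableAverages : IsClosed (attainableAverages q) := by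
  refine isClosed_of_closure_subset fun z hz a b hab ε hε => ?_
  have hba : 0 < b - a := sub_pos.2 hab
  obtain ⟨z', hz', hd⟩ := Metric.mem_closure_iff.1 hz (ε / 2 / (b - a)) (by positivity)
  obtain ⟨Θ, hΘ, h⟩ := hz' a b hab (ε / 2) (by positivity)
  refine ⟨Θ, hΘ, ?_⟩
  have h1 : ‖(b - a) • (z' - z)‖ ≤ ε / 2 := by
    rw [norm_smul, Real.norm_of_nonneg hba.le, ← dist_eq_norm, dist_comm, mul_comm]
    exact ((lt_div_iff₀ hba).1 hd).le
  have h2 : (∫ t in a..b, q (Θ t)) - (b - a) • z =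
      ((∫ t in a..b, q (Θ t)) - (b - a) • z') + (b - a) • (z' - z) := by
    rw [smul_sub]
    abel
  rw [h2]
  exact (norm_add_le _ _).trans (by linarith)

theorem convex_attainableAverages (hq : Continuous q) : Convex ℝ (attainableAverages q) := by
  refine convex_iff_forall_pos.2 fun z₀ hz₀ z₁ hz₁ α β hα hβ hαβ a b hab ε hε => ?_
  have hba : 0 < b - a := sub_pos.2 hab
  obtain ⟨m, hm⟩ : ∃ m, m = a + α * (b - a) := ⟨_, rfl⟩
  have hma : m - a = α * (b - a) := by rw [hm]; ring
  have hbm : b - m = β * (b - a) := by rw [hm, ← eq_sub_of_add_eq' hαβ |>.symm]; ring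
  have ham : a < m := by nlinarith
  have hmb : m < b := by nlinarith
  obtain ⟨Θ₀, h₀, hd₀⟩ := hz₀ a m ham (ε / 2) (by positivity)
  obtain ⟨Θ₁, h₁, hd₁⟩ := hz₁ m b hmb (ε / 2) (by positivity)
  obtain ⟨hΘ, hl, hr⟩ := h₀.glue h₁ ham.le hmb.le
  refine ⟨_, hΘ, ?_⟩
  rw [← intervalIntegral.integral_add_adjacent_intervals (hΘ.intervalIntegrable hq a m)
    (hΘ.intervalIntegrable hq m b)]
  have e0 : ∫ t in a..m, q ((Θ₀ + Θ₁) t) = ∫ t in a..m, q (Θ₀ t) := by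
    refine intervalIntegral.integral_congr fun t ht => ?_
    rw [uIcc_of_le ham.le] at ht
    simp only [hl t ht.2]
  have e1 : ∫ t in m..b, q ((Θ₀ + Θ₁) t) = ∫ t in m..b, q (Θ₁ t) := by
    refine intervalIntegral.integral_congr fun t ht => ?_
    rw [uIcc_of_le hmb.le] at ht
    simp only [hr t ht.1]
  have h2 : (b - a) • (α • z₀ + β • z₁) = (m - a) • z₀ + (b - m) • z₁ := by
    rw [smul_add, smul_smul, smul_smul, hma, hbm, mul_comm α, mul_comm β]
  rw [e0, e1, h2, add_sub_add_comm]
  exact (norm_add_le _ _).trans (by linarith)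

theorem range_subset_attainableAverages [CompleteSpace E] (hq : Continuous q) (hD : ∀ v, ‖q v‖ ≤ D) :
    range q ⊆ attainableAverages q := by
  rintro _ ⟨v, rfl⟩ a b hab ε hε
  have hD0 : 0 ≤ D := (norm_nonneg _).trans (hD v)
  -- A bump with values `v` except on two short intervals at the end points.
  obtain ⟨η, hη, hηb, hηD⟩ : ∃ η > 0, η < (b - a) / 2 ∧ 2 * η * (2 * D) ≤ ε := by
    refine ⟨min ((b - a) / 4) (ε / (4 * (D + 1))), ?_, ?_, ?_⟩
    · have := sub_pos.2 hab
      positivity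
    · exact (min_le_left _ _).trans_lt (by linarith)
    · have h1 : min ((b - a) / 4) (ε / (4 * (D + 1))) ≤ ε / (4 * (D + 1)) := min_le_right _ _
      have h2 : ε / (4 * (D + 1)) * (4 * (D + 1)) = ε := div_mul_cancel₀ _ (by positivity)
      have h3 : 0 ≤ ε / (4 * (D + 1)) := by positivity
      nlinarith
  let f : ContDiffBump ((a + b) / 2) := ⟨(b - a) / 2 - η, (b - a) / 2 - η / 2, by linarith, by linarith⟩
  have hf1 : ∀ t ∈ Icc (a + η) (b - η), f t = 1 := by
    intro t ht
    refine f.one_of_mem_closedBall ?_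
    rw [Metric.mem_closedBall, Real.dist_eq, abs_le]
    change -((b - a) / 2 - η) ≤ _ ∧ _ ≤ (b - a) / 2 - η
    exact ⟨by linarith [ht.1], by linarith [ht.2]⟩
  have hΘ : IsTestCurve a b fun t => f t • v := by
    refine ⟨f.contDiff.smul contDiff_const, f.hasCompactSupport.smul_right, ?_⟩
    refine (tsupport_smul_subset_left _ _).trans ?_
    rw [f.tsupport_eq, Real.closedBall_eq_Icc]
    refine Icc_subset_Ioo ?_ ?_
    · change a < (a + b) / 2 - ((b - a) / 2 - η / 2)
      linarith
    · change (a + b) / 2 + ((b - a) / 2 - η / 2) < b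
      linarith
  refine ⟨_, hΘ, ?_⟩
  have hi : ∀ s t, IntervalIntegrable (fun t => q (f t • v) - q v) volume s t := fun s t =>
    (hΘ.intervalIntegrable hq s t).sub intervalIntegrable_const
  have hb : ∀ t, ‖q (f t • v) - q v‖ ≤ 2 * D := fun t =>
    (norm_sub_le _ _).trans (by linarith [hD (f t • v), hD v])
  have h1 : (∫ t in a..b, q (f t • v)) - (b - a) • q v = ∫ t in a..b, (q (f t • v) - q v) := by
    rw [intervalIntegral.integral_sub (hΘ.intervalIntegrable hq a b) intervalIntegrable_const,
      intervalIntegral.integral_const]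
  rw [h1, ← intervalIntegral.integral_add_adjacent_intervals (hi a (a + η)) (hi (a + η) b),
    ← intervalIntegral.integral_add_adjacent_intervals (hi (a + η) (b - η)) (hi (b - η) b)]
  have h2 : ∫ t in (a + η)..(b - η), (q (f t • v) - q v) = 0 := by
    refine (intervalIntegral.integral_congr fun t ht => ?_).trans intervalIntegral.integral_zero
    rw [uIcc_of_le (by linarith)] at ht
    simp only [hf1 t ht, one_smul, sub_self]
  have h3 := intervalIntegral.norm_integral_le_of_norm_le_const (a := a) (b := a + η)
    (f := fun t => q (f t • v) - q v) fun t _ => hb t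
  have h4 := intervalIntegral.norm_integral_le_of_norm_le_const (a := b - η) (b := b)
    (f := fun t => q (f t • v) - q v) fun t _ => hb t
  rw [add_sub_cancel_left, abs_of_pos hη] at h3
  rw [sub_sub_cancel, abs_of_pos hη] at h4
  rw [h2, zero_add]
  exact (norm_add_le _ _).trans (by linarith)

theorem convexHull_range_subset_attainableAverages [CompleteSpace E] (hq : Continuous q)
    (hD : ∀ v, ‖q v‖ ≤ D) :
    convexHull ℝ (range q) ⊆ attainableAverages q :=
  convexHull_min (range_subset_attainableAverages hq hD) (convex_attainableAverages hq)

/-- Relaxation: a measurable field with values in the convex hull of the range of `q` is, in the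
sense of its primitive, approximated by the values of `q` along a test curve. -/
theorem exists_isTestCurve_primitive_close [CompleteSpace E] (hq : Continuous q)
    (hD : ∀ v, ‖q v‖ ≤ D) (hab : a < b) {F : ℝ → E} (hFm : AEStronglyMeasurable F)
    (hF : ∀ᵐ t, F t ∈ convexHull ℝ (range q)) {ε : ℝ} (hε : 0 < ε) :
    ∃ Θ : ℝ → V, IsTestCurve a b Θ ∧ ∀ t ∈ Icc a b, ‖∫ s in a..t, (q (Θ s) - F s)‖ ≤ ε := by
  have hD0 : 0 ≤ D := (norm_nonneg _).trans (hD 0)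
  have hFb : ∀ᵐ t, ‖F t‖ ≤ D := by
    filter_upwards [hF] with t ht
    have h1 : convexHull ℝ (range q) ⊆ Metric.closedBall 0 D :=
      convexHull_min (range_subset_iff.2 fun v => mem_closedBall_zero_iff.2 (hD v))
        (convex_closedBall 0 D)
    exact mem_closedBall_zero_iff.1 (h1 ht)
  have hFi : ∀ s t, IntervalIntegrable F volume s t := fun s t =>
    (intervalIntegrable_const (c := D)).mono_fun' hFm.restrict (ae_restrict_of_ae hFb)
  have hba : 0 < b - a := sub_pos.2 hab
  obtain ⟨N, hN⟩ := exists_nat_gt (max 1 (2 * D * (b - a) / (ε / 2)))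
  have hN1 : (1 : ℝ) < N := (le_max_left _ _).trans_lt hN
  have hN0 : (0 : ℝ) < N := by linarith
  obtain ⟨δ, hδ⟩ : ∃ δ, δ = (b - a) / N := ⟨_, rfl⟩
  have hδ0 : 0 < δ := hδ ▸ div_pos hba hN0
  have hδN : N * δ = b - a := by rw [hδ]; field_simp
  have hδε : 2 * D * δ ≤ ε / 2 := by
    have h1 := (div_lt_iff₀ (by positivity)).1 ((le_max_right _ _).trans_lt hN)
    rw [hδ, mul_div_assoc', div_le_iff₀ hN0]
    linarith
  have key : ∀ k : ℕ, ∃ Θ : ℝ → V, IsTestCurve a (a + k * δ) Θ ∧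
      ‖∫ s in a..(a + k * δ), (q (Θ s) - F s)‖ ≤ k * (ε / (2 * N)) ∧
      ∀ t ∈ Icc a (a + k * δ), ‖∫ s in a..t, (q (Θ s) - F s)‖ ≤
        k * (ε / (2 * N)) + 2 * D * δ := by
    intro k
    induction k with
    | zero =>
      refine ⟨0, isTestCurve_zero, by simp, fun t ht => ?_⟩
      have : t = a := le_antisymm (by simpa using ht.2) ht.1
      rw [this, intervalIntegral.integral_same, norm_zero]
      positivity
    | succ k ih =>
      obtain ⟨Θ₀, h₀, hend, hall⟩ := ih
      obtain ⟨m, hm⟩ : ∃ m, m = a + k * δ := ⟨_, rfl⟩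
      have hm' : a + (k + 1 : ℕ) * δ = m + δ := by rw [hm]; push_cast; ring
      have ham : a ≤ m := by rw [hm]; linarith [mul_nonneg k.cast_nonneg hδ0.le]
      rw [← hm] at h₀ hend hall
      rw [hm']
      -- On the new interval the average of `F` is attainable.
      have hav : (⨍ t in Ioc m (m + δ), F t) ∈ attainableAverages q := by
        refine (convex_attainableAverages hq).set_average_mem isClosed_attainableAverages
          (by simp [hδ0]) (by simp) (ae_restrict_of_ae (hF.mono fun t ht =>
            convexHull_range_subset_attainableAverages hq hD ht)) ?_
        have h := hFi m (m + δ)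
        rwa [intervalIntegrable_iff_integrableOn_Ioc_of_le (by linarith)] at h
      obtain ⟨Θ₁, h₁, hd₁⟩ := hav m (m + δ) (by linarith) (ε / (2 * N)) (by positivity)
      have hsm : (m + δ - m) • (⨍ t in Ioc m (m + δ), F t) = ∫ t in m..(m + δ), F t := by
        rw [intervalIntegral.integral_of_le (by linarith), setAverage_eq, smul_smul,
          Real.volume_real_Ioc_of_le (by linarith), mul_inv_cancel₀ (by linarith), one_smul]
      rw [hsm, ← intervalIntegral.integral_sub (h₁.intervalIntegrable hq _ _) (hFi _ _)] at hd₁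
      obtain ⟨hΘ, hl, hr⟩ := h₀.glue h₁ ham (by linarith : m ≤ m + δ)
      have hi : ∀ s t, IntervalIntegrable (fun u => q ((Θ₀ + Θ₁) u) - F u) volume s t :=
        fun s t => (hΘ.intervalIntegrable hq s t).sub (hFi s t)
      have hleft : ∀ t ∈ Icc a m, ∫ s in a..t, (q ((Θ₀ + Θ₁) s) - F s) =
          ∫ s in a..t, (q (Θ₀ s) - F s) := by
        intro t ht
        refine intervalIntegral.integral_congr fun s hs => ?_
        rw [uIcc_of_le ht.1] at hs
        simp only [hl s (hs.2.trans ht.2)]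
      have hcast : ((k + 1 : ℕ) : ℝ) * (ε / (2 * N)) = k * (ε / (2 * N)) + ε / (2 * N) := by
        push_cast
        ring
      have hpos : 0 ≤ ε / (2 * N) := by positivity
      refine ⟨_, hΘ, ?_, fun t ht => ?_⟩
      · rw [← intervalIntegral.integral_add_adjacent_intervals (hi a m) (hi m (m + δ)),
          hleft m ⟨ham, le_rfl⟩, hcast]
        have h2 : ∫ s in m..(m + δ), (q ((Θ₀ + Θ₁) s) - F s) =
            ∫ s in m..(m + δ), (q (Θ₁ s) - F s) := by
          refine intervalIntegral.integral_congr fun s hs => ?_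
          rw [uIcc_of_le (by linarith)] at hs
          simp only [hr s hs.1]
        rw [h2]
        exact (norm_add_le _ _).trans (by linarith)
      · rw [hcast]
        rcases le_total t m with htm | htm
        · rw [hleft t ⟨ht.1, htm⟩]
          exact (hall t ⟨ht.1, htm⟩).trans (by linarith)
        · rw [← intervalIntegral.integral_add_adjacent_intervals (hi a m) (hi m t),
            hleft m ⟨ham, le_rfl⟩]
          have h2 : ‖∫ s in m..t, (q ((Θ₀ + Θ₁) s) - F s)‖ ≤ 2 * D * |t - m| := by
            refine intervalIntegral.norm_integral_le_of_norm_le_const_ae ?_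
            filter_upwards [hFb] with s hs _
            exact (norm_sub_le _ _).trans (by linarith [hD ((Θ₀ + Θ₁) s)])
          rw [abs_of_nonneg (by linarith)] at h2
          have h3 : 2 * D * (t - m) ≤ 2 * D * δ :=
            mul_le_mul_of_nonneg_left (by linarith [ht.2]) (by positivity)
          exact (norm_add_le _ _).trans (by linarith)
  obtain ⟨Θ, hΘ, -, hall⟩ := key N
  have hb : a + N * δ = b := by linarith
  rw [hb] at hΘ hall
  refine ⟨Θ, hΘ, fun t ht => (hall t ht).trans ?_⟩
  have h1 : (N : ℝ) * (ε / (2 * N)) = ε / 2 := by field_simp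
  linarith

end Relaxation

theorem SO3mul_one : SO3mul 1 = SO3 := by simp [SO3mul]

theorem exists_eulerRotation_primitive_close {a b : ℝ} (hab : a < b) (H : Mat3) {F : ℝ → Mat3}
    (hFm : AEStronglyMeasurable F (volume.restrict (Ioo a b)))
    (hF : ∀ᵐ t ∂(volume.restrict (Ioo a b)), F t ∈ convexHull ℝ (SO3mul H)) {ε : ℝ} (hε : 0 < ε) :
    ∃ Θ : ℝ → Fin 3 → ℝ, IsTestCurve a b Θ ∧ ∀ t ∈ Icc a b, ∀ i j,
      |∫ s in a..t, ((eulerRotation (Θ s) * H) i j - F s i j)| ≤ ε := by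
  let q : (Fin 3 → ℝ) → Fin 3 → Fin 3 → ℝ := fun v => eulerRotation v * H
  have hq : Continuous q := by
    refine continuous_pi fun i => continuous_pi fun j => ?_
    simp only [q, Matrix.mul_apply]
    exact continuous_finsetSum _ fun k _ =>
      ((contDiff_eulerRotation i k).continuous).mul continuous_const
  have hrange : range q = SO3mul H := by
    rw [SO3mul, ← range_eulerRotation, ← range_comp]
    rfl
  obtain ⟨D, hD⟩ : ∃ D, ∀ v, ‖q v‖ ≤ D := by
    refine ⟨∑ i, ∑ j, |H i j|, fun v => ?_⟩
    have h0 : ∀ k j, |H k j| ≤ ∑ i, ∑ j, |H i j| := fun k j =>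
      (Finset.single_le_sum (f := fun j => |H k j|) (fun j _ => abs_nonneg _)
        (Finset.mem_univ j)).trans (Finset.single_le_sum (f := fun i => ∑ j, |H i j|)
          (fun i _ => by positivity) (Finset.mem_univ k))
    refine (pi_norm_le_iff_of_nonneg (by positivity)).2 fun i =>
      (pi_norm_le_iff_of_nonneg (by positivity)).2 fun j => ?_
    simp only [q, Matrix.mul_apply, Real.norm_eq_abs]
    refine (Finset.abs_sum_le_sum_abs _ _).trans (Finset.sum_le_sum fun k _ => ?_)
    rw [abs_mul]
    refine (mul_le_of_le_one_left (abs_nonneg _)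
      (abs_entry_le_of_mem_SO3 (eulerRotation_mem_SO3 v) i k)).trans ?_
    exact Finset.single_le_sum (f := fun j => |H k j|) (fun j _ => abs_nonneg _) (Finset.mem_univ j)
  classical
  let F₀ : ℝ → Fin 3 → Fin 3 → ℝ := F
  let F' : ℝ → Fin 3 → Fin 3 → ℝ := (Ioo a b).piecewise F₀ fun _ => q 0
  have hin : ∀ t ∈ Ioo a b, F' t = F t := fun t ht => piecewise_eq_of_mem (Ioo a b) F₀ _ ht
  have hout : ∀ t ∉ Ioo a b, F' t = q 0 := fun t ht => piecewise_eq_of_notMem (Ioo a b) F₀ _ ht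
  have hFm' : AEStronglyMeasurable F' := by
    refine AEStronglyMeasurable.piecewise measurableSet_Ioo ?_ aestronglyMeasurable_const
    exact hFm
  have hF' : ∀ᵐ t, F' t ∈ convexHull ℝ (range q) := by
    rw [hrange]
    filter_upwards [(ae_restrict_iff' measurableSet_Ioo).1 hF] with t ht
    by_cases hx : t ∈ Ioo a b
    · rw [hin t hx]
      exact ht hx
    · rw [hout t hx, ← hrange]
      exact subset_convexHull ℝ _ (mem_range_self _)
  obtain ⟨Θ, hΘ, h⟩ := exists_isTestCurve_primitive_close hq hD hab hFm' hF' hε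
  refine ⟨Θ, hΘ, fun t ht i j => ?_⟩
  have hFb : ∀ᵐ t, ‖F' t‖ ≤ D := by
    filter_upwards [hF'] with t ht
    have h1 : convexHull ℝ (range q) ⊆ Metric.closedBall 0 D :=
      convexHull_min (range_subset_iff.2 fun v => mem_closedBall_zero_iff.2 (hD v))
        (convex_closedBall 0 D)
    exact mem_closedBall_zero_iff.1 (h1 ht)
  have hi : IntervalIntegrable (fun s => q (Θ s) - F' s) volume a t :=
    (hΘ.intervalIntegrable hq a t).sub
      ((intervalIntegrable_const (c := D)).mono_fun' hFm'.restrict (ae_restrict_of_ae hFb))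
  let π : (Fin 3 → Fin 3 → ℝ) →L[ℝ] ℝ :=
    (ContinuousLinearMap.proj (φ := fun _ : Fin 3 => ℝ) j).comp
      (ContinuousLinearMap.proj (φ := fun _ : Fin 3 => Fin 3 → ℝ) i)
  have h1 : ∫ s in a..t, ((eulerRotation (Θ s) * H) i j - F s i j) =
      π (∫ s in a..t, (q (Θ s) - F' s)) := by
    rw [← ContinuousLinearMap.intervalIntegral_comp_comm π hi]
    rw [intervalIntegral.integral_of_le ht.1, intervalIntegral.integral_of_le ht.1,
      integral_Ioc_eq_integral_Ioo, integral_Ioc_eq_integral_Ioo]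
    refine setIntegral_congr_fun measurableSet_Ioo fun s hs => ?_
    have hs' : s ∈ Ioo a b := ⟨hs.1, hs.2.trans_le ht.2⟩
    change _ = q (Θ s) i j - F' s i j
    rw [hin s hs']
  rw [h1]
  set I := ∫ s in a..t, (q (Θ s) - F' s) with hI
  have h2 : ‖I i j‖ ≤ ‖I i‖ := norm_le_pi_norm (I i) j
  exact (h2.trans (norm_le_pi_norm I i)).trans (h t ht)

/-- The undeformed states of the two materials: the identity for `x₁ < 0` and `H` for `x₁ ≥ 0`. -/
noncomputable def restState (H : Mat3) (t : ℝ) : Mat3 := if t < 0 then 1 else H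

theorem measurable_restState (H : Mat3) (i j : Fin 3) : Measurable fun t => restState H t i j := by
  have h : (fun t => restState H t i j) = fun t : ℝ => if t < 0 then (1 : Mat3) i j else H i j := by
    funext t
    simp only [restState]
    split_ifs <;> rfl
  rw [h]
  exact Measurable.ite measurableSet_Iio measurable_const measurable_const

theorem abs_restState_le (H : Mat3) (i j : Fin 3) (t : ℝ) :
    |restState H t i j| ≤ |(1 : Mat3) i j| + |H i j| := by
  rw [restState]
  split_ifs <;> simp

/-- Fields in the energy wells that oscillate along the axis with given mean values. They are
described by their deviation `B` from the constant fields `1` and `H`, which vanishes near the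
interface. -/
theorem exists_oscillation {L : ℝ} (hL : 0 < L) (H : Mat3) {F : ℝ → Mat3}
    (hFi : ∀ i j, IntegrableOn (fun t => F t i j) (Ioo (-L) L))
    (hFneg : ∀ᵐ t ∂(volume.restrict (Ioo (-L) 0)), F t ∈ convexHull ℝ SO3)
    (hFpos : ∀ᵐ t ∂(volume.restrict (Ioo 0 L)), F t ∈ convexHull ℝ (SO3mul H))
    {ε : ℝ} (hε : 0 < ε) :
    ∃ B : ℝ → Mat3, (∀ i j, ContDiff ℝ ∞ fun t => B t i j) ∧
      (∃ δ > 0, ∀ t, |t| < δ → B t = 0) ∧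
      (∀ t < 0, 1 + B t ∈ SO3) ∧ (∀ t, 0 ≤ t → H + B t ∈ SO3mul H) ∧
      ∀ t ∈ Icc (-L) L, ∀ i j,
        |∫ s in (-L)..t, ((restState H s + B s) i j - F s i j)| ≤ ε := by
  have hFm : AEStronglyMeasurable F (volume.restrict (Ioo (-L) L)) :=
    aestronglyMeasurable_iff_entries.2 fun i j => (hFi i j).1
  rw [← SO3mul_one] at hFneg
  obtain ⟨Θ, hΘ, hc⟩ := exists_eulerRotation_primitive_close (neg_lt_zero.2 hL) 1
    (hFm.mono_measure (Measure.restrict_mono (Ioo_subset_Ioo_right hL.le) le_rfl)) hFneg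
    (half_pos hε)
  obtain ⟨Θ', hΘ', hc'⟩ := exists_eulerRotation_primitive_close hL H
    (hFm.mono_measure (Measure.restrict_mono (Ioo_subset_Ioo_left (by linarith)) le_rfl)) hFpos
    (half_pos hε)
  have hz : ∀ t, 0 ≤ t → eulerRotation (Θ t) = 1 := fun t ht => by
    rw [hΘ.eq_zero fun h => not_lt.2 ht h.2, eulerRotation_zero]
  have hz' : ∀ t ≤ 0, eulerRotation (Θ' t) = 1 := fun t ht => by
    rw [hΘ'.eq_zero fun h => not_lt.2 ht h.1, eulerRotation_zero]
  let B : ℝ → Mat3 := fun t => (eulerRotation (Θ t) - 1) + (eulerRotation (Θ' t) - 1) * H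
  have hBneg : ∀ t ≤ 0, 1 + B t = eulerRotation (Θ t) * 1 := by
    intro t ht
    simp [B, hz' t ht]
  have hBpos : ∀ t, 0 ≤ t → H + B t = eulerRotation (Θ' t) * H := by
    intro t ht
    simp [B, hz t ht, sub_mul]
  have hcd : ∀ {a b : ℝ} {Θ : ℝ → Fin 3 → ℝ}, IsTestCurve a b Θ → ∀ i j,
      ContDiff ℝ ∞ fun t => (eulerRotation (Θ t) - 1) i j := fun h i j =>
    ((contDiff_eulerRotation i j).comp h.contDiff).sub contDiff_const
  have hBc : ∀ i j, ContDiff ℝ ∞ fun t => B t i j := by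
    intro i j
    have h : (fun t => B t i j) = fun t => (eulerRotation (Θ t) - 1) i j +
        ∑ k, (eulerRotation (Θ' t) - 1) i k * H k j := by
      funext t
      simp only [B, Matrix.add_apply, Matrix.mul_apply]
    rw [h]
    exact (hcd hΘ i j).add (ContDiff.sum fun k _ => (hcd hΘ' i k).mul contDiff_const)
  refine ⟨B, hBc, ?_, fun t ht => ?_, fun t ht => ?_, ?_⟩
  · have h0 : ∀ᶠ t in 𝓝 (0 : ℝ), Θ t = 0 ∧ Θ' t = 0 := by
      have h1 : (tsupport Θ)ᶜ ∈ 𝓝 (0 : ℝ) := (isClosed_tsupport Θ).isOpen_compl.mem_nhds fun h =>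
        lt_irrefl _ (hΘ.tsupport_subset h).2
      have h2 : (tsupport Θ')ᶜ ∈ 𝓝 (0 : ℝ) := (isClosed_tsupport Θ').isOpen_compl.mem_nhds fun h =>
        lt_irrefl _ (hΘ'.tsupport_subset h).1
      filter_upwards [h1, h2] with t ht ht'
      exact ⟨image_eq_zero_of_notMem_tsupport ht, image_eq_zero_of_notMem_tsupport ht'⟩
    obtain ⟨δ, hδ, h⟩ := Metric.eventually_nhds_iff.1 h0
    refine ⟨δ, hδ, fun t ht => ?_⟩
    obtain ⟨h1, h2⟩ := h (y := t) (by rwa [Real.dist_0_eq_abs])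
    simp [B, h1, h2, eulerRotation_zero]
  · rw [hBneg t ht.le, mul_one]
    exact eulerRotation_mem_SO3 _
  · rw [hBpos t ht]
    exact mem_image_of_mem _ (eulerRotation_mem_SO3 _)
  · intro t ht i j
    let A : ℝ → ℝ := fun s => (restState H s + B s) i j - F s i j
    have hleft : ∀ t ≤ 0, -L ≤ t → ∫ s in (-L)..t, A s =
        ∫ s in (-L)..t, ((eulerRotation (Θ s) * 1) i j - F s i j) := by
      intro t ht hLt
      rw [intervalIntegral.integral_of_le hLt, intervalIntegral.integral_of_le hLt,
        integral_Ioc_eq_integral_Ioo, integral_Ioc_eq_integral_Ioo]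
      refine setIntegral_congr_fun measurableSet_Ioo fun s hs => ?_
      have hs0 : s < 0 := hs.2.trans_le ht
      simp only [A, restState, if_pos hs0, hBneg s hs0.le]
    rcases le_total t 0 with h0 | h0
    · rw [hleft t h0 ht.1]
      exact (hc t ⟨ht.1, h0⟩ i j).trans (by linarith)
    · have hAi : IntervalIntegrable A volume (-L) L := by
        refine IntervalIntegrable.sub ?_ ?_
        · simp only [Matrix.add_apply]
          refine IntervalIntegrable.add ?_ ((hBc i j).continuous.intervalIntegrable _ _)
          exact (intervalIntegrable_const (c := |(1 : Mat3) i j| + |H i j|)).mono_fun'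
            (measurable_restState H i j).aestronglyMeasurable
            (Eventually.of_forall (abs_restState_le H i j))
        · rw [intervalIntegrable_iff_integrableOn_Ioo_of_le (by linarith)]
          exact hFi i j
      have hsub : ∀ s ∈ Icc (-L) L, ∀ u ∈ Icc (-L) L, IntervalIntegrable A volume s u := by
        intro s hs u hu
        refine hAi.mono_set ?_
        rw [uIcc_of_le (by linarith : -L ≤ L)]
        exact uIcc_subset_Icc hs hu
      have h0m : (0 : ℝ) ∈ Icc (-L) L := ⟨by linarith, hL.le⟩
      have hright : ∫ s in (0 : ℝ)..t, A s =
          ∫ s in (0 : ℝ)..t, ((eulerRotation (Θ' s) * H) i j - F s i j) := by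
        refine intervalIntegral.integral_congr fun s hs => ?_
        rw [uIcc_of_le h0] at hs
        simp only [A, restState, if_neg (not_lt.2 hs.1), hBpos s hs.1]
      have h1 := intervalIntegral.integral_add_adjacent_intervals
        (hsub (-L) ⟨le_rfl, by linarith⟩ 0 h0m) (hsub 0 h0m t ht)
      change |∫ s in (-L)..t, A s| ≤ ε
      rw [← h1, hleft 0 le_rfl (by linarith), hright]
      have h2 := hc 0 ⟨by linarith, le_rfl⟩ i j
      have h3 := hc' t ⟨h0, ht.2⟩ i j
      exact (abs_add_le _ _).trans (by linarith)

/-! ### Transition fields -/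

theorem isFiniteMeasure_cyl (a b r : ℝ) : IsFiniteMeasure (volume.restrict (cyl (Ioo a b) r)) := by
  refine ⟨?_⟩
  rw [Measure.restrict_apply_univ]
  exact (measure_mono (Set.prod_mono Ioo_subset_Icc_self Metric.ball_subset_closedBall)).trans_lt
    (isCompact_Icc.prod (isCompact_closedBall (0 : Plane) r)).measure_lt_top

theorem measurableSet_cyl {I : Set ℝ} (hI : MeasurableSet I) (r : ℝ) : MeasurableSet (cyl I r) :=
  hI.prod measurableSet_ball

theorem exists_bound_cyl {f : Space3 → ℝ} (hf : Continuous f) (a b r : ℝ) :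
    ∃ K, 0 ≤ K ∧ ∀ x ∈ cyl (Ioo a b) r, |f x| ≤ K := by
  obtain ⟨K, hK⟩ := (isCompact_Icc.prod (isCompact_closedBall (0 : Plane)
    r)).exists_bound_of_continuousOn (f := f) (s := Icc a b ×ˢ Metric.closedBall (0 : Plane) r)
    hf.continuousOn
  exact ⟨max K 0, le_max_right _ _, fun x hx => (hK x (Set.prod_mono Ioo_subset_Icc_self
    Metric.ball_subset_closedBall hx)).trans (le_max_left _ _)⟩

theorem memLp_cyl_of_continuous {f : Space3 → ℝ} (hf : Continuous f) (a b r : ℝ) (p : ENNReal) :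
    MemLp f p (volume.restrict (cyl (Ioo a b) r)) := by
  obtain ⟨K, -, hK⟩ := exists_bound_cyl hf a b r
  have := isFiniteMeasure_cyl a b r
  exact MemLp.of_bound hf.aestronglyMeasurable K
    ((ae_restrict_iff' (measurableSet_cyl measurableSet_Ioo r)).2 (Eventually.of_forall hK))

/-- Fields in `L^p_loc` are measurable on the whole open cylinder. -/
theorem aestronglyMeasurable_cyl {r : ℝ} {F : Space3 → Mat3}
    (hF : ∀ K : Set Space3, IsCompact K → K ⊆ cyl univ r →
      AEStronglyMeasurable F (volume.restrict K)) :
    AEStronglyMeasurable F (volume.restrict (cyl univ r)) := by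
  let K : ℕ → Set Space3 := fun n => Icc (-(n : ℝ)) n ×ˢ Metric.closedBall 0 (r - 1 / (n + 1))
  have hK : ∀ n, K n ⊆ cyl univ r := by
    rintro n x ⟨-, hx⟩
    refine ⟨mem_univ _, Metric.closedBall_subset_ball ?_ hx⟩
    have : (0 : ℝ) < 1 / (n + 1) := by positivity
    linarith
  have hU : cyl univ r ⊆ ⋃ n, K n := by
    rintro x ⟨-, hx⟩
    rw [disk, mem_ball_zero_iff] at hx
    obtain ⟨n, hn⟩ := exists_nat_one_div_lt (sub_pos.2 hx)
    obtain ⟨m, hm⟩ := exists_nat_ge |x.1|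
    refine mem_iUnion.2 ⟨max n m, ?_, ?_⟩
    · rw [mem_Icc, ← abs_le]
      exact hm.trans (by exact_mod_cast le_max_right n m)
    · rw [mem_closedBall_zero_iff]
      have h1 : 1 / (((max n m : ℕ) : ℝ) + 1) ≤ 1 / ((n : ℝ) + 1) := by
        refine one_div_le_one_div_of_le (by positivity) ?_
        have : (n : ℝ) ≤ ((max n m : ℕ) : ℝ) := by exact_mod_cast le_max_left n m
        linarith
      linarith
  refine aestronglyMeasurable_iff_entries.2 fun i j => ?_
  refine (AEStronglyMeasurable.iUnion fun n => ?_).mono_measure (Measure.restrict_mono hU le_rfl)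
  exact aestronglyMeasurable_iff_entries.1
    (hF _ (isCompact_Icc.prod (isCompact_closedBall _ _)) (hK n)) i j

section Density

variable {p C₁ C₂ : ℝ} {K : Set Mat3} {W : Mat3 → ℝ} {A : Mat3}

theorem IsEnergyDensity.le_sq_norm (hW : IsEnergyDensity p C₁ C₂ K W) (hC₂ : 0 < C₂) {A' : Mat3}
    (hA' : A' ∈ K) : W A ≤ C₂ * ‖A - A'‖ ^ 2 := by
  refine (hW.upper A).trans (mul_le_mul_of_nonneg_left ((min_le_left _ _).trans ?_) hC₂.le)
  have h := Metric.infDist_le_dist_of_mem (x := A) hA'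
  rw [dist_eq_norm] at h
  exact pow_le_pow_left₀ Metric.infDist_nonneg h 2

theorem IsEnergyDensity.le_rpow_norm (hW : IsEnergyDensity p C₁ C₂ K W) (hC₂ : 0 < C₂) :
    W A ≤ C₂ * (‖A‖ ^ p + 1) :=
  (hW.upper A).trans (mul_le_mul_of_nonneg_left (min_le_right _ _) hC₂.le)

/-- Coercivity, for a bounded energy well. -/
theorem IsEnergyDensity.rpow_norm_le (hW : IsEnergyDensity p C₁ C₂ K W) (hC₁ : 0 < C₁)
    (hp₀ : 0 < p) (hp₂ : p < 2) (hK : K.Nonempty) {ϱ : ℝ} (hϱ : ∀ A ∈ K, ‖A‖ ≤ ϱ) :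
    ‖A‖ ^ p ≤ (2 / C₁) * W A + (2 * (ϱ + 1) ^ 2 + 1) := by
  have h0 : 0 ≤ ϱ := by
    obtain ⟨A', hA'⟩ := hK
    exact (norm_nonneg _).trans (hϱ A' hA')
  have hd : 0 ≤ Metric.infDist A K := Metric.infDist_nonneg
  have h1 : ‖A‖ ≤ Metric.infDist A K + (ϱ + 1) := by
    obtain ⟨A', hA', h⟩ := (Metric.infDist_lt_iff hK).1 (lt_add_one (Metric.infDist A K))
    rw [dist_eq_norm] at h
    have h2 := norm_sub_norm_le A A'
    linarith [hϱ A' hA']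
  have h2 : ‖A‖ ^ p ≤ ‖A‖ ^ 2 + 1 := by
    rcases le_total ‖A‖ 1 with h | h
    · exact (Real.rpow_le_one (norm_nonneg _) h hp₀.le).trans (by linarith [sq_nonneg ‖A‖])
    · refine (Real.rpow_le_rpow_of_exponent_le h hp₂.le).trans ?_
      rw [Real.rpow_two]
      linarith
  have h3 : ‖A‖ ^ 2 ≤ 2 * Metric.infDist A K ^ 2 + 2 * (ϱ + 1) ^ 2 := by
    nlinarith [pow_le_pow_left₀ (norm_nonneg A) h1 2, sq_nonneg (Metric.infDist A K - (ϱ + 1))]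
  have h4 : min (Metric.infDist A K ^ 2) (‖A‖ ^ p + 1) ≤ W A / C₁ := by
    rw [le_div_iff₀ hC₁, mul_comm]
    exact hW.lower A
  have h6 : 2 / C₁ * W A = 2 * (W A / C₁) := by ring
  have h7 : 0 ≤ ‖A‖ ^ p := by positivity
  rw [h6]
  rcases min_le_iff.1 h4 with h5 | h5
  · linarith
  · nlinarith [sq_nonneg (ϱ + 1)]

theorem norm_le_of_mem_SO3mul {H A : Mat3} (hA : A ∈ SO3mul H) : ‖A‖ ≤ 9 * ∑ i, ∑ j, |H i j| := by
  obtain ⟨R, hR, rfl⟩ := hA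
  have h0 : ∀ k j, |H k j| ≤ ∑ j, |H k j| := fun k j =>
    Finset.single_le_sum (f := fun j => |H k j|) (fun j _ => abs_nonneg _) (Finset.mem_univ j)
  have h1 : ∀ i j, |(R * H) i j| ≤ ∑ i, ∑ j, |H i j| := by
    intro i j
    rw [Matrix.mul_apply]
    refine (Finset.abs_sum_le_sum_abs _ _).trans (Finset.sum_le_sum fun k _ => ?_)
    rw [abs_mul]
    exact (mul_le_of_le_one_left (abs_nonneg _) (abs_entry_le_of_mem_SO3 hR i k)).trans (h0 k j)
  refine (norm_le_sum_abs_entry _).trans ((Finset.sum_le_sum fun i _ => Finset.sum_le_sum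
    fun j _ => h1 i j).trans ?_)
  simp only [Finset.sum_const, Finset.card_univ, Fintype.card_fin, nsmul_eq_mul]
  push_cast
  linarith

end Density

section Transition

variable {r p ℓ : ℝ} {c : ℝ → Plane} {b : EuclideanSpace ℝ (Fin 3)} {H : Mat3} {C₁ C₂ : ℝ}
  {W₁ W₂ : Mat3 → ℝ}

/-- The coordinate functions `x₁, x₂, x₃`. -/
def coordFun : Fin 3 → Space3 → ℝ := ![fun x => x.1, fun x => x.2 0, fun x => x.2 1]

theorem contDiff_coordFun {n : ℕ∞} (k : Fin 3) : ContDiff ℝ n (coordFun k) := by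
  have h : ∀ i : Fin 2, ContDiff ℝ n fun x : Space3 => x.2 i := fun i =>
    (EuclideanSpace.proj i : Plane →L[ℝ] ℝ).contDiff.comp contDiff_snd
  fin_cases k
  · exact contDiff_fst
  · exact h 0
  · exact h 1

theorem fderiv_coordFun (k j : Fin 3) (x : Space3) :
    fderiv ℝ (coordFun k) x (coordVec j) = (1 : Mat3) k j := by
  have h : ∀ i : Fin 2, HasFDerivAt (fun x : Space3 => x.2 i)
      ((EuclideanSpace.proj i : Plane →L[ℝ] ℝ).comp (ContinuousLinearMap.snd ℝ ℝ Plane)) x :=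
    fun i => ((EuclideanSpace.proj i : Plane →L[ℝ] ℝ).comp
      (ContinuousLinearMap.snd ℝ ℝ Plane)).hasFDerivAt
  have h0 : fderiv ℝ (coordFun 0) x = ContinuousLinearMap.fst ℝ ℝ Plane := hasFDerivAt_fst.fderiv
  have h1 : fderiv ℝ (coordFun 1) x = _ := (h 0).fderiv
  have h2 : fderiv ℝ (coordFun 2) x = _ := (h 1).fderiv
  fin_cases k
  · change fderiv ℝ (coordFun 0) x (coordVec j) = (1 : Mat3) 0 j
    rw [h0]
    fin_cases j <;> simp [coordVec] <;> rfl
  · change fderiv ℝ (coordFun 1) x (coordVec j) = (1 : Mat3) 1 j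
    rw [h1]
    fin_cases j <;> simp [coordVec] <;> rfl
  · change fderiv ℝ (coordFun 2) x (coordVec j) = (1 : Mat3) 2 j
    rw [h2]
    fin_cases j <;> simp [coordVec] <;> rfl

theorem fderiv_sum_coordFun (A : Mat3) (i j : Fin 3) (x : Space3) :
    fderiv ℝ (fun x => ∑ k, A i k * coordFun k x) x (coordVec j) = A i j := by
  have hd : ∀ k, DifferentiableAt ℝ (coordFun k) x := fun k =>
    (contDiff_coordFun (n := 1) k).differentiable one_ne_zero x
  rw [fderiv_fun_sum fun k _ => (hd k).const_mul _]
  simp only [fderiv_const_mul (hd _), sum_apply, smul_apply,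
    fderiv_coordFun, smul_eq_mul, Matrix.one_apply, mul_ite, mul_one, mul_zero, Finset.sum_ite_eq',
    Finset.mem_univ, if_true]

/-- Transition fields exist: add the slip field to the gradient of a smooth deformation that turns
from the identity to `H`. -/
theorem IsDislocationCurve.exists_transitionField (hr : 0 < r) (hΓ : IsDislocationCurve r ℓ c)
    (hp₁ : 1 < p) (hp₂ : p < 2) (b : EuclideanSpace ℝ (Fin 3)) (H : Mat3) :
    ∃ T ∈ transitionFields r p b ℓ c 2 1 H,
      MemLp T (ENNReal.ofReal p) (volume.restrict (cyl (Ioo (-2) 2) r)) := by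
  obtain ⟨E, hE, hE0, hEc⟩ := hΓ.exists_slip hr hp₁ hp₂
  let v : Fin 3 → Space3 → ℝ := fun i x => (1 - cutoff x.1) * (∑ k, (1 : Mat3) i k * coordFun k x) +
    cutoff x.1 * ∑ k, H i k * coordFun k x
  have hsum : ∀ (A : Mat3) i, ContDiff ℝ 1 fun x => ∑ k, A i k * coordFun k x := fun A i =>
    ContDiff.sum fun k _ => contDiff_const.mul (contDiff_coordFun k)
  have hcut : ContDiff ℝ 1 fun x : Space3 => cutoff x.1 := contDiff_cutoff.comp contDiff_fst
  have hv : ∀ i, ContDiff ℝ 1 (v i) := fun i =>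
    ((contDiff_const.sub hcut).mul (hsum 1 i)).add (hcut.mul (hsum H i))
  let D : Space3 → Mat3 := fun x => Matrix.of fun i j => fderiv ℝ (v i) x (coordVec j)
  let S : Space3 → Mat3 := fun x => Matrix.of fun i j => b i * E x j
  have hDc : ∀ i j, Continuous fun x => D x i j := fun i j =>
    ((hv i).continuous_fderiv one_ne_zero).clm_apply continuous_const
  have hS : MemLp S (ENNReal.ofReal p) (volume.restrict (cyl univ r)) :=
    memLp_iff_entries.2 fun i j => (hE j).const_mul (b i)
  have hDl : ∀ x : Space3, x.1 < -2 → D x = 1 := by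
    intro x hx
    have h1 : ∀ i, v i =ᶠ[𝓝 x] fun x => ∑ k, (1 : Mat3) i k * coordFun k x := by
      intro i
      have h2 : ∀ᶠ y : Space3 in 𝓝 x, y.1 < -2 := continuous_fst.continuousAt.eventually_lt_const hx
      filter_upwards [h2] with y hy
      simp only [v]
      rw [cutoff_of_le (by linarith)]
      ring
    ext i j
    simp only [D, Matrix.of_apply, (h1 i).fderiv_eq]
    exact fderiv_sum_coordFun 1 i j x
  have hDr : ∀ x : Space3, 2 < x.1 → D x = H := by
    intro x hx
    have h1 : ∀ i, v i =ᶠ[𝓝 x] fun x => ∑ k, H i k * coordFun k x := by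
      intro i
      have h2 : ∀ᶠ y : Space3 in 𝓝 x, 2 < y.1 := continuous_fst.continuousAt.eventually_const_lt hx
      filter_upwards [h2] with y hy
      simp only [v]
      rw [cutoff_of_ge hy.le]
      ring
    ext i j
    simp only [D, Matrix.of_apply, (h1 i).fderiv_eq]
    exact fderiv_sum_coordFun H i j x
  have hS0 : ∀ x : Space3, x.1 ∉ Ioo (0 : ℝ) 2 → S x = 0 := by
    intro x hx
    ext i j
    simp [S, hE0 x hx]
  refine ⟨fun x => D x + S x, ⟨⟨fun K hK hKU => ?_, ?_⟩, ?_, ?_⟩, ?_⟩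
  · refine memLp_iff_entries.2 fun i j => MemLp.add ?_ ?_
    · have : IsFiniteMeasure (volume.restrict K) := ⟨by simpa using hK.measure_lt_top⟩
      obtain ⟨κ, hκ⟩ := hK.exists_bound_of_continuousOn (hDc i j).continuousOn
      exact MemLp.of_bound (hDc i j).aestronglyMeasurable κ
        ((ae_restrict_iff' hK.measurableSet).2 (Eventually.of_forall hκ))
    · exact (memLp_iff_entries.1 hS i j).mono_measure (Measure.restrict_mono hKU le_rfl)
  · have h := (hasDislocationCurl_gradient (U := cyl univ r) (ℓ := ℓ) (c := c) (D := D) hv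
      fun x i j => rfl).add (hEc b) (locIntegrableField_of_continuous hDc)
      (locIntegrableField_of_memLp hp₁.le fun K _ hKU =>
        memLp_iff_entries.2 fun i j => (memLp_iff_entries.1 hS i j).mono_measure
          (Measure.restrict_mono hKU le_rfl))
    rwa [zero_add] at h
  · refine (ae_restrict_iff' (measurableSet_cyl measurableSet_Iio r)).2
      (Eventually.of_forall fun x hx => ?_)
    have h0 : x.1 < -2 := hx.1
    change D x + S x = 1
    rw [hDl x h0, hS0 x fun h => by linarith [h.1], add_zero]
  · refine (ae_restrict_iff' (measurableSet_cyl measurableSet_Ioi r)).2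
      (Eventually.of_forall fun x hx => ?_)
    have h0 : 2 < x.1 := hx.1
    change D x + S x = H
    rw [hDr x h0, hS0 x fun h => by linarith [h.2], add_zero]
  · refine memLp_iff_entries.2 fun i j => MemLp.add (memLp_cyl_of_continuous (hDc i j) _ _ _ _) ?_
    exact (memLp_iff_entries.1 hS i j).mono_measure
      (Measure.restrict_mono (Set.prod_mono (subset_univ _) Subset.rfl) le_rfl)

theorem density_le_rpow_norm (hW₁ : IsEnergyDensity p C₁ C₂ SO3 W₁)
    (hW₂ : IsEnergyDensity p C₁ C₂ (SO3mul H) W₂) (hC₂ : 0 < C₂) (x : Space3) (A : Mat3) :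
    density W₁ W₂ x A ≤ C₂ * (‖A‖ ^ p + 1) := by
  rw [density]
  split_ifs
  · exact hW₁.le_rpow_norm hC₂
  · exact hW₂.le_rpow_norm hC₂

theorem exists_rpow_norm_le_density (hW₁ : IsEnergyDensity p C₁ C₂ SO3 W₁)
    (hW₂ : IsEnergyDensity p C₁ C₂ (SO3mul H) W₂) (hC₁ : 0 < C₁) (hp₁ : 1 < p) (hp₂ : p < 2) :
    ∃ κ κ' : ℝ, 0 ≤ κ ∧ 0 ≤ κ' ∧ ∀ (x : Space3) (A : Mat3),
      ‖A‖ ^ p ≤ κ * density W₁ W₂ x A + κ' := by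
  set s : ℝ := 9 * ∑ i, ∑ j, |(1 : Mat3) i j|
  set s' : ℝ := 9 * ∑ i, ∑ j, |H i j|
  refine ⟨2 / C₁, 2 * (s + 1) ^ 2 + 1 + (2 * (s' + 1) ^ 2 + 1), by positivity, by positivity,
    fun x A => ?_⟩
  have h1 : ‖A‖ ^ p ≤ (2 / C₁) * W₁ A + (2 * (s + 1) ^ 2 + 1) := by
    refine hW₁.rpow_norm_le hC₁ (by linarith) hp₂ ⟨1, one_mem_SO3⟩ fun A hA => ?_
    rw [← SO3mul_one] at hA
    exact norm_le_of_mem_SO3mul hA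
  have h2 : ‖A‖ ^ p ≤ (2 / C₁) * W₂ A + (2 * (s' + 1) ^ 2 + 1) :=
    hW₂.rpow_norm_le hC₁ (by linarith) hp₂ ⟨_, mem_image_of_mem _ one_mem_SO3⟩ fun A hA =>
      norm_le_of_mem_SO3mul hA
  rw [density]
  have := sq_nonneg (s + 1)
  have := sq_nonneg (s' + 1)
  split_ifs <;> linarith

theorem lintegral_rpow_norm_lt_top_iff {α : Type*} [MeasurableSpace α] {μ : Measure α}
    {F : α → Mat3} (hF : AEStronglyMeasurable F μ) (hp : 0 < p) :
    MemLp F (ENNReal.ofReal p) μ ↔ ∫⁻ x, ENNReal.ofReal (‖F x‖ ^ p) ∂μ < ⊤ := by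
  have h0 : ENNReal.ofReal p ≠ 0 := (ENNReal.ofReal_pos.2 hp).ne'
  have h1 : ∀ x, ENNReal.ofReal (‖F x‖ ^ p) = ‖F x‖ₑ ^ (ENNReal.ofReal p).toReal := by
    intro x
    rw [ENNReal.toReal_ofReal hp.le, ← ofReal_norm,
      ENNReal.ofReal_rpow_of_nonneg (norm_nonneg _) hp.le]
  simp_rw [h1]
  rw [← eLpNorm_lt_top_iff_lintegral_rpow_enorm_lt_top h0 ENNReal.ofReal_ne_top]
  exact ⟨fun h => h.2, fun h => ⟨hF, h⟩⟩

theorem energy_lt_top (hW₁ : IsEnergyDensity p C₁ C₂ SO3 W₁)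
    (hW₂ : IsEnergyDensity p C₁ C₂ (SO3mul H) W₂) (hC₂ : 0 < C₂) (hp₁ : 1 < p) {a a' : ℝ}
    {T : Space3 → Mat3}
    (hT : MemLp T (ENNReal.ofReal p) (volume.restrict (cyl (Ioo a a') r))) :
    energy W₁ W₂ (Ioo a a') r T < ⊤ := by
  have hfin := isFiniteMeasure_cyl a a' r
  have h1 := (lintegral_rpow_norm_lt_top_iff hT.1 (by linarith)).1 hT
  calc energy W₁ W₂ (Ioo a a') r T
      ≤ ∫⁻ x in cyl (Ioo a a') r, ENNReal.ofReal C₂ * (ENNReal.ofReal (‖T x‖ ^ p) + 1) := by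
        refine lintegral_mono fun x => ?_
        rw [← ENNReal.ofReal_one, ← ENNReal.ofReal_add (by positivity) zero_le_one,
          ← ENNReal.ofReal_mul hC₂.le]
        exact ENNReal.ofReal_le_ofReal (density_le_rpow_norm hW₁ hW₂ hC₂ x _)
    _ = ENNReal.ofReal C₂ * ((∫⁻ x in cyl (Ioo a a') r, ENNReal.ofReal (‖T x‖ ^ p)) +
          ∫⁻ x in cyl (Ioo a a') r, 1) := by
        rw [lintegral_const_mul' _ _ ENNReal.ofReal_ne_top, lintegral_add_right _ measurable_const]
    _ < ⊤ := by
        refine ENNReal.mul_lt_top ENNReal.ofReal_lt_top (ENNReal.add_lt_top.2 ⟨h1, ?_⟩)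
        rw [lintegral_one]
        exact measure_lt_top _ _

theorem transitionCost_lt_top (hr : 0 < r) (hΓ : IsDislocationCurve r ℓ c)
    (hW₁ : IsEnergyDensity p C₁ C₂ SO3 W₁) (hW₂ : IsEnergyDensity p C₁ C₂ (SO3mul H) W₂)
    (hC₂ : 0 < C₂) (hp₁ : 1 < p) (hp₂ : p < 2) :
    transitionCost r p W₁ W₂ b ℓ c 1 H < ⊤ := by
  obtain ⟨T, hT, hTp⟩ := hΓ.exists_transitionField hr hp₁ hp₂ b H
  refine lt_of_le_of_lt ?_ (energy_lt_top hW₁ hW₂ hC₂ hp₁ hTp)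
  exact (iInf₂_le (2 : ℝ) two_pos).trans (iInf₂_le T hT)

/-- A transition field of finite energy is `p`-integrable up to the lateral boundary, and so is its
deviation from the rest state on the infinite cylinder. -/
theorem memLp_sub_restState (hW₁ : IsEnergyDensity p C₁ C₂ SO3 W₁)
    (hW₂ : IsEnergyDensity p C₁ C₂ (SO3mul H) W₂) (hC₁ : 0 < C₁) (hp₁ : 1 < p) (hp₂ : p < 2)
    {M : ℝ} (hM : 0 < M) {T : Space3 → Mat3} (hT : T ∈ transitionFields r p b ℓ c M 1 H)
    (hE : energy W₁ W₂ (Ioo (-M) M) r T < ⊤) :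
    MemLp (fun x => T x - restState H x.1) (ENNReal.ofReal p) (volume.restrict (cyl univ r)) := by
  have hsub : cyl (Ioo (-M) M) r ⊆ cyl univ r := prod_mono (subset_univ _) Subset.rfl
  have hTm : AEStronglyMeasurable T (volume.restrict (cyl univ r)) :=
    aestronglyMeasurable_cyl fun K hK hKU => (hT.1.1 K hK hKU).1
  have hfin := isFiniteMeasure_cyl (-M) M r
  have hTp : MemLp T (ENNReal.ofReal p) (volume.restrict (cyl (Ioo (-M) M) r)) := by
    rw [lintegral_rpow_norm_lt_top_iff
      (hTm.mono_measure (Measure.restrict_mono hsub le_rfl)) (by linarith)]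
    obtain ⟨κ, κ', hκ, hκ', h⟩ := exists_rpow_norm_le_density hW₁ hW₂ hC₁ hp₁ hp₂
    calc ∫⁻ x in cyl (Ioo (-M) M) r, ENNReal.ofReal (‖T x‖ ^ p)
        ≤ ∫⁻ x in cyl (Ioo (-M) M) r, (ENNReal.ofReal κ *
            ENNReal.ofReal (density W₁ W₂ x (T x)) + ENNReal.ofReal κ') := by
          refine lintegral_mono fun x => ?_
          refine (ENNReal.ofReal_le_ofReal (h x (T x))).trans (ENNReal.ofReal_add_le.trans ?_)
          rw [ENNReal.ofReal_mul hκ]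
      _ = ENNReal.ofReal κ * energy W₁ W₂ (Ioo (-M) M) r T +
            ∫⁻ x in cyl (Ioo (-M) M) r, ENNReal.ofReal κ' := by
          rw [lintegral_add_right _ measurable_const, lintegral_const_mul' _ _ ENNReal.ofReal_ne_top]
          rfl
      _ < ⊤ := by
          refine ENNReal.add_lt_top.2 ⟨ENNReal.mul_lt_top ENNReal.ofReal_lt_top hE, ?_⟩
          rw [lintegral_const]
          exact ENNReal.mul_lt_top ENNReal.ofReal_lt_top (measure_lt_top _ _)
  refine memLp_iff_entries.2 fun i j => ?_
  let s : Set Space3 := Ioo (-M) M ×ˢ univ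
  have hs : MeasurableSet s := measurableSet_Ioo.prod MeasurableSet.univ
  have hss : s ∩ cyl univ r = cyl (Ioo (-M) M) r := by
    rw [cyl, prod_inter_prod, inter_univ, univ_inter]
    rfl
  have hind : (fun x => (T x - restState H x.1) i j) =ᵐ[volume.restrict (cyl univ r)]
      s.indicator fun x => (T x - restState H x.1) i j := by
    have h1 := (ae_restrict_iff' (measurableSet_cyl measurableSet_Iio r)).1 hT.2.1
    have h2 := (ae_restrict_iff' (measurableSet_cyl measurableSet_Ioi r)).1 hT.2.2
    have h3 : ∀ a : ℝ, ∀ᵐ x : Space3, x.1 ≠ a := fun a =>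
      Measure.quasiMeasurePreserving_fst.ae (Measure.ae_ne volume a)
    refine (ae_restrict_iff' (measurableSet_cyl MeasurableSet.univ r)).2 ?_
    filter_upwards [h1, h2, h3 M, h3 (-M)] with x hx1 hx2 hx3 hx4 hx
    by_cases hxs : x ∈ s
    · rw [indicator_of_mem hxs]
    · rw [indicator_of_notMem hxs]
      have h5 : x.1 < -M ∨ M < x.1 := by
        by_contra h
        rw [not_or, not_lt, not_lt] at h
        exact hxs ⟨⟨h.1.lt_of_ne' hx4, h.2.lt_of_ne hx3⟩, mem_univ _⟩
      rcases h5 with h | h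
      · rw [hx1 ⟨h, hx.2⟩, restState, if_pos (by linarith), sub_self]
        rfl
      · rw [hx2 ⟨h, hx.2⟩, restState, if_neg (by linarith), sub_self]
        rfl
  rw [memLp_congr_ae hind, memLp_indicator_iff_restrict hs, Measure.restrict_restrict hs, hss]
  refine (memLp_iff_entries.1 hTp i j).sub ?_
  exact MemLp.of_bound ((measurable_restState H i j).comp measurable_fst).aestronglyMeasurable _
    (Eventually.of_forall fun x => abs_restState_le H i j x.1)

end Transition

/-! ### The recovery fields -/

/-- The first column that compensates, up to a factor `h`, for the axial oscillation of the second
and third columns of the field `B`. -/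
noncomputable def corrector (B : ℝ → Mat3) (x : Space3) : Mat3 := Matrix.of fun i j =>
  if j = 0 then deriv (fun t => B t i 1) x.1 * x.2 0 + deriv (fun t => B t i 2) x.1 * x.2 1 else 0

/-- The fields of the recovery sequence, after the rescaling: the squeezed transition field plus the
axial oscillation `B` and its corrector. -/
noncomputable def recoveryField (T : Space3 → Mat3) (B : ℝ → Mat3) (h : ℝ) (x : Space3) : Mat3 :=
  T (axialScale h⁻¹ x) + (B x.1 + h • corrector B x)

section Recovery

variable {L r p ℓ : ℝ} {c : ℝ → Plane} {b : EuclideanSpace ℝ (Fin 3)} {H : Mat3} {C₁ C₂ : ℝ}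
  {W₁ W₂ : Mat3 → ℝ} {T : Space3 → Mat3} {B : ℝ → Mat3} {M δ h : ℝ}

theorem continuous_corrector (hB : ∀ i j, ContDiff ℝ ∞ fun t => B t i j) (i j : Fin 3) :
    Continuous fun x => corrector B x i j := by
  have hd : ∀ k, Continuous fun x : Space3 => deriv (fun t => B t i k) x.1 := fun k =>
    ((hB i k).continuous_deriv (by simp)).comp continuous_fst
  simp only [corrector, Matrix.of_apply]
  split_ifs
  · exact ((hd 1).mul (by fun_prop)).add ((hd 2).mul (by fun_prop))
  · exact continuous_const

theorem corrector_eq_zero (hδ : ∀ t, |t| < δ → B t = 0) {x : Space3} (hx : |x.1| < δ) :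
    corrector B x = 0 := by
  have hd : ∀ i k, deriv (fun t => B t i k) x.1 = 0 := by
    intro i k
    have h1 : (fun t => B t i k) =ᶠ[𝓝 x.1] fun _ => 0 := by
      have h2 : ∀ᶠ t in 𝓝 x.1, |t| < δ := continuous_abs.continuousAt.eventually_lt_const hx
      filter_upwards [h2] with t ht
      rw [hδ t ht]
      rfl
    rw [h1.deriv_eq, deriv_const]
  ext i j
  simp [corrector, hd]

theorem exists_antideriv {f : ℝ → ℝ} (hf : Continuous f) :
    ∃ g : ℝ → ℝ, ContDiff ℝ 1 g ∧ ∀ t, HasDerivAt g (f t) t := by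
  have h : ∀ t, HasDerivAt (fun t => ∫ s in (0 : ℝ)..t, f s) (f t) t := fun t =>
    intervalIntegral.integral_hasDerivAt_right (hf.intervalIntegrable _ _)
      (hf.stronglyMeasurableAtFilter _ _) hf.continuousAt
  refine ⟨_, contDiff_one_iff_deriv.2 ⟨fun t => (h t).differentiableAt, ?_⟩, h⟩
  rwa [funext fun t => (h t).deriv]

/-- In the original variables, an axial oscillation together with its corrector is a gradient. -/
theorem hasDislocationCurl_oscillation {U : Set Space3} (hB : ∀ i j, ContDiff ℝ ∞ fun t => B t i j) :
    HasDislocationCurl U ℓ c 0 fun x => unrescale h (B x.1 + h • corrector B x) := by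
  choose g hg hg' using fun i : Fin 3 => exists_antideriv (hB i 0).continuous
  let v : Fin 3 → Space3 → ℝ := fun i x =>
    g i x.1 + h * (B x.1 i 1 * coordFun 1 x + B x.1 i 2 * coordFun 2 x)
  have hB1 : ∀ i k, ContDiff ℝ 1 fun x : Space3 => B x.1 i k := fun i k =>
    ((hB i k).of_le (by simp)).comp contDiff_fst
  refine hasDislocationCurl_gradient (v := v) (fun i => ?_) fun x i j => ?_
  · exact ((hg i).comp contDiff_fst).add (contDiff_const.mul
      (((hB1 i 1).mul (contDiff_coordFun 1)).add ((hB1 i 2).mul (contDiff_coordFun 2))))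
  have hfst : HasFDerivAt (fun x : Space3 => x.1) (ContinuousLinearMap.fst ℝ ℝ Plane) x :=
    hasFDerivAt_fst
  have hBd : ∀ k, HasFDerivAt (fun x : Space3 => B x.1 i k)
      (deriv (fun t => B t i k) x.1 • ContinuousLinearMap.fst ℝ ℝ Plane) x := fun k =>
    (((hB i k).differentiable (by simp) x.1).hasDerivAt).comp_hasFDerivAt x hfst
  have hcd : ∀ k, HasFDerivAt (coordFun k) (fderiv ℝ (coordFun k) x) x := fun k =>
    ((contDiff_coordFun (n := 1) k).differentiable one_ne_zero x).hasFDerivAt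
  have hvd := ((hg' i x.1).comp_hasFDerivAt x hfst).add
    ((((hBd 1).mul (hcd 1)).add ((hBd 2).mul (hcd 2))).const_mul h)
  refine Eq.trans ?_ (DFunLike.congr_fun hvd.fderiv (coordVec j)).symm
  simp only [add_apply, smul_apply, fderiv_coordFun]
  fin_cases j
  · simp [unrescale, corrector, coordVec, coordFun]
    exact Or.inl (by ring)
  · simp [unrescale, corrector, coordVec, coordFun]
    exact Or.inl (mul_one _).symm
  · simp [unrescale, corrector, coordVec, coordFun]
    exact Or.inl (mul_one _).symm

theorem restState_scale (hh : 0 < h) (t : ℝ) : restState H (h⁻¹ * t) = restState H t := by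
  have h1 : h⁻¹ * t < 0 ↔ t < 0 := by
    rw [mul_neg_iff]
    have := inv_pos.2 hh
    constructor
    · rintro (h | h)
      · exact h.2
      · linarith [h.1]
    · exact fun h => Or.inl ⟨this, h⟩
  simp only [restState, h1]

theorem map_axialScale_restrict (hh : 0 < h) :
    Measure.map (axialScale h⁻¹) (volume.restrict (cyl univ r)) =
      ENNReal.ofReal h • volume.restrict (cyl univ r) := by
  have h1 : axialScale h⁻¹ ⁻¹' cyl univ r = cyl univ r := by
    ext x
    simp [axialScale, cyl]
  have h2 := (measurableEmbedding_axialScale (inv_ne_zero hh.ne')).restrict_map volume (cyl univ r)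
  rw [h1] at h2
  rw [← h2, map_axialScale (inv_ne_zero hh.ne'), inv_inv, abs_of_pos hh, Measure.restrict_smul]

theorem memLp_comp_axialScale (hh : 0 < h) {q : ENNReal} {f : Space3 → ℝ}
    (hf : MemLp f q (volume.restrict (cyl univ r))) :
    MemLp (fun x => f (axialScale h⁻¹ x)) q (volume.restrict (cyl univ r)) := by
  refine (measurableEmbedding_axialScale (inv_ne_zero hh.ne')).memLp_map_measure_iff.1 ?_
  rw [map_axialScale_restrict hh]
  exact hf.smul_measure ENNReal.ofReal_ne_top

theorem eLpNorm_comp_axialScale (hh : 0 < h) (hp : 0 < p) (f : Space3 → ℝ) :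
    eLpNorm (fun x => f (axialScale h⁻¹ x)) (ENNReal.ofReal p) (volume.restrict (cyl univ r)) =
      ENNReal.ofReal (h ^ (1 / p)) * eLpNorm f (ENNReal.ofReal p) (volume.restrict (cyl univ r)) := by
  have h1 := (measurableEmbedding_axialScale (inv_ne_zero hh.ne')).eLpNorm_map_measure
    (p := ENNReal.ofReal p) (g := f) (μ := volume.restrict (cyl univ r))
  rw [map_axialScale_restrict hh, eLpNorm_smul_measure_of_ne_top ENNReal.ofReal_ne_top] at h1
  have h2 : (ENNReal.ofReal h) ^ (1 / ENNReal.ofReal p).toReal = ENNReal.ofReal (h ^ (1 / p)) := by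
    rw [ENNReal.toReal_div, ENNReal.toReal_one, ENNReal.toReal_ofReal hp.le,
      ENNReal.ofReal_rpow_of_pos hh]
  rw [h2, smul_eq_mul] at h1
  exact h1.symm

theorem recoveryField_sub (hh : 0 < h) (x : Space3) (i j : Fin 3) :
    (recoveryField T B h x - (restState H x.1 + B x.1)) i j =
      (T (axialScale h⁻¹ x) - restState H (axialScale h⁻¹ x).1) i j + h * corrector B x i j := by
  have h1 : restState H (axialScale h⁻¹ x).1 = restState H x.1 := restState_scale hh x.1
  rw [h1]
  simp only [recoveryField, Matrix.sub_apply, Matrix.add_apply, Matrix.smul_apply, smul_eq_mul]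
  ring

theorem volume_restrict_cyl_mono (I : Set ℝ) (r : ℝ) :
    volume.restrict (cyl I r) ≤ volume.restrict (cyl univ r) :=
  Measure.restrict_mono (Set.prod_mono (subset_univ _) Subset.rfl) le_rfl

theorem memLp_recoveryField_sub (hh : 0 < h) (hB : ∀ i j, ContDiff ℝ ∞ fun t => B t i j)
    (hT : MemLp (fun x => T x - restState H x.1) (ENNReal.ofReal p) (volume.restrict (cyl univ r)))
    (i j : Fin 3) : MemLp (fun x => (recoveryField T B h x - (restState H x.1 + B x.1)) i j)
      (ENNReal.ofReal p) (volume.restrict (cyl (Ioo (-L) L) r)) := by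
  simp only [recoveryField_sub hh]
  exact ((memLp_comp_axialScale hh (memLp_iff_entries.1 hT i j)).mono_measure
    (volume_restrict_cyl_mono _ r)).add
    ((memLp_cyl_of_continuous (continuous_corrector hB i j) _ _ _ _).const_mul h)

theorem memLp_recoveryField (hh : 0 < h) (hB : ∀ i j, ContDiff ℝ ∞ fun t => B t i j)
    (hT : MemLp (fun x => T x - restState H x.1) (ENNReal.ofReal p) (volume.restrict (cyl univ r)))
    (i j : Fin 3) : MemLp (fun x => recoveryField T B h x i j)
      (ENNReal.ofReal p) (volume.restrict (cyl (Ioo (-L) L) r)) := by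
  have hfin := isFiniteMeasure_cyl (-L) L r
  have h1 : MemLp (fun x : Space3 => restState H x.1 i j) (ENNReal.ofReal p)
      (volume.restrict (cyl (Ioo (-L) L) r)) :=
    MemLp.of_bound ((measurable_restState H i j).comp measurable_fst).aestronglyMeasurable _
      (Eventually.of_forall fun x => abs_restState_le H i j x.1)
  have h2 : MemLp (fun x : Space3 => B x.1 i j) (ENNReal.ofReal p)
      (volume.restrict (cyl (Ioo (-L) L) r)) :=
    memLp_cyl_of_continuous ((hB i j).continuous.comp continuous_fst) _ _ _ _
  have h3 := (memLp_recoveryField_sub (L := L) hh hB hT i j).add (h1.add h2)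
  refine h3.ae_eq (Eventually.of_forall fun x => ?_)
  simp

theorem unrescale_recoveryField_mem (hp₁ : 1 < p) (hh : 0 < h)
    (hB : ∀ i j, ContDiff ℝ ∞ fun t => B t i j)
    (hTc : HasDislocationCurl (cyl univ r) ℓ c b T)
    (hT : MemLp (fun x => T x - restState H x.1) (ENNReal.ofReal p) (volume.restrict (cyl univ r))) :
    (fun x => unrescale h (recoveryField T B h x)) ∈ AdmissibleField L r p b ℓ c h := by
  have hun : ∀ {F : Space3 → Mat3} {μ : Measure Space3},
      (∀ i j, MemLp (fun x => F x i j) (ENNReal.ofReal p) μ) →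
      MemLp (fun x => unrescale h (F x)) (ENNReal.ofReal p) μ := by
    intro F μ hF
    refine memLp_iff_entries.2 fun i j => ?_
    simp only [unrescale, Matrix.of_apply]
    split_ifs
    · exact hF i j
    · exact (hF i j).const_mul h
  have hG := hun (memLp_recoveryField (L := L) hh hB hT)
  refine ⟨hG, ?_⟩
  have hsub : cyl (Ioo (-L) L) r ⊆ cyl univ r := Set.prod_mono (subset_univ _) Subset.rfl
  have h1 := (hTc.squeeze hh).mono hsub
  have h2 : HasDislocationCurl (cyl (Ioo (-L) L) r) ℓ c 0
    fun x => unrescale h (B x.1 + h • corrector B x) := hasDislocationCurl_oscillation hB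
  have hc2 : ∀ i j, Continuous fun x => unrescale h (B x.1 + h • corrector B x) i j := by
    intro i j
    have h3 : Continuous fun x : Space3 => B x.1 i j + h * corrector B x i j :=
      ((hB i j).continuous.comp continuous_fst).add
        (continuous_const.mul (continuous_corrector hB i j))
    simp only [unrescale, Matrix.of_apply, Matrix.add_apply, Matrix.smul_apply, smul_eq_mul]
    split_ifs
    · exact h3
    · exact continuous_const.mul h3
  have hi2 : LocIntegrableField (cyl (Ioo (-L) L) r)
    fun x => unrescale h (B x.1 + h • corrector B x) := locIntegrableField_of_continuous hc2
  have hTe : ∀ i j, MemLp (fun x => T (axialScale h⁻¹ x) i j) (ENNReal.ofReal p)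
      (volume.restrict (cyl (Ioo (-L) L) r)) := by
    intro i j
    have h4 := memLp_recoveryField (L := L) (B := 0) hh (fun i j => contDiff_const) hT i j
    refine h4.ae_eq (Eventually.of_forall fun x => ?_)
    simp [recoveryField, corrector]
  have hi1 : LocIntegrableField (cyl (Ioo (-L) L) r) fun x => unrescale h (T (axialScale h⁻¹ x)) :=
    locIntegrableField_of_memLp hp₁.le fun K _ hKU => memLp_iff_entries.2 fun i j =>
      (memLp_iff_entries.1 (hun hTe) i j).mono_measure (Measure.restrict_mono hKU le_rfl)
  have h5 := h1.add h2 hi1 hi2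
  rw [add_zero] at h5
  have h6 : (fun x => unrescale h (recoveryField T B h x)) = fun x =>
      unrescale h (T (axialScale h⁻¹ x)) + unrescale h (B x.1 + h • corrector B x) := by
    funext x
    rw [recoveryField, unrescale_add]
  rw [h6]
  exact h5

theorem tendsto_eLpNorm_recoveryField_sub (hp₁ : 1 < p)
    (hB : ∀ i j, ContDiff ℝ ∞ fun t => B t i j)
    (hT : MemLp (fun x => T x - restState H x.1) (ENNReal.ofReal p) (volume.restrict (cyl univ r)))
    (i j : Fin 3) : Tendsto (fun h => eLpNorm
      (fun x => (recoveryField T B h x - (restState H x.1 + B x.1)) i j)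
      (ENNReal.ofReal p) (volume.restrict (cyl (Ioo (-L) L) r))) (𝓝[>] 0) (𝓝 0) := by
  have hp0 : 0 < p := by linarith
  set P := eLpNorm (fun x => (T x - restState H x.1) i j) (ENNReal.ofReal p)
    (volume.restrict (cyl univ r)) with hPdef
  set N := eLpNorm (fun x => corrector B x i j) (ENNReal.ofReal p)
    (volume.restrict (cyl (Ioo (-L) L) r)) with hNdef
  have hP : P ≠ ⊤ := (memLp_iff_entries.1 hT i j).2.ne
  have hN : N ≠ ⊤ := (memLp_cyl_of_continuous (continuous_corrector hB i j) _ _ _ _).2.ne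
  have hlim : Tendsto (fun h : ℝ => ENNReal.ofReal (h ^ (1 / p)) * P + ENNReal.ofReal h * N)
      (𝓝[>] 0) (𝓝 0) := by
    have h1 : Tendsto (fun h : ℝ => h ^ (1 / p)) (𝓝[>] 0) (𝓝 0) := by
      have h2 : Continuous fun h : ℝ => h ^ (1 / p) :=
        Real.continuous_rpow_const (by positivity)
      have h3 := (h2.tendsto 0).mono_left (nhdsWithin_le_nhds (s := Ioi 0))
      rwa [Real.zero_rpow (by positivity)] at h3
    have h4 : Tendsto (fun h : ℝ => h) (𝓝[>] 0) (𝓝 0) := nhdsWithin_le_nhds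
    have h5 := ENNReal.Tendsto.mul_const (ENNReal.tendsto_ofReal h1) (Or.inr hP)
    have h6 := ENNReal.Tendsto.mul_const (ENNReal.tendsto_ofReal h4) (Or.inr hN)
    simpa using h5.add h6
  refine tendsto_of_tendsto_of_tendsto_of_le_of_le' tendsto_const_nhds hlim
    (Eventually.of_forall fun _ => zero_le) ?_
  filter_upwards [self_mem_nhdsWithin] with h hh
  simp only [recoveryField_sub (mem_Ioi.1 hh)]
  have hm1 := (memLp_comp_axialScale (mem_Ioi.1 hh) (memLp_iff_entries.1 hT i j)).mono_measure
    (volume_restrict_cyl_mono (Ioo (-L) L) r)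
  have hm2 := (memLp_cyl_of_continuous (continuous_corrector hB i j) (-L) L r
    (ENNReal.ofReal p)).const_mul h
  refine (eLpNorm_add_le hm1.1 hm2.1 (by rw [ENNReal.one_le_ofReal]; exact hp₁.le)).trans ?_
  refine add_le_add ?_ ?_
  · rw [hPdef, ← eLpNorm_comp_axialScale (mem_Ioi.1 hh) hp0]
    exact eLpNorm_mono_measure _ (volume_restrict_cyl_mono _ r)
  · refine (eLpNorm_const_smul_le (c := h) (f := fun x => corrector B x i j)).trans_eq ?_
    rw [Real.enorm_of_nonneg (mem_Ioi.1 hh).le]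

/-- The energy of the squeezed transition field is `h` times that of the transition field; the
oscillation lies in the wells, and its corrector contributes only `O(h²)`. -/
theorem exists_energy_recoveryField_le (hC₂ : 0 < C₂)
    (hW₁ : IsEnergyDensity p C₁ C₂ SO3 W₁) (hW₂ : IsEnergyDensity p C₁ C₂ (SO3mul H) W₂)
    (hM : 0 < M) (hTl : ∀ᵐ x ∂(volume.restrict (cyl (Iio (-M)) r)), T x = 1)
    (hTr : ∀ᵐ x ∂(volume.restrict (cyl (Ioi M) r)), T x = H)
    (hB : ∀ i j, ContDiff ℝ ∞ fun t => B t i j) (hB0 : ∀ t, |t| < δ → B t = 0)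
    (hB1 : ∀ t < 0, 1 + B t ∈ SO3) (hB2 : ∀ t, 0 ≤ t → H + B t ∈ SO3mul H) :
    ∃ K : ENNReal, K ≠ ⊤ ∧ ∀ h, 0 < h → h * M < δ →
      ENNReal.ofReal (1 / h) * energy W₁ W₂ (Ioo (-L) L) r (recoveryField T B h) ≤
        energy W₁ W₂ (Ioo (-M) M) r T + ENNReal.ofReal h * K := by
  have hΩ := measurableSet_cyl (I := Ioo (-L) L) measurableSet_Ioo r
  have hfin := isFiniteMeasure_cyl (-L) L r
  choose κ hκ0 hκ using fun i j => exists_bound_cyl (continuous_corrector hB i j) (-L) L r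
  set N := ∑ i, ∑ j, κ i j
  have hN0 : 0 ≤ N := Finset.sum_nonneg fun i _ => Finset.sum_nonneg fun j _ => hκ0 i j
  refine ⟨ENNReal.ofReal (C₂ * N ^ 2) * volume (cyl (Ioo (-L) L) r), ?_, fun h hh hhM => ?_⟩
  · refine ENNReal.mul_ne_top ENNReal.ofReal_ne_top ?_
    rw [← Measure.restrict_apply_univ]
    exact measure_ne_top _ _
  have hnorm : ∀ x ∈ cyl (Ioo (-L) L) r, ‖h • corrector B x‖ ≤ h * N := by
    intro x hx
    refine (norm_le_sum_abs_entry _).trans ?_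
    rw [Finset.mul_sum]
    refine Finset.sum_le_sum fun i _ => ?_
    rw [Finset.mul_sum]
    refine Finset.sum_le_sum fun j _ => ?_
    rw [Matrix.smul_apply, smul_eq_mul, abs_mul, abs_of_pos hh]
    exact mul_le_mul_of_nonneg_left (hκ i j x hx) hh.le
  let f : Space3 → ENNReal := fun x => ENNReal.ofReal (density W₁ W₂ x (T x))
  let s : Set Space3 := axialScale h⁻¹ ⁻¹' cyl (Ioo (-M) M) r
  have hs : MeasurableSet s := (measurableEmbedding_axialScale (inv_ne_zero hh.ne')).measurable
    (measurableSet_cyl measurableSet_Ioo r)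
  have hqmp : Measure.QuasiMeasurePreserving (axialScale h⁻¹) volume volume := by
    refine ⟨(measurableEmbedding_axialScale (inv_ne_zero hh.ne')).measurable, ?_⟩
    rw [map_axialScale (inv_ne_zero hh.ne')]
    exact Measure.smul_absolutelyContinuous
  have hl := hqmp.ae ((ae_restrict_iff' (measurableSet_cyl measurableSet_Iio r)).1 hTl)
  have hr := hqmp.ae ((ae_restrict_iff' (measurableSet_cyl measurableSet_Ioi r)).1 hTr)
  have hne : ∀ a : ℝ, ∀ᵐ x : Space3, (axialScale h⁻¹ x).1 ≠ a := fun a =>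
    hqmp.ae (Measure.quasiMeasurePreserving_fst.ae (Measure.ae_ne volume a))
  have hsign : ∀ x : Space3, (axialScale h⁻¹ x).1 < 0 ↔ x.1 < 0 := by
    intro x
    rw [axialScale, mul_comm, ← div_eq_mul_inv, div_lt_iff₀ hh, zero_mul]
  have hpt : ∀ᵐ x ∂(volume.restrict (cyl (Ioo (-L) L) r)),
      ENNReal.ofReal (density W₁ W₂ x (recoveryField T B h x)) ≤
        s.indicator (fun x => f (axialScale h⁻¹ x)) x +
          ENNReal.ofReal (h ^ 2 * (C₂ * N ^ 2)) := by
    refine (ae_restrict_iff' hΩ).2 ?_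
    filter_upwards [hl, hr, hne M, hne (-M)] with x hxl hxr hx1 hx2 hx
    by_cases hxs : x ∈ s
    · -- In the transition layer neither the oscillation nor its corrector is present.
      have h1 : |x.1| < δ := by
        have h2 : |h⁻¹ * x.1| < M := abs_lt.2 hxs.1
        rw [abs_mul, abs_of_pos (inv_pos.2 hh), inv_mul_lt_iff₀ hh] at h2
        linarith
      rw [indicator_of_mem hxs, recoveryField, hB0 x.1 h1, corrector_eq_zero hB0 h1, smul_zero,
        add_zero, add_zero]
      simp only [f, density, hsign]
      exact le_self_add
    · rw [indicator_of_notMem hxs, zero_add]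
      refine ENNReal.ofReal_le_ofReal ?_
      have hsq : C₂ * ‖h • corrector B x‖ ^ 2 ≤ h ^ 2 * (C₂ * N ^ 2) := by
        have h3 := pow_le_pow_left₀ (norm_nonneg _) (hnorm x hx) 2
        calc C₂ * ‖h • corrector B x‖ ^ 2 ≤ C₂ * (h * N) ^ 2 := mul_le_mul_of_nonneg_left h3 hC₂.le
          _ = h ^ 2 * (C₂ * N ^ 2) := by ring
      have h5 : (axialScale h⁻¹ x).1 < -M ∨ M < (axialScale h⁻¹ x).1 := by
        by_contra h
        rw [not_or, not_lt, not_lt] at h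
        exact hxs ⟨⟨h.1.lt_of_ne' hx2, h.2.lt_of_ne hx1⟩, hx.2⟩
      refine le_trans ?_ hsq
      rcases h5 with h6 | h6
      · have h7 : x.1 < 0 := (hsign x).1 (by linarith)
        rw [density, if_pos h7, recoveryField, hxl ⟨h6, hx.2⟩]
        refine (hW₁.le_sq_norm hC₂ (hB1 x.1 h7)).trans_eq ?_
        rw [← add_assoc, add_sub_cancel_left]
      · have h7 : ¬ x.1 < 0 := fun h => by linarith [(hsign x).2 h]
        rw [density, if_neg h7, recoveryField, hxr ⟨h6, hx.2⟩]
        refine (hW₂.le_sq_norm hC₂ (hB2 x.1 (not_lt.1 h7))).trans_eq ?_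
        rw [← add_assoc, add_sub_cancel_left]
  have hE : energy W₁ W₂ (Ioo (-L) L) r (recoveryField T B h) ≤
      ENNReal.ofReal h * energy W₁ W₂ (Ioo (-M) M) r T +
        ENNReal.ofReal (h ^ 2 * (C₂ * N ^ 2)) * volume (cyl (Ioo (-L) L) r) := by
    refine (lintegral_mono_ae hpt).trans ?_
    rw [lintegral_add_right _ measurable_const, lintegral_const, Measure.restrict_apply_univ]
    refine add_le_add ?_ le_rfl
    rw [lintegral_indicator hs, Measure.restrict_restrict hs]
    refine (lintegral_mono_set inter_subset_left).trans_eq ?_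
    rw [setLIntegral_comp_axialScale (inv_ne_zero hh.ne'), inv_inv, abs_of_pos hh]
    rfl
  have hinv : ENNReal.ofReal (1 / h) * ENNReal.ofReal h = 1 := by
    rw [← ENNReal.ofReal_mul (by positivity), one_div, inv_mul_cancel₀ hh.ne', ENNReal.ofReal_one]
  have hinv2 : ENNReal.ofReal (1 / h) * ENNReal.ofReal (h ^ 2 * (C₂ * N ^ 2)) =
      ENNReal.ofReal h * ENNReal.ofReal (C₂ * N ^ 2) := by
    rw [← ENNReal.ofReal_mul (by positivity), ← ENNReal.ofReal_mul hh.le]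
    congr 1
    field_simp
  refine (mul_le_mul_right hE _).trans_eq ?_
  rw [mul_add, ← mul_assoc, hinv, one_mul, ← mul_assoc, hinv2, mul_assoc]

end Recovery

/-! ### Weak convergence and the diagonal sequence -/

/-- A diagonal choice: properties that hold at every level `n` for small `h` hold along a family
whose level tends to infinity as `h → 0⁺`. -/
theorem exists_diagonal {X : Type*} {P : ℝ → X → Prop} {Q : ℕ → ℝ → X → Prop}
    (hPQ : ∀ n, ∃ G : ℝ → X, (∀ h, 0 < h → P h (G h)) ∧ ∀ᶠ h in 𝓝[>] 0, Q n h (G h)) :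
    ∃ (G : ℝ → X) (N : ℝ → ℕ), Tendsto N (𝓝[>] 0) atTop ∧ (∀ h, 0 < h → P h (G h)) ∧
      ∀ᶠ h in 𝓝[>] 0, Q (N h) h (G h) := by
  classical
  choose G hP hQ using hPQ
  choose δ hδ hδQ using fun n => mem_nhdsGT_iff_exists_Ioo_subset.1 (hQ n)
  let N : ℝ → ℕ := fun h => Nat.findGreatest (fun n => h < δ n) ⌊1 / h⌋₊
  refine ⟨fun h => G (N h) h, N, ?_, fun h hh => hP _ h hh, ?_⟩
  · refine tendsto_atTop.2 fun m => ?_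
    have hm : (0 : ℝ) < 1 / (m + 1) := by positivity
    filter_upwards [Ioo_mem_nhdsGT (hδ m), Ioo_mem_nhdsGT hm] with h h1 h2
    refine Nat.le_findGreatest (Nat.le_floor ?_) h1.2
    have h3 := (lt_one_div h1.1 (by positivity)).1 h2.2
    linarith
  · filter_upwards [Ioo_mem_nhdsGT (hδ 0)] with h h1
    have h2 : h < δ (N h) := Nat.findGreatest_spec (P := fun n => h < δ n) (Nat.zero_le _) h1.2
    exact hδQ (N h) ⟨h1.1, h2⟩

theorem enorm_integral_mul_le {α : Type*} [MeasurableSpace α] {μ : Measure α} {p q : ENNReal}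
    [ENNReal.HolderTriple p q 1] {f g : α → ℝ} (hf : AEStronglyMeasurable f μ)
    (hg : AEStronglyMeasurable g μ) :
    ‖∫ x, f x * g x ∂μ‖ₑ ≤ eLpNorm f p μ * eLpNorm g q μ := by
  refine (enorm_integral_le_lintegral_enorm _).trans ?_
  rw [← eLpNorm_one_eq_lintegral_enorm]
  exact eLpNorm_smul_le_mul_eLpNorm (p := p) (q := q) (r := 1) (f := g) (φ := f) hg hf

/-- Bounded functions whose primitives tend to zero uniformly tend to zero weakly: approximate the
test function by a smooth one and integrate by parts. -/
theorem tendsto_integral_mul_of_primitive {L K : ℝ} (hL : 0 < L) {g : ℕ → ℝ → ℝ}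
    (hgm : ∀ n, AEStronglyMeasurable (g n) (volume.restrict (Ioo (-L) L)))
    (hgK : ∀ n, ∀ᵐ t ∂(volume.restrict (Ioo (-L) L)), |g n t| ≤ K)
    (hprim : ∀ n : ℕ, ∀ t ∈ Icc (-L) L, |∫ s in (-L)..t, g n s| ≤ 1 / ((n : ℝ) + 1))
    {ψ : ℝ → ℝ} (hψ : IntegrableOn ψ (Ioo (-L) L)) :
    Tendsto (fun n => ∫ t in Ioo (-L) L, g n t * ψ t) atTop (𝓝 0) := by
  have hLL : -L ≤ L := by linarith
  have hK0 : 0 ≤ K := by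
    have : NeZero (volume.restrict (Ioo (-L) L)) := ⟨by
      rw [Ne, Measure.restrict_eq_zero, Real.volume_Ioo, ENNReal.ofReal_eq_zero]
      linarith⟩
    obtain ⟨t, ht⟩ := (hgK 0).exists
    exact (abs_nonneg _).trans ht
  rw [Metric.tendsto_atTop]
  intro ε hε
  obtain ⟨φ, hφc, hφ, hφd⟩ := (memLp_one_iff_integrable.2 hψ).exist_eLpNorm_sub_le
    ENNReal.one_ne_top le_rfl (ε := ε / (2 * (K + 1))) (by positivity)
  have hφ1 : ContDiff ℝ 1 φ := hφ.of_le (by simp)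
  have hφi : IntegrableOn φ (Ioo (-L) L) :=
    (hφ.continuous.integrable_of_hasCompactSupport hφc).integrableOn
  have hdist : ∫ t in Ioo (-L) L, |ψ t - φ t| ≤ ε / (2 * (K + 1)) := by
    rw [eLpNorm_one_eq_lintegral_enorm] at hφd
    have h1 := integral_norm_eq_lintegral_enorm (hψ.sub hφi).1
    have h2 := ENNReal.toReal_mono ENNReal.ofReal_ne_top hφd
    rw [← h1, ENNReal.toReal_ofReal (by positivity)] at h2
    exact h2
  have hdc : Continuous (deriv φ) := hφ1.continuous_deriv le_rfl
  set κ := |φ L| + ∫ s in (-L)..L, |deriv φ s| with hκ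
  have hκ0 : 0 ≤ κ :=
    add_nonneg (abs_nonneg _) (intervalIntegral.integral_nonneg hLL fun _ _ => abs_nonneg _)
  have hgi : ∀ n, IntervalIntegrable (g n) volume (-L) L := by
    intro n
    rw [intervalIntegrable_iff_integrableOn_Ioo_of_le hLL]
    exact Integrable.of_bound (hgm n) K (hgK n)
  -- Integration by parts.
  have hparts : ∀ n : ℕ, |∫ t in Ioo (-L) L, g n t * φ t| ≤ 1 / ((n : ℝ) + 1) * κ := by
    intro n
    let Γ : ℝ → ℝ := fun t => ∫ s in (-L)..t, g n s
    have hΓ : AbsolutelyContinuousOnInterval Γ (-L) L :=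
      (hgi n).absolutelyContinuousOnInterval_intervalIntegral left_mem_uIcc
    have hIBP := (hφ1.contDiffOn (s := uIcc (-L) L)).absolutelyContinuousOnInterval
      |>.integral_mul_deriv_eq_deriv_mul hΓ
    have h0 : Γ (-L) = 0 := intervalIntegral.integral_same
    have h1 : ∫ t in (-L)..L, φ t * deriv Γ t = ∫ t in Ioo (-L) L, g n t * φ t := by
      have h2 : ∫ t in (-L)..L, φ t * deriv Γ t = ∫ t in (-L)..L, g n t * φ t := by
        refine intervalIntegral.integral_congr_ae ?_
        filter_upwards [(hgi n).ae_hasDerivAt_integral] with t ht hmem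
        rw [(ht (uIoc_subset_uIcc hmem) (-L) left_mem_uIcc).deriv, mul_comm]
      rw [h2, intervalIntegral.integral_of_le hLL, integral_Ioc_eq_integral_Ioo]
    rw [h1, h0, mul_zero, sub_zero] at hIBP
    rw [hIBP, hκ, mul_add]
    refine (abs_sub _ _).trans (add_le_add ?_ ?_)
    · rw [abs_mul, mul_comm]
      exact mul_le_mul_of_nonneg_right (hprim n L ⟨hLL, le_rfl⟩) (abs_nonneg _)
    · rw [← intervalIntegral.integral_const_mul]
      refine intervalIntegral.norm_integral_le_of_norm_le (μ := volume)
        (f := fun t => deriv φ t * Γ t) hLL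
        (g := fun t => 1 / ((n : ℝ) + 1) * |deriv φ t|) (Eventually.of_forall fun t ht => ?_)
        ((continuous_const.mul hdc.abs).intervalIntegrable _ _)
      rw [norm_mul, mul_comm]
      exact mul_le_mul_of_nonneg_right (hprim n t ⟨ht.1.le, ht.2⟩) (norm_nonneg _)
  have hmul : ∀ n {χ : ℝ → ℝ}, IntegrableOn χ (Ioo (-L) L) →
      IntegrableOn (fun t => g n t * χ t) (Ioo (-L) L) := fun n χ hχ =>
    Integrable.bdd_mul hχ (hgm n) (hgK n)
  obtain ⟨n₀, hn₀⟩ := exists_nat_gt (2 * κ / ε)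
  refine ⟨n₀, fun n hn => ?_⟩
  rw [Real.dist_0_eq_abs]
  have hsplit : ∫ t in Ioo (-L) L, g n t * ψ t =
      (∫ t in Ioo (-L) L, g n t * (ψ t - φ t)) + ∫ t in Ioo (-L) L, g n t * φ t := by
    have hsub : IntegrableOn (fun t => ψ t - φ t) (Ioo (-L) L) := hψ.sub hφi
    rw [← integral_add (hmul n hsub) (hmul n hφi)]
    simp only [mul_sub, sub_add_cancel]
  have hfirst : |∫ t in Ioo (-L) L, g n t * (ψ t - φ t)| ≤ ε / 2 := by
    have h1 : ‖∫ t in Ioo (-L) L, g n t * (ψ t - φ t)‖ ≤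
        ∫ t in Ioo (-L) L, K * |ψ t - φ t| := by
      refine norm_integral_le_of_norm_le ((hψ.sub hφi).abs.const_mul K) ?_
      filter_upwards [hgK n] with t ht
      rw [norm_mul]
      exact mul_le_mul_of_nonneg_right ht (norm_nonneg _)
    rw [integral_const_mul] at h1
    refine h1.trans ((mul_le_mul_of_nonneg_left hdist hK0).trans ?_)
    rw [mul_div_assoc', div_le_div_iff₀ (by positivity) two_pos]
    nlinarith
  have hsecond : 1 / ((n : ℝ) + 1) * κ < ε / 2 := by
    have h1 : (n₀ : ℝ) ≤ n := by exact_mod_cast hn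
    rw [div_lt_iff₀ hε] at hn₀
    rw [one_div_mul_eq_div, div_lt_div_iff₀ (by positivity) two_pos]
    nlinarith
  rw [hsplit]
  exact (abs_add_le _ _).trans_lt (by linarith [hparts n])

/-- Weak convergence on the cylinder of functions of the axial variable. -/
theorem tendsto_integral_cyl_of_primitive {L K r : ℝ} (hL : 0 < L) {g : ℕ → ℝ → ℝ}
    (hgm : ∀ n, AEStronglyMeasurable (g n) (volume.restrict (Ioo (-L) L)))
    (hgK : ∀ n, ∀ᵐ t ∂(volume.restrict (Ioo (-L) L)), |g n t| ≤ K)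
    (hprim : ∀ n : ℕ, ∀ t ∈ Icc (-L) L, |∫ s in (-L)..t, g n s| ≤ 1 / ((n : ℝ) + 1))
    {Φ : Space3 → ℝ} (hΦ : IntegrableOn Φ (cyl (Ioo (-L) L) r)) :
    Tendsto (fun n => ∫ x in cyl (Ioo (-L) L) r, g n x.1 * Φ x) atTop (𝓝 0) := by
  have hμ : (volume : Measure Space3).restrict (cyl (Ioo (-L) L) r) =
      (volume.restrict (Ioo (-L) L)).prod (volume.restrict (disk r)) := by
    rw [Measure.prod_restrict]
    rfl
  rw [IntegrableOn, hμ] at hΦ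
  have h := tendsto_integral_mul_of_primitive hL hgm hgK hprim hΦ.integral_prod_left
  refine h.congr fun n => ?_
  rw [hμ, integral_prod]
  · simp only [integral_const_mul]
  · exact hΦ.bdd_mul (hgm n).comp_fst (Measure.quasiMeasurePreserving_fst.ae (hgK n))

theorem abs_entry_le_of_mem_convexHull {K : ℝ} {S : Set Mat3} {i j : Fin 3}
    (hS : ∀ A ∈ S, |A i j| ≤ K) {A : Mat3} (hA : A ∈ convexHull ℝ S) : |A i j| ≤ K := by
  have h1 : Convex ℝ {A : Mat3 | A i j ∈ Icc (-K) K} :=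
    (convex_Icc (-K) K).linear_preimage (Matrix.entryLinearMap ℝ ℝ i j)
  exact abs_le.2 (convexHull_min (fun A hA => abs_le.1 (hS A hA)) h1 hA)

theorem theorem5p1
    (L r p : ℝ) (hL : 0 < L) (hr : 0 < r) (hp₁ : 1 < p) (hp₂ : p < 2)
    (b : EuclideanSpace ℝ (Fin 3)) (hb : ‖b‖ = 1)
    (ℓ : ℝ) (c : ℝ → Plane) (hΓ : IsDislocationCurve r ℓ c)
    (H : Mat3) (hH : 0 < H.det)
    (C₁ C₂ : ℝ) (hC₁ : 0 < C₁) (hC₂ : 0 < C₂)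
    (W₁ W₂ : Mat3 → ℝ)
    (hW₁ : IsEnergyDensity p C₁ C₂ SO3 W₁)
    (hW₂ : IsEnergyDensity p C₁ C₂ (SO3mul H) W₂)
    (F : ℝ → Mat3)
    (hF : MemLp F (ENNReal.ofReal p) (volume.restrict (Ioo (-L) L)))
    (hFneg : ∀ᵐ t ∂(volume.restrict (Ioo (-L) 0)), F t ∈ convexHull ℝ SO3)
    (hFpos : ∀ᵐ t ∂(volume.restrict (Ioo 0 L)), F t ∈ convexHull ℝ (SO3mul H)) :
    ∃ G : ℝ → Space3 → Mat3,
      (∀ h : ℝ, 0 < h → G h ∈ AdmissibleField L r p b ℓ c h) ∧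
      WeakLpConverges (cyl (Ioo (-L) L) r) p (fun h x => rescale h (G h x)) (fun x => F x.1) ∧
      limsup (fun h : ℝ => ENNReal.ofReal (1 / h) *
          energy W₁ W₂ (Ioo (-L) L) r (fun x => rescale h (G h x))) (𝓝[>] 0)
        ≤ transitionCost r p W₁ W₂ b ℓ c 1 H := by
  set μ : Measure Space3 := volume.restrict (cyl (Ioo (-L) L) r) with hμ
  have hμfin : IsFiniteMeasure μ := isFiniteMeasure_cyl (-L) L r
  set cost := transitionCost r p W₁ W₂ b ℓ c 1 H with hcost
  have hcost_top : cost < ⊤ := transitionCost_lt_top hr hΓ hW₁ hW₂ hC₂ hp₁ hp₂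
  have hFi : ∀ i j, IntegrableOn (fun t => F t i j) (Ioo (-L) L) := fun i j =>
    (memLp_iff_entries.1 hF i j).integrable (by rw [ENNReal.one_le_ofReal]; exact hp₁.le)
  let ε : ℕ → ℝ := fun n => 1 / ((n : ℝ) + 1)
  have hε : ∀ n, 0 < ε n := fun n => by positivity
  have hε0 : Tendsto (fun n => ENNReal.ofReal (ε n)) atTop (𝓝 0) := by
    have := ENNReal.tendsto_ofReal tendsto_one_div_add_atTop_nhds_zero_nat
    rwa [ENNReal.ofReal_zero] at this
  choose B hBs hB0 hBl hBr hBp using fun n => exists_oscillation hL H hFi hFneg hFpos (hε n)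
  let A : ℕ → ℝ → Mat3 := fun n t => restState H t + B n t
  have hAm : ∀ n i j, Measurable fun t => A n t i j := fun n i j =>
    (measurable_restState H i j).add (hBs n i j).continuous.measurable
  -- The oscillating fields and their limit are uniformly bounded.
  obtain ⟨K, hK1, hKA⟩ : ∃ K : ℝ, 1 ≤ K ∧ ∀ A' ∈ SO3mul H, ∀ i j, |A' i j| ≤ K := by
    refine ⟨1 + 9 * ∑ i, ∑ j, |H i j|, ?_, fun A' hA' i j => ?_⟩
    · have : 0 ≤ ∑ i, ∑ j, |H i j| := by positivity
      linarith
    · linarith [(abs_entry_le_norm A' i j).trans (norm_le_of_mem_SO3mul hA')]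
  have hAK : ∀ n t i j, |A n t i j| ≤ K := by
    intro n t i j
    rcases lt_or_ge t 0 with ht | ht
    · have h1 : A n t = 1 + B n t := by simp only [A, restState, if_pos ht]
      rw [h1]
      exact (abs_entry_le_of_mem_SO3 (hBl n t ht) i j).trans hK1
    · have h1 : A n t = H + B n t := by simp only [A, restState, if_neg (not_lt.2 ht)]
      rw [h1]
      exact hKA _ (hBr n t ht) i j
  have hFK : ∀ i j, ∀ᵐ t ∂(volume.restrict (Ioo (-L) L)), |F t i j| ≤ K := by
    intro i j
    refine (ae_restrict_iff' measurableSet_Ioo).2 ?_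
    filter_upwards [(ae_restrict_iff' measurableSet_Ioo).1 hFneg,
      (ae_restrict_iff' measurableSet_Ioo).1 hFpos, Measure.ae_ne volume (0 : ℝ)] with t h1 h2 h3 ht
    rcases h3.lt_or_gt with h | h
    · exact abs_entry_le_of_mem_convexHull
        (fun A' hA' => (abs_entry_le_of_mem_SO3 hA' i j).trans hK1) (h1 ⟨ht.1, h⟩)
    · exact abs_entry_le_of_mem_convexHull (fun A' hA' => hKA A' hA' i j) (h2 ⟨h, ht.2⟩)
  have hlevel : ∀ n, ∃ G : ℝ → Space3 → Mat3,
      (∀ h, 0 < h → G h ∈ AdmissibleField L r p b ℓ c h ∧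
        ∀ i j, MemLp (fun x => rescale h (G h x) i j) (ENNReal.ofReal p) μ) ∧
      ∀ᶠ h in 𝓝[>] 0, (∀ i j, eLpNorm (fun x => (rescale h (G h x) - A n x.1) i j)
          (ENNReal.ofReal p) μ ≤ ENNReal.ofReal (ε n)) ∧
        ENNReal.ofReal (1 / h) * energy W₁ W₂ (Ioo (-L) L) r (fun x => rescale h (G h x)) ≤
          cost + ENNReal.ofReal (ε n) + ENNReal.ofReal (ε n) := by
    intro n
    have hlt : cost < cost + ENNReal.ofReal (ε n) :=
      ENNReal.lt_add_right hcost_top.ne (ENNReal.ofReal_pos.2 (hε n)).ne'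
    rw [hcost] at hlt
    nth_rewrite 1 [transitionCost] at hlt
    simp only [iInf_lt_iff] at hlt
    obtain ⟨M, hM, T, hT, hTE⟩ := hlt
    have hTP := memLp_sub_restState hW₁ hW₂ hC₁ hp₁ hp₂ hM hT (hTE.trans_le le_top)
    obtain ⟨δ, hδ, hδ0⟩ := hB0 n
    obtain ⟨κ, hκ, hE⟩ := exists_energy_recoveryField_le (L := L) hC₂ hW₁ hW₂ hM hT.2.1 hT.2.2
      (hBs n) hδ0 (hBl n) (hBr n)
    refine ⟨fun h x => unrescale h (recoveryField T (B n) h x), fun h hh => ⟨?_, fun i j => ?_⟩, ?_⟩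
    · exact unrescale_recoveryField_mem hp₁ hh (hBs n) hT.1.2 hTP
    · simp only [rescale_unrescale hh.ne']
      exact memLp_recoveryField hh (hBs n) hTP i j
    have hev1 : ∀ᶠ h in 𝓝[>] (0 : ℝ), ∀ i j,
        eLpNorm (fun x => (recoveryField T (B n) h x - A n x.1) i j) (ENNReal.ofReal p) μ ≤
          ENNReal.ofReal (ε n) := by
      refine eventually_all.2 fun i => eventually_all.2 fun j => ?_
      exact ((tendsto_eLpNorm_recoveryField_sub (L := L) hp₁ (hBs n) hTP i j).eventually_lt_const
        (ENNReal.ofReal_pos.2 (hε n))).mono fun h hh => hh.le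
    have hev2 : ∀ᶠ h in 𝓝[>] (0 : ℝ), ENNReal.ofReal h * κ < ENNReal.ofReal (ε n) := by
      have h1 : Tendsto (fun h : ℝ => h) (𝓝[>] 0) (𝓝 0) := nhdsWithin_le_nhds
      have h2 := ENNReal.Tendsto.mul_const (ENNReal.tendsto_ofReal h1) (Or.inr hκ)
      rw [ENNReal.ofReal_zero, zero_mul] at h2
      exact h2.eventually_lt_const (ENNReal.ofReal_pos.2 (hε n))
    filter_upwards [hev1, hev2, Ioo_mem_nhdsGT (div_pos hδ hM)] with h h1 h2 h3
    have hh : 0 < h := h3.1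
    simp only [rescale_unrescale hh.ne']
    refine ⟨h1, (hE h hh ((lt_div_iff₀ hM).1 h3.2)).trans (add_le_add hTE.le h2.le)⟩
  obtain ⟨G, N, hN, hG, hQ⟩ := exists_diagonal
    (P := fun h g => g ∈ AdmissibleField L r p b ℓ c h ∧
      ∀ i j, MemLp (fun x => rescale h (g x) i j) (ENNReal.ofReal p) μ)
    (Q := fun n h g => (∀ i j, eLpNorm (fun x => (rescale h (g x) - A n x.1) i j)
        (ENNReal.ofReal p) μ ≤ ENNReal.ofReal (ε n)) ∧
      ENNReal.ofReal (1 / h) * energy W₁ W₂ (Ioo (-L) L) r (fun x => rescale h (g x)) ≤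
        cost + ENNReal.ofReal (ε n) + ENNReal.ofReal (ε n)) hlevel
  have hFμ : ∀ i j, MemLp (fun x : Space3 => F x.1 i j) (ENNReal.ofReal p) μ := by
    intro i j
    have hprod : μ = (volume.restrict (Ioo (-L) L)).prod (volume.restrict (disk r)) := by
      rw [Measure.prod_restrict]
      rfl
    rw [hprod]
    have hfin : IsFiniteMeasure ((volume : Measure Plane).restrict (disk r)) :=
      ⟨by rw [Measure.restrict_apply_univ]; exact measure_ball_lt_top⟩
    exact (memLp_iff_entries.1 hF i j).comp_fst _
  refine ⟨G, fun h hh => (hG h hh).1, ⟨fun h hh => memLp_iff_entries.2 (hG h hh).2,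
    memLp_iff_entries.2 hFμ, fun Φ hΦ => ?_⟩, ?_⟩
  · have hconj : ENNReal.HolderConjugate (ENNReal.ofReal p) (ENNReal.ofReal (p / (p - 1))) :=
      (Real.HolderConjugate.conjExponent hp₁).ennrealOfReal
    have hq1 : 1 ≤ ENNReal.ofReal (p / (p - 1)) := by
      rw [ENNReal.one_le_ofReal, one_le_div (by linarith)]
      linarith
    have hΦe := memLp_iff_entries.1 hΦ
    have hAμ : ∀ n i j, MemLp (fun x : Space3 => A n x.1 i j) (ENNReal.ofReal p) μ := fun n i j =>
      MemLp.of_bound ((hAm n i j).comp measurable_fst).aestronglyMeasurable K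
        (Eventually.of_forall fun x => hAK n x.1 i j)
    have hmul : ∀ {f : Space3 → ℝ}, MemLp f (ENNReal.ofReal p) μ → ∀ i j,
        Integrable (fun x => f x * Φ x i j) μ := fun hf i j => hf.integrable_mul (hΦe i j)
    have hentry : ∀ i j, Tendsto (fun h => ∫ x, rescale h (G h x) i j * Φ x i j ∂μ) (𝓝[>] 0)
        (𝓝 (∫ x, F x.1 i j * Φ x i j ∂μ)) := by
      intro i j
      -- The oscillating fields converge weakly,
      have hosc : Tendsto (fun n => ∫ x, (A n x.1 i j - F x.1 i j) * Φ x i j ∂μ) atTop (𝓝 0) := by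
        refine tendsto_integral_cyl_of_primitive (K := K + K) hL
          (g := fun n t => A n t i j - F t i j)
          (fun n => (hAm n i j).aestronglyMeasurable.sub (hFi i j).1) (fun n => ?_)
          (fun n t ht => hBp n t ht i j) ((hΦe i j).integrable hq1)
        filter_upwards [hFK i j] with t ht
        exact (abs_sub _ _).trans (add_le_add (hAK n t i j) ht)
      -- and the recovery sequence stays close to them in `L^p`.
      have hclose : Tendsto (fun h => ∫ x, (rescale h (G h x) - A (N h) x.1) i j * Φ x i j ∂μ)
          (𝓝[>] 0) (𝓝 0) := by
        rw [tendsto_iff_enorm_sub_tendsto_zero]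
        have h1 := ENNReal.Tendsto.mul_const (hε0.comp hN) (Or.inr (hΦe i j).2.ne)
        rw [zero_mul] at h1
        refine tendsto_of_tendsto_of_tendsto_of_le_of_le' tendsto_const_nhds h1
          (Eventually.of_forall fun _ => zero_le) ?_
        filter_upwards [hQ, self_mem_nhdsWithin] with h hh hh0
        rw [sub_zero]
        refine (enorm_integral_mul_le (p := ENNReal.ofReal p) (q := ENNReal.ofReal (p / (p - 1)))
          ?_ (hΦe i j).1).trans ?_
        · exact ((hG h hh0).2 i j).1.sub (hAμ _ i j).1
        · exact mul_le_mul_left (hh.1 i j) _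
      have hsum := (hclose.add (hosc.comp hN)).add_const (∫ x, F x.1 i j * Φ x i j ∂μ)
      rw [add_zero, zero_add] at hsum
      refine hsum.congr' ?_
      filter_upwards [self_mem_nhdsWithin] with h hh
      have hD : MemLp (fun x => (rescale h (G h x) - A (N h) x.1) i j) (ENNReal.ofReal p) μ :=
        ((hG h hh).2 i j).sub (hAμ _ i j)
      have hD' : MemLp (fun x => A (N h) x.1 i j - F x.1 i j) (ENNReal.ofReal p) μ :=
        (hAμ _ i j).sub (hFμ i j)
      simp only [Function.comp_apply]
      have hint : Integrable (fun x => (rescale h (G h x) - A (N h) x.1) i j * Φ x i j +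
          (A (N h) x.1 i j - F x.1 i j) * Φ x i j) μ := (hmul hD i j).add (hmul hD' i j)
      rw [← integral_add (hmul hD i j) (hmul hD' i j), ← integral_add hint (hmul (hFμ i j) i j)]
      refine integral_congr_ae (Eventually.of_forall fun x => ?_)
      simp only [Matrix.sub_apply]
      ring
    have hall : ∀ {f : Space3 → Mat3}, (∀ i j, MemLp (fun x => f x i j) (ENNReal.ofReal p) μ) →
        ∫ x, ∑ i, ∑ j, f x i j * Φ x i j ∂μ = ∑ i, ∑ j, ∫ x, f x i j * Φ x i j ∂μ := by
      intro f hf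
      rw [integral_finsetSum _ fun i _ => integrable_finsetSum _ fun j _ => hmul (hf i j) i j]
      refine Finset.sum_congr rfl fun i _ => ?_
      rw [integral_finsetSum _ fun j _ => hmul (hf i j) i j]
    rw [hall hFμ]
    refine (tendsto_finsetSum _ fun i _ => tendsto_finsetSum _ fun j _ => hentry i j).congr' ?_
    filter_upwards [self_mem_nhdsWithin] with h hh
    exact (hall (hG h hh).2).symm
  · have hlim : Tendsto (fun h => cost + ENNReal.ofReal (ε (N h)) + ENNReal.ofReal (ε (N h)))
        (𝓝[>] 0) (𝓝 cost) := by
      have h1 := (tendsto_const_nhds (x := cost)).add (hε0.comp hN)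
      have h2 := h1.add (hε0.comp hN)
      rwa [add_zero, add_zero] at h2
    rw [← hlim.limsup_eq]
    exact limsup_le_limsup (hQ.mono fun h hh => hh.2)
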